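/- **Setting.** Let $M$ be a smooth $m$-dimensional manifold with a volume form $\eta$ and let $\pi\colon E\to M$ be a smooth bundle with $\dim E=m+n$. Charts of $E$ adapted to $\pi$ give coordinates $(x^i,u^\alpha)$ on $E$ and natural coordinates $(x^i,u^\alpha_I)$, $|I|\le k$, on the jet bundles $J^k\pi$; we write $u_i^\alpha=u^\alpha_{1_i}$, and $n(ij)=1$ if $i=j$, $n(ij)=2$ if $i\ne j$. In sums over $I$ for the momenta, $|I|=2$. Let $J^2\pi^\dagger\to J^1\pi$ be the bundle of $m$-forms at the points of $J^1\pi$ that vanish whenever two of their arguments are vertical over $M$ and have the form $$p\,d^mx+p^i_\alpha\,du^\alpha\wedge d^{m-1}x_i+p^{ij}_\alpha\,du_i^\alpha\wedge d^{m-1}x_j,\qquad p^{ij}_\alpha=p^{ji}_\alpha ,\qquad d^{m-1}x_i=i(\partial/\partial x^i)d^mx,$$ with coordinates $(x^i,u^\alpha,u^\alpha_i,p,p^i_\alpha,p^I_\alpha)$, $p^{1_i+1_j}_\alpha=n(ij)\,p^{ij}_\alpha$, and let $J^2\pi^\ddagger$ be its quotient by the forms $p\,d^mx$, with coordinates $(x^i,u^\alpha,u^\alpha_i,p^i_\alpha,p^I_\alpha)$.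 Let $\Theta_1^s$ be the tautological $m$-form of $J^2\pi^\dagger$ and $\Omega_1^s=-d\Theta_1^s$. Put $\mathcal W=J^3\pi\times_{J^1\pi}J^2\pi^\dagger$ and $\mathcal W_r=J^3\pi\times_{J^1\pi}J^2\pi^\ddagger$, with projections $\rho_2\colon\mathcal W\to J^2\pi^\dagger$, $\rho_1^r\colon\mathcal W_r\to J^3\pi$, $\rho_2^r\colon\mathcal W_r\to J^2\pi^\ddagger$ and $\mu_{\mathcal W}\colon\mathcal W\to\mathcal W_r$. Let $\mathcal L=L\,\eta$ be a second-order Lagrangian density, with $L\in C^\infty(J^2\pi)$; in natural coordinates write $\mathcal L=\hat L\,d^mx$. Let $\mathcal W_o\subset\mathcal W$ be the set of the points $(j^3_x\phi,\omega)$ with $(j^1\phi)^*_x\omega=\mathcal L(j^2_x\phi)$; $\mu_{\mathcal W}$ restricts to a bijection $\mathcal W_o\to\mathcal W_r$, whose inverse is a section $\hat h\colon\mathcal W_r\to\mathcal W$ of $\mu_{\mathcal W}$. Put $\Omega_r=(\rho_2\circ\hat h)^*\Omega_1^s$. A section $\psi$ of $\mathcal W_r\to M$ is *holonomic* if $\rho_1^r\circ\psi=j^3\phi$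 for $\phi=\pi^3\circ\rho_1^r\circ\psi$, where $\pi^3\colon J^3\pi\to E$, and it solves the *unified equation* if $\psi^*i(X)\Omega_r=0$ for all $X\in\mathfrak X(\mathcal W_r)$. The restricted Legendre map $\mathcal{FL}\colon J^3\pi\to J^2\pi^\ddagger$ is the map over $J^1\pi$ with $$p^i_\alpha=\frac{\partial\hat L}{\partial u^\alpha_i}-\sum_{j=1}^m\frac1{n(ij)}\frac{d}{dx^j}\frac{\partial\hat L}{\partial u^\alpha_{1_i+1_j}},\qquad p^I_\alpha=\frac{\partial\hat L}{\partial u^\alpha_I},$$ and the extended Legendre map $\widetilde{\mathcal{FL}}\colon J^3\pi\to J^2\pi^\dagger$ is $a\mapsto\rho_2(\hat h(a,\mathcal{FL}(a)))$. Assume that $\mathcal L$ is *hyperregular*: $\mathcal{FL}$ has a smooth global section $\Upsilon\colon J^2\pi^\ddagger\to J^3\pi$. Put $h=\widetilde{\mathcal{FL}}\circ\Upsilon\colon J^2\pi^\ddagger\to J^2\pi^\dagger$ and $\Omega_h=h^*\Omega_1^s$; in natural coordinates $h(x^i,u^\alpha,u^\alpha_i,p^i_\alpha,p^I_\alpha)=(x^i,u^\alpha,u^\alpha_i,-H,p^i_\alpha,p^I_\alpha)$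 with a local Hamiltonian function $H$. **Proposition.** Let $U\subseteq M$ be open (for instance $U=M$). 1. Let $\psi$ be a smooth holonomic section of $\mathcal W_r\to M$ over $U$ that solves the unified equation on $U$. Then $\psi_h=\rho_2^r\circ\psi$ is a smooth section of $J^2\pi^\ddagger\to M$ over $U$, it solves the Hamiltonian equation $$\psi_h^*\,i(X)\Omega_h=0\qquad\text{for all }X\in\mathfrak X(J^2\pi^\ddagger)$$ on $U$, and in every natural chart it satisfies the Hamilton–De Donder–Weyl equations $$\frac{\partial u^\alpha}{\partial x^i}=\frac{\partial H}{\partial p^i_\alpha},\qquad \sum_{1_i+1_j=I}\frac1{n(ij)}\frac{\partial u^\alpha_i}{\partial x^j}=\frac{\partial H}{\partial p^I_\alpha},$$ $$\sum_{i=1}^m\frac{\partial p^i_\alpha}{\partial x^i}=-\frac{\partial H}{\partial u^\alpha},\qquad \sum_{j=1}^m\frac1{n(ij)}\frac{\partial p^{1_i+1_j}_\alpha}{\partial x^j}=-\frac{\partial H}{\partial u^\alpha_i},$$ where the sum in the second equation is over the ordered pairs $(i,j)$ with $1_i+1_j=I$. 2. A smooth section of $J^2\pi^\ddagger\to M$ over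 $U$ solves the Hamiltonian equation on $U$ if and only if it satisfies these Hamilton–De Donder–Weyl equations in every natural chart. -/

import Mathlib

open scoped Manifold ContDiff Topology

noncomputable section

namespace FieldTheory

/-! ### Multi-indices and partial derivatives -/

/-- Multi-indices `I` of length `|I| ≤ k` in `m` variables. -/
abbrev MultiIndexLE (m k : ℕ) : Type := {I : Fin m → ℕ // ∑ i, I i ≤ k}

/-- Multi-indices `I` of length `|I| = 2` in `m` variables. -/
abbrev MultiIndexTwo (m : ℕ) : Type := {I : Fin m → ℕ // ∑ i, I i = 2}

instance (m k : ℕ) : Finite (MultiIndexLE m k) := by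
  refine Finite.of_injective
    (fun I : MultiIndexLE m k => fun i : Fin m => (⟨I.1 i, ?_⟩ : Fin (k + 1))) ?_
  · have h := Finset.single_le_sum (f := I.1) (fun _ _ => Nat.zero_le _) (Finset.mem_univ i)
    have := I.2
    omega
  · intro I J h
    ext i
    have := congrFun h i
    simpa using this

instance (m : ℕ) : Finite (MultiIndexTwo m) :=
  Finite.of_injective (fun I : MultiIndexTwo m => (⟨I.1, I.2.le⟩ : MultiIndexLE m 2))
    (fun I J h => by ext i; have := congrArg (fun K => K.1 i) h; simpa using this)

instance (m k : ℕ) : Fintype (MultiIndexLE m k) := Fintype.ofFinite _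
instance (m : ℕ) : Fintype (MultiIndexTwo m) := Fintype.ofFinite _

/-- The multi-index `0`. -/
def MultiIndexLE.zero (m k : ℕ) : MultiIndexLE m k := ⟨0, by simp⟩

/-- The multi-index `1_i`, of length one. -/
def MultiIndexLE.one {m : ℕ} (k : ℕ) (i : Fin m) : MultiIndexLE m (k + 1) :=
  ⟨Pi.single i 1, by simp⟩

/-- The multi-index `I + 1_i`. -/
def MultiIndexLE.succ {m k : ℕ} (I : MultiIndexLE m k) (i : Fin m) : MultiIndexLE m (k + 1) :=
  ⟨I.1 + Pi.single i 1, by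
    have := I.2
    simp only [Pi.add_apply, Finset.sum_add_distrib, Finset.sum_pi_single', Finset.mem_univ,
      if_true]
    omega⟩

/-- A multi-index of length at most `r` is one of length at most `k`, when `r ≤ k`. -/
def MultiIndexLE.castLE {m r k : ℕ} (h : r ≤ k) (I : MultiIndexLE m r) : MultiIndexLE m k :=
  ⟨I.1, I.2.trans h⟩

/-- The multi-index `1_i + 1_j`, of length two. -/
def MultiIndexTwo.pair {m : ℕ} (i j : Fin m) : MultiIndexTwo m :=
  ⟨Pi.single i 1 + Pi.single j 1, by
    simp [Finset.sum_add_distrib]⟩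

/-- A multi-index of length two, as one of length at most two. -/
def MultiIndexTwo.toLE {m : ℕ} (I : MultiIndexTwo m) : MultiIndexLE m 2 := ⟨I.1, I.2.le⟩

/-- `n(ij)`, which is `1` if `i = j` and `2` if `i ≠ j`. -/
def nn {m : ℕ} (i j : Fin m) : ℝ := if i = j then 1 else 2

section Partial

variable {m : ℕ} {W : Type*} [NormedAddCommGroup W] [NormedSpace ℝ W]

/-- The partial derivative `∂f/∂x^i`. -/
def pderiv (i : Fin m) (f : (Fin m → ℝ) → W) (y : Fin m → ℝ) : W :=
  fderiv ℝ f y (Pi.single i 1)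

/-- The list of the indices `i`, each one repeated `I i` times. -/
def dirs (I : Fin m → ℕ) : List (Fin m) :=
  (List.finRange m).flatMap fun i => List.replicate (I i) i

/-- Successive partial derivatives along a list of indices. -/
def lderiv (l : List (Fin m)) (f : (Fin m → ℝ) → W) : (Fin m → ℝ) → W := l.foldr pderiv f

/-- The partial derivative `∂^{|I|} f/∂x^I`. -/
def mpderiv (I : Fin m → ℕ) (f : (Fin m → ℝ) → W) : (Fin m → ℝ) → W := lderiv (dirs I) f

lemma natCast_le_infty (r : ℕ) : (r : ℕ∞ω) ≤ ∞ := by exact_mod_cast le_top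

lemma count_dirs (I : Fin m → ℕ) (j : Fin m) : (dirs I).count j = I j := by
  simp only [dirs, List.count_flatMap, List.count_replicate, Function.comp_def, beq_iff_eq]
  rw [← List.ofFn_eq_map, List.sum_ofFn]
  simp

lemma length_dirs (I : Fin m → ℕ) : (dirs I).length = ∑ i, I i := by
  simp only [dirs, List.length_flatMap, List.length_replicate]
  rw [← List.ofFn_eq_map, List.sum_ofFn]

lemma perm_dirs (l : List (Fin m)) : l.Perm (dirs fun i => l.count i) := by
  rw [List.perm_iff_count]
  intro a
  rw [count_dirs]

lemma sum_count (l : List (Fin m)) : ∑ i, l.count i = l.length := by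
  rw [← length_dirs, ← (perm_dirs l).length_eq]

variable {f g : (Fin m → ℝ) → W} {y : Fin m → ℝ}

lemma ContDiffAt.pderiv' (i : Fin m) (hf : ContDiffAt ℝ ∞ f y) :
    ContDiffAt ℝ ∞ (pderiv i f) y :=
  (hf.fderiv_right (m := ∞) (by simp)).clm_apply contDiffAt_const

lemma ContDiffAt.lderiv' (l : List (Fin m)) (hf : ContDiffAt ℝ ∞ f y) :
    ContDiffAt ℝ ∞ (lderiv l f) y := by
  induction l with
  | nil => exact hf
  | cons i l ih => exact ContDiffAt.pderiv' i ih

lemma pderiv_congr (i : Fin m) (h : f =ᶠ[𝓝 y] g) : pderiv i f =ᶠ[𝓝 y] pderiv i g := by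
  filter_upwards [h.fderiv (𝕜 := ℝ)] with z hz
  simp [pderiv, hz]

lemma lderiv_congr (l : List (Fin m)) (h : f =ᶠ[𝓝 y] g) : lderiv l f =ᶠ[𝓝 y] lderiv l g := by
  induction l with
  | nil => exact h
  | cons i l ih => exact pderiv_congr i ih

lemma pderiv_comm (i j : Fin m) (hf : ContDiffAt ℝ 2 f y) :
    pderiv i (pderiv j f) y = pderiv j (pderiv i f) y := by
  have hd : DifferentiableAt ℝ (fderiv ℝ f) y :=
    (hf.fderiv_right (m := 1) (by norm_num)).differentiableAt (by simp)
  have key : ∀ a b : Fin m, pderiv a (pderiv b f) y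
      = fderiv ℝ (fderiv ℝ f) y (Pi.single a 1) (Pi.single b 1) := by
    intro a b
    change fderiv ℝ (fun z => fderiv ℝ f z (Pi.single b 1)) y _ = _
    rw [fderiv_clm_apply hd (differentiableAt_const _)]
    simp
  rw [key, key]
  exact hf.isSymmSndFDerivAt (by simp) _ _

lemma lderiv_perm {l l' : List (Fin m)} (h : l.Perm l') (hf : ContDiffAt ℝ ∞ f y) :
    lderiv l f =ᶠ[𝓝 y] lderiv l' f := by
  induction h with
  | nil => exact Filter.EventuallyEq.rfl
  | cons i _ ih => exact pderiv_congr i ih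
  | swap i j l =>
    have h2 : ContDiffAt ℝ 2 (lderiv l f) y :=
      (ContDiffAt.lderiv' l hf).of_le (natCast_le_infty 2)
    filter_upwards [h2.eventually (by simp)] with z hz
    exact pderiv_comm _ _ hz
  | trans _ _ ih1 ih2 => exact ih1.trans ih2

lemma lderiv_eq_iteratedFDeriv (l : List (Fin m)) (hf : ContDiffAt ℝ ∞ f y) :
    lderiv l f =ᶠ[𝓝 y] fun z =>
      iteratedFDeriv ℝ l.length f z fun k => (Pi.single (l.get k) 1 : Fin m → ℝ) := by
  induction l with
  | nil => exact Filter.Eventually.of_forall fun z => by simp [lderiv]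
  | cons i l ih =>
    refine (pderiv_congr i ih).trans ?_
    have h2 : ContDiffAt ℝ ((l.length + 1 : ℕ) : ℕ∞ω) f y :=
      hf.of_le (by exact_mod_cast le_top)
    filter_upwards [h2.eventually (by exact_mod_cast WithTop.coe_ne_top)] with z hz
    have hd : DifferentiableAt ℝ (iteratedFDeriv ℝ l.length f) z :=
      hz.differentiableAt_iteratedFDeriv (by exact_mod_cast Nat.lt_succ_self _)
    simp only [pderiv, List.length_cons]
    rw [iteratedFDeriv_succ_apply_left]
    have := fderiv_continuousMultilinear_apply_const_apply hd
      (fun k => (Pi.single (l.get k) 1 : Fin m → ℝ)) (Pi.single i 1 : Fin m → ℝ)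
    rw [this]
    rfl

/-- Contact of order `k`, in terms of partial derivatives and of iterated derivatives. -/
lemma contact_iff (k : ℕ) (hf : ContDiffAt ℝ ∞ f y) (hg : ContDiffAt ℝ ∞ g y) :
    (∀ I : MultiIndexLE m k, mpderiv I.1 f y = mpderiv I.1 g y) ↔
      ∀ r ≤ k, iteratedFDeriv ℝ r f y = iteratedFDeriv ℝ r g y := by
  constructor
  · intro h r hr
    apply ContinuousMultilinearMap.toMultilinearMap_injective
    refine Module.Basis.ext_multilinear (fun _ : Fin r => Pi.basisFun ℝ (Fin m)) ?_
    intro s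
    have h1 := (lderiv_eq_iteratedFDeriv (List.ofFn s) hf).self_of_nhds
    have h2 := (lderiv_eq_iteratedFDeriv (List.ofFn s) hg).self_of_nhds
    have h3 := (lderiv_perm (perm_dirs (List.ofFn s)) hf).self_of_nhds
    have h4 := (lderiv_perm (perm_dirs (List.ofFn s)) hg).self_of_nhds
    have h5 := h ⟨fun i => (List.ofFn s).count i, by rw [sum_count]; simpa using hr⟩
    have h6 : lderiv (List.ofFn s) f y = lderiv (List.ofFn s) g y := by
      rw [h3, h4]; exact h5
    rw [h1, h2] at h6
    beta_reduce at h6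
    have key : ∀ F : (Fin m → ℝ) → W, iteratedFDeriv ℝ (List.ofFn s).length F y
        (fun k => (Pi.single ((List.ofFn s).get k) 1 : Fin m → ℝ))
        = iteratedFDeriv ℝ r F y (fun k => (Pi.single (s k) 1 : Fin m → ℝ)) := by
      intro F
      have aux : ∀ (q : ℕ) (t : Fin q → Fin m) (hq : q = r)
          (ht : ∀ k, t k = s (Fin.cast hq k)), iteratedFDeriv ℝ q F y
          (fun k => (Pi.single (t k) 1 : Fin m → ℝ))
          = iteratedFDeriv ℝ r F y (fun k => (Pi.single (s k) 1 : Fin m → ℝ)) := by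
        intro q t hq ht
        subst hq
        congr 1
        ext1 k
        rw [ht]
        rfl
      exact aux _ _ (by simp) (fun k => by simp; rfl)
    rw [key, key] at h6
    simpa using h6
  · intro h I
    have h1 := (lderiv_eq_iteratedFDeriv (dirs I.1) hf).self_of_nhds
    have h2 := (lderiv_eq_iteratedFDeriv (dirs I.1) hg).self_of_nhds
    rw [mpderiv, mpderiv, h1, h2]
    beta_reduce
    rw [h _ ((length_dirs I.1).le.trans I.2)]

/-- Contact is preserved by left and right composition with smooth maps. -/
lemma contact_comp {W' : Type*} [NormedAddCommGroup W'] [NormedSpace ℝ W'] {q : ℕ}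
    (k : ℕ) {G : W → W'} {y' : Fin q → ℝ} {ξ : (Fin q → ℝ) → (Fin m → ℝ)}
    (hξ : ContDiffAt ℝ ∞ ξ y') (hy : ξ y' = y)
    (hf : ContDiffAt ℝ ∞ f y) (hg : ContDiffAt ℝ ∞ g y) (hG : ContDiffAt ℝ ∞ G (f y))
    (h : ∀ r ≤ k, iteratedFDeriv ℝ r f y = iteratedFDeriv ℝ r g y) :
    ∀ r ≤ k, iteratedFDeriv ℝ r (G ∘ (f ∘ ξ)) y' = iteratedFDeriv ℝ r (G ∘ (g ∘ ξ)) y' := by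
  have h0 : f y = g y := by
    have := congrArg (fun F => F (fun i => i.elim0)) (h 0 (Nat.zero_le _))
    simpa using this
  subst hy
  have hle : ∀ r : ℕ, (r : ℕ∞ω) ≤ ∞ := fun r => by exact_mod_cast le_top
  have step1 : ∀ r ≤ k, iteratedFDeriv ℝ r (f ∘ ξ) y' = iteratedFDeriv ℝ r (g ∘ ξ) y' := by
    intro r hr
    rw [iteratedFDeriv_comp hf hξ (hle r), iteratedFDeriv_comp hg hξ (hle r)]
    simp only [FormalMultilinearSeries.taylorComp, FormalMultilinearSeries.compAlongOrderedFinpartition]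
    refine Finset.sum_congr rfl fun c _ => ?_
    simp only [ftaylorSeries]
    rw [h _ (c.length_le.trans hr)]
  intro r hr
  have hG' : ContDiffAt ℝ ∞ G ((g ∘ ξ) y') := by simpa [← h0] using hG
  rw [iteratedFDeriv_comp (f := f ∘ ξ) (by simpa using hG) (hf.comp y' hξ) (hle r),
    iteratedFDeriv_comp (f := g ∘ ξ) hG' (hg.comp y' hξ) (hle r)]
  simp only [FormalMultilinearSeries.taylorComp, FormalMultilinearSeries.compAlongOrderedFinpartition]
  refine Finset.sum_congr rfl fun c _ => ?_
  simp only [ftaylorSeries, Function.comp_apply, h0]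
  congr 1
  ext1 j
  exact step1 _ ((c.partSize_le j).trans hr)

/-- Partial derivatives depend smoothly on parameters. -/
lemma contDiffAt_lderiv_param {P : Type*} [NormedAddCommGroup P] [NormedSpace ℝ P]
    (l : List (Fin m)) {F : P → (Fin m → ℝ) → W} {p : P}
    (hF : ContDiffAt ℝ ∞ (fun z : P × (Fin m → ℝ) => F z.1 z.2) (p, y)) :
    ContDiffAt ℝ ∞ (fun z : P × (Fin m → ℝ) => lderiv l (F z.1) z.2) (p, y) := by
  induction l with
  | nil => exact hF
  | cons i l ih =>
    change ContDiffAt ℝ ∞ (fun z : P × (Fin m → ℝ) =>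
      fderiv ℝ (lderiv l (F z.1)) z.2 (Pi.single i 1)) (p, y)
    refine ContDiffAt.clm_apply ?_ contDiffAt_const
    refine ContDiffAt.fderiv (n := ∞) (f := fun z : P × (Fin m → ℝ) => lderiv l (F z.1))
      (g := fun z => z.2) ?_ contDiffAt_snd (by simp)
    have : (Function.uncurry fun z : P × (Fin m → ℝ) => lderiv l (F z.1))
        = (fun z : P × (Fin m → ℝ) => lderiv l (F z.1) z.2) ∘
          fun w : (P × (Fin m → ℝ)) × (Fin m → ℝ) => (w.1.1, w.2) := rfl
    rw [this]
    refine ContDiffAt.comp _ ih ?_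
    fun_prop

/-- The monomial `∏ᵢ (yⁱ - xⁱ)^{I(i)} / I(i)!`. -/
def monomialAt (x : Fin m → ℝ) (I : Fin m → ℕ) (y : Fin m → ℝ) : ℝ :=
  ∏ i, (y i - x i) ^ I i / (I i).factorial

/-- The Taylor polynomial at `x` with derivatives `u`. -/
def taylorAt {k : ℕ} (x : Fin m → ℝ) (u : MultiIndexLE m k → W) (y : Fin m → ℝ) : W :=
  ∑ I, monomialAt x I.1 y • u I

lemma contDiff_monomialAt (I : Fin m → ℕ) :
    ContDiff ℝ ∞ fun z : (Fin m → ℝ) × (Fin m → ℝ) => monomialAt z.1 I z.2 := by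
  unfold monomialAt
  refine contDiff_prod fun i _ => ContDiff.div_const (ContDiff.pow ?_ _) _
  fun_prop

lemma contDiff_taylorAt (k : ℕ) :
    ContDiff ℝ ∞ fun z : ((Fin m → ℝ) × (MultiIndexLE m k → W)) × (Fin m → ℝ) =>
      taylorAt z.1.1 z.1.2 z.2 := by
  unfold taylorAt
  refine ContDiff.sum fun I _ => ContDiff.smul ?_ (by fun_prop)
  exact (contDiff_monomialAt I.1).comp
    (f := fun z : ((Fin m → ℝ) × (MultiIndexLE m k → W)) × (Fin m → ℝ) => (z.1.1, z.2))
    (by fun_prop)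

lemma contDiff_monomialAt' (x : Fin m → ℝ) (I : Fin m → ℕ) : ContDiff ℝ ∞ (monomialAt x I) :=
  (contDiff_monomialAt I).comp (f := fun y => (x, y)) (by fun_prop)

lemma monomialAt_self (x : Fin m → ℝ) (I : Fin m → ℕ) :
    monomialAt x I x = if I = 0 then 1 else 0 := by
  unfold monomialAt
  split_ifs with h
  · simp [h]
  · obtain ⟨i, hi⟩ := Function.ne_iff.1 h
    exact Finset.prod_eq_zero (Finset.mem_univ i) (by simp [zero_pow (by simpa using hi)])

lemma pderiv_monomialAt (x : Fin m → ℝ) (I : Fin m → ℕ) (j : Fin m) :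
    pderiv j (monomialAt x I) =
      if 1 ≤ I j then monomialAt x (I - Pi.single j 1) else 0 := by
  ext y
  have hd : DifferentiableAt ℝ (monomialAt x I) y :=
    (contDiff_monomialAt' x I).contDiffAt.differentiableAt (by simp)
  rw [pderiv, ← hd.lineDeriv_eq_fderiv, lineDeriv]
  have h1 : (fun t : ℝ => monomialAt x I (y + t • Pi.single j 1)) = fun t =>
      (∏ i ∈ Finset.univ.erase j, (y i - x i) ^ I i / (I i).factorial) *
        (((t + (y j - x j)) ^ I j) / (I j).factorial) := by
    ext t
    rw [monomialAt, ← Finset.prod_erase_mul _ _ (Finset.mem_univ j)]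
    congr 1
    · refine Finset.prod_congr rfl fun i hi => ?_
      simp [Pi.single_eq_of_ne (Finset.ne_of_mem_erase hi)]
    · simp
      ring
  rw [h1]
  have h2 : HasDerivAt (fun t : ℝ => ((t + (y j - x j)) ^ I j) / (I j).factorial)
      ((I j : ℝ) * (0 + (y j - x j)) ^ (I j - 1) * 1 / (I j).factorial) 0 :=
    (((hasDerivAt_id (0 : ℝ)).add_const (y j - x j)).pow (I j)).div_const _
  rw [(h2.const_mul _).deriv]
  split_ifs with h
  · rw [monomialAt, ← Finset.prod_erase_mul _ _ (Finset.mem_univ j)]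
    congr 1
    · refine Finset.prod_congr rfl fun i hi => ?_
      simp [Pi.single_eq_of_ne (Finset.ne_of_mem_erase hi)]
    · obtain ⟨a, ha⟩ : ∃ a, I j = a + 1 := ⟨I j - 1, by omega⟩
      simp only [ha, Pi.sub_apply, Pi.single_eq_same, Nat.add_sub_cancel, Nat.factorial_succ]
      push_cast
      field_simp
      ring
  · have : I j = 0 := by omega
    simp [this]

lemma lderiv_monomialAt (x : Fin m → ℝ) (I : Fin m → ℕ) (l : List (Fin m)) :
    lderiv l (monomialAt x I) =
      if ∀ i, l.count i ≤ I i then monomialAt x (fun i => I i - l.count i) else 0 := by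
  induction l with
  | nil => simp [lderiv]
  | cons j l ih =>
    change pderiv j (lderiv l (monomialAt x I)) = _
    rw [ih]
    have hc : ∀ i, (j :: l).count i = l.count i + (Pi.single j 1 : Fin m → ℕ) i := by
      intro i
      rcases eq_or_ne i j with rfl | h
      · simp
      · simp [List.count_cons_of_ne h.symm, h]
    simp only [hc]
    by_cases h : ∀ i, l.count i ≤ I i
    · rw [if_pos h, pderiv_monomialAt]
      by_cases hj : 1 ≤ I j - l.count j
      · rw [if_pos hj, if_pos]
        · congr 1
          ext i
          simp only [Pi.sub_apply]
          omega
        · intro i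
          have := h i
          rcases eq_or_ne i j with rfl | hi
          · simp; omega
          · simpa [hi] using this
      · rw [if_neg hj, if_neg]
        intro h'
        have := h' j
        simp at this
        omega
    · rw [if_neg h, if_neg]
      · ext y
        simp [pderiv]
      · intro h'
        exact h fun i => (Nat.le_add_right _ _).trans (h' i)

lemma lderiv_taylorAt {k : ℕ} (x : Fin m → ℝ) (u : MultiIndexLE m k → W) (l : List (Fin m)) :
    lderiv l (taylorAt x u) = fun y => ∑ I, lderiv l (monomialAt x I.1) y • u I := by
  induction l with
  | nil => rfl
  | cons j l ih =>
    change pderiv j (lderiv l (taylorAt x u)) = _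
    rw [ih]
    ext1 y
    have hd : ∀ I : MultiIndexLE m k, DifferentiableAt ℝ (lderiv l (monomialAt x I.1)) y :=
      fun I => (ContDiffAt.lderiv' l (contDiff_monomialAt' x I.1).contDiffAt).differentiableAt
        (by simp)
    rw [pderiv, fderiv_fun_sum fun I _ => (hd I).smul_const (u I)]
    simp only [sum_apply]
    refine Finset.sum_congr rfl fun I _ => ?_
    rw [fderiv_smul_const (hd I)]
    rfl

lemma mpderiv_taylorAt {k : ℕ} (x : Fin m → ℝ) (u : MultiIndexLE m k → W)
    (J : MultiIndexLE m k) : mpderiv J.1 (taylorAt x u) x = u J := by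
  rw [mpderiv, lderiv_taylorAt]
  beta_reduce
  rw [Finset.sum_eq_single J]
  · simp [lderiv_monomialAt, count_dirs, monomialAt_self, Pi.zero_def]
  · intro I _ hI
    rw [lderiv_monomialAt]
    simp only [count_dirs]
    split_ifs with h
    · rw [monomialAt_self, if_neg, zero_smul]
      intro h0
      apply hI
      ext i
      have h1 : I.1 i - J.1 i = 0 := congrFun h0 i
      have h2 := h i
      omega
    · simp
  · simp

end Partial

/-! ### Manifolds given by a family of coordinate systems -/

/-- A family of coordinate systems on a set `S`, with values in a normed space `V`, defined on
subsets that cover `S` and with smooth changes of coordinates. -/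
structure SmoothCharts (ι S V : Type*) [NormedAddCommGroup V] [NormedSpace ℝ V] where
  chart : ι → PartialEquiv S V
  exists_mem : ∀ s, ∃ i, s ∈ (chart i).source
  isOpen : ∀ i j, IsOpen ((chart i).symm.trans (chart j)).source
  smooth : ∀ i j, ContDiffOn ℝ ∞ ((chart i).symm.trans (chart j))
    ((chart i).symm.trans (chart j)).source

namespace SmoothCharts

variable {ι S V : Type*} [NormedAddCommGroup V] [NormedSpace ℝ V] (C : SmoothCharts ι S V)

/-- The atlas whose charts are the given coordinate systems. -/
def core : ChartedSpaceCore V S where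
  atlas := Set.range C.chart
  chartAt s := C.chart (C.exists_mem s).choose
  mem_chart_source s := (C.exists_mem s).choose_spec
  chart_mem_atlas s := ⟨_, rfl⟩
  open_source := by
    rintro _ _ ⟨i, rfl⟩ ⟨j, rfl⟩
    exact C.isOpen i j
  continuousOn_toFun := by
    rintro _ _ ⟨i, rfl⟩ ⟨j, rfl⟩
    exact (C.smooth i j).continuousOn

/-- The topology of the manifold given by a family of coordinate systems. -/
abbrev topologicalSpace : TopologicalSpace S := C.core.toTopologicalSpace

/-- The charts of the manifold given by a family of coordinate systems. -/
abbrev chartedSpace : @ChartedSpace V _ S C.topologicalSpace :=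
  C.core.toChartedSpace

lemma isManifold :
    @IsManifold ℝ _ V _ _ V _ 𝓘(ℝ, V) ∞ S C.topologicalSpace C.chartedSpace := by
  let _ := C.topologicalSpace
  let _ := C.chartedSpace
  refine isManifold_of_contDiffOn _ _ _ ?_
  rintro e e' he he'
  obtain ⟨_, ⟨⟨_, rfl⟩, ⟨_, ⟨⟨i, rfl⟩, rfl⟩, rfl⟩⟩⟩ := he
  obtain ⟨_, ⟨⟨_, rfl⟩, ⟨_, ⟨⟨j, rfl⟩, rfl⟩, rfl⟩⟩⟩ := he'
  refine ((C.smooth i j).mono ?_)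
  intro x hx
  exact hx.1

/-- One of the given coordinate systems, as a chart of the manifold. -/
def ofIndex (i : ι) : @OpenPartialHomeomorph S V C.topologicalSpace _ :=
  C.core.openPartialHomeomorph (C.chart i) ⟨i, rfl⟩

lemma ofIndex_mem_atlas (i : ι) : C.ofIndex i ∈ @atlas V _ S C.topologicalSpace C.chartedSpace :=
  Set.mem_iUnion₂.2 ⟨C.chart i, ⟨i, rfl⟩, rfl⟩

end SmoothCharts

/-! ### Fibred manifolds, adapted charts and jets -/

section AdaptedChart

universe u v

/-- A chart of the total space of `proj : E → M` that is adapted to the bundle structure: it has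
coordinates `(xⁱ, u^α)`, where the `xⁱ` are the coordinates of a chart of the base. -/
structure AdaptedChart (m n : ℕ) {M : Type u} {E : Type v}
    [TopologicalSpace M] [ChartedSpace (EuclideanSpace ℝ (Fin m)) M]
    [TopologicalSpace E] [ChartedSpace (EuclideanSpace ℝ (Fin (m + n))) E] (proj : E → M) where
  base : OpenPartialHomeomorph M (Fin m → ℝ)
  total : OpenPartialHomeomorph E ((Fin m → ℝ) × (Fin n → ℝ))
  base_smooth : ContMDiffOn (𝓡 m) 𝓘(ℝ, Fin m → ℝ) ∞ base base.source
  base_symm_smooth : ContMDiffOn 𝓘(ℝ, Fin m → ℝ) (𝓡 m) ∞ base.symm base.target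
  total_smooth :
    ContMDiffOn (𝓡 (m + n)) 𝓘(ℝ, (Fin m → ℝ) × (Fin n → ℝ)) ∞ total total.source
  total_symm_smooth :
    ContMDiffOn 𝓘(ℝ, (Fin m → ℝ) × (Fin n → ℝ)) (𝓡 (m + n)) ∞ total.symm total.target
  proj_mem : ∀ e ∈ total.source, proj e ∈ base.source
  proj_eq : ∀ e ∈ total.source, base (proj e) = (total e).1

/-- The configuration bundle `π : E → M` of a field theory, over an `m`-dimensional manifold and
with `n`-dimensional fibres: a smooth surjective map with adapted charts around every point of the
total space. -/
structure FieldBundle (m n : ℕ) where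
  M : Type u
  E : Type v
  [topM : TopologicalSpace M]
  [chartedM : ChartedSpace (EuclideanSpace ℝ (Fin m)) M]
  [manifoldM : IsManifold (𝓡 m) ∞ M]
  [t2M : T2Space M]
  [secondCountableM : SecondCountableTopology M]
  [topE : TopologicalSpace E]
  [chartedE : ChartedSpace (EuclideanSpace ℝ (Fin (m + n))) E]
  [manifoldE : IsManifold (𝓡 (m + n)) ∞ E]
  [t2E : T2Space E]
  [secondCountableE : SecondCountableTopology E]
  proj : E → M
  smooth_proj : ContMDiff (𝓡 (m + n)) (𝓡 m) ∞ proj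
  surjective_proj : Function.Surjective proj
  exists_chart : ∀ e, ∃ c : AdaptedChart m n proj, e ∈ c.total.source

end AdaptedChart

attribute [instance] FieldBundle.topM FieldBundle.chartedM FieldBundle.manifoldM FieldBundle.t2M
  FieldBundle.secondCountableM FieldBundle.topE FieldBundle.chartedE FieldBundle.manifoldE
  FieldBundle.t2E FieldBundle.secondCountableE

section Jets

variable {m n : ℕ} (B : FieldBundle m n)

/-- The adapted charts of the bundle. -/
abbrev FieldBundle.Chart : Type _ := AdaptedChart m n B.proj

/-- A map from the base to the total space is a smooth section on a neighbourhood of `x`. -/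
def IsSectionNear (φ : B.M → B.E) (x : B.M) : Prop :=
  ∃ U : Set B.M, IsOpen U ∧ x ∈ U ∧ ContMDiffOn (𝓡 m) (𝓡 (m + n)) ∞ φ U ∧
    ∀ y ∈ U, B.proj (φ y) = y

/-- A point of the base together with a local section around it. -/
structure JetRep where
  pt : B.M
  sec : B.M → B.E
  isSection : IsSectionNear B sec pt

variable {B}

/-- The local expression `u^α = φ^α(x)` of a section in an adapted chart. -/
def AdaptedChart.localRep (c : B.Chart) (φ : B.M → B.E) (y : Fin m → ℝ) : Fin n → ℝ :=
  (c.total (φ (c.base.symm y))).2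

variable (B)

/-- Local sections have the same `k`-jet at a point if they have there the same value and the same
partial derivatives up to order `k` in adapted coordinates. -/
def jetSetoid (k : ℕ) : Setoid (JetRep B) where
  r a b := a.pt = b.pt ∧ a.sec a.pt = b.sec b.pt ∧
    ∀ c : B.Chart, a.sec a.pt ∈ c.total.source → ∀ I : MultiIndexLE m k,
      mpderiv I.1 (c.localRep a.sec) (c.base a.pt) = mpderiv I.1 (c.localRep b.sec) (c.base b.pt)
  iseqv :=
    { refl := fun _ => ⟨rfl, rfl, fun _ _ _ => rfl⟩
      symm := fun h => ⟨h.1.symm, h.2.1.symm, fun c hc I => (h.2.2 c (h.2.1 ▸ hc) I).symm⟩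
      trans := fun h h' => ⟨h.1.trans h'.1, h.2.1.trans h'.2.1,
        fun c hc I => (h.2.2 c hc I).trans (h'.2.2 c (h.2.1 ▸ hc) I)⟩ }

/-- The `k`th-order jet bundle `J^kπ`. -/
def Jet (k : ℕ) : Type _ := Quotient (jetSetoid B k)

variable {B}

namespace Jet

/-- The `k`-jet of a local section. -/
def mk (k : ℕ) (r : JetRep B) : Jet B k := Quotient.mk (jetSetoid B k) r

/-- The projection `π̄^k : J^kπ → M`. -/
def source {k : ℕ} (j : Jet B k) : B.M := Quotient.lift (s := jetSetoid B k) JetRep.pt (fun _ _ h => h.1) j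

/-- The projection `π^k : J^kπ → E`. -/
def target {k : ℕ} (j : Jet B k) : B.E :=
  Quotient.lift (s := jetSetoid B k) (fun r => r.sec r.pt) (fun _ _ h => h.2.1) j

/-- The projection `π^k_r : J^kπ → J^rπ`. -/
def trunc {k : ℕ} (r : ℕ) (h : r ≤ k) (j : Jet B k) : Jet B r :=
  Quotient.lift (s := jetSetoid B k) (fun a => mk r a)
    (fun _ _ hab => Quotient.sound (s := jetSetoid B r)
      ⟨hab.1, hab.2.1, fun c hc I => hab.2.2 c hc (I.castLE h)⟩) j

/-- A local section that represents a jet. -/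
def rep {k : ℕ} (j : Jet B k) : JetRep B := Quotient.out (s := jetSetoid B k) j

lemma mk_rep {k : ℕ} (j : Jet B k) : mk k j.rep = j := Quotient.out_eq (s := jetSetoid B k) j

@[simp] lemma source_mk (k : ℕ) (r : JetRep B) : (mk k r).source = r.pt := rfl
@[simp] lemma target_mk (k : ℕ) (r : JetRep B) : (mk k r).target = r.sec r.pt := rfl
@[simp] lemma trunc_mk {k : ℕ} (q : ℕ) (h : q ≤ k) (r : JetRep B) :
    (mk k r).trunc q h = mk q r := rfl

lemma rep_pt {k : ℕ} (j : Jet B k) : j.rep.pt = j.source := by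
  conv_rhs => rw [← j.mk_rep, source_mk]

lemma rep_sec {k : ℕ} (j : Jet B k) : j.rep.sec j.rep.pt = j.target := by
  conv_rhs => rw [← j.mk_rep, target_mk]

end Jet

lemma JetRep.proj_sec (r : JetRep B) : B.proj (r.sec r.pt) = r.pt := by
  obtain ⟨U, _, hx, _, h⟩ := r.isSection
  exact h _ hx

@[simp] lemma Jet.proj_target {k : ℕ} (j : Jet B k) : B.proj j.target = j.source := by
  rw [← j.rep_sec, j.rep.proj_sec, j.rep_pt]

/-- The space with coordinates `(xⁱ, u_I^α)`, `|I| ≤ k`. -/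
abbrev JetModel (m n k : ℕ) : Type := (Fin m → ℝ) × (MultiIndexLE m k → Fin n → ℝ)

namespace AdaptedChart

variable (c c' : B.Chart)

/-- The natural coordinates `(xⁱ, u_I^α)` of a jet. -/
def jetCoord {k : ℕ} (j : Jet B k) : JetModel m n k :=
  (c.base j.source, fun I => mpderiv I.1 (c.localRep j.rep.sec) (c.base j.source))

lemma jetCoord_mk {k : ℕ} (r : JetRep B) (h : r.sec r.pt ∈ c.total.source) :
    c.jetCoord (Jet.mk k r) =
      (c.base r.pt, fun I => mpderiv I.1 (c.localRep r.sec) (c.base r.pt)) := by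
  have h1 : (jetSetoid B k) (Jet.mk k r).rep r := Quotient.mk_out (s := jetSetoid B k) r
  have h2 : (Jet.mk k r).rep.sec (Jet.mk k r).rep.pt ∈ c.total.source := by
    rw [h1.2.1]; exact h
  have h3 := h1.2.2 c h2
  rw [Jet.rep_pt, Jet.source_mk] at h3
  rw [jetCoord, Jet.source_mk]
  ext1
  · rfl
  · exact funext fun I => h3 I

lemma base_symm_proj {p : (Fin m → ℝ) × (Fin n → ℝ)} (hp : p ∈ c.total.target) :
    p.1 ∈ c.base.target ∧ B.proj (c.total.symm p) = c.base.symm p.1 := by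
  have h1 := c.total.map_target hp
  have h2 := c.proj_eq _ h1
  rw [c.total.right_inv hp] at h2
  have h3 := c.proj_mem _ h1
  exact ⟨h2 ▸ c.base.map_source h3, by rw [← h2, c.base.left_inv h3]⟩

variable {c c'}

lemma contDiffAt_base_change {y : Fin m → ℝ} (hy : y ∈ c'.base.target)
    (h : c'.base.symm y ∈ c.base.source) :
    ContDiffAt ℝ ∞ (fun z => c.base (c'.base.symm z)) y := by
  rw [← contMDiffAt_iff_contDiffAt]
  exact ((c.base_smooth _ h).contMDiffAt (c.base.open_source.mem_nhds h)).comp y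
    ((c'.base_symm_smooth _ hy).contMDiffAt (c'.base.open_target.mem_nhds hy))

lemma contDiffAt_total_change {p : (Fin m → ℝ) × (Fin n → ℝ)} (hp : p ∈ c'.total.target)
    (h : c'.total.symm p ∈ c.total.source) :
    ContDiffAt ℝ ∞ (fun z => c.total (c'.total.symm z)) p := by
  rw [← contMDiffAt_iff_contDiffAt]
  exact ((c.total_smooth _ h).contMDiffAt (c.total.open_source.mem_nhds h)).comp p
    ((c'.total_symm_smooth _ hp).contMDiffAt (c'.total.open_target.mem_nhds hp))

lemma mem_base_of_section {φ : B.M → B.E} {x : B.M} (hφ : IsSectionNear B φ x)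
    (h : φ x ∈ c.total.source) : x ∈ c.base.source := by
  obtain ⟨U, _, hx, _, hU⟩ := hφ
  rw [← hU x hx]
  exact c.proj_mem _ h

lemma contDiffAt_localRep {φ : B.M → B.E} {x : B.M} (hφ : IsSectionNear B φ x)
    (h : φ x ∈ c.total.source) : ContDiffAt ℝ ∞ (c.localRep φ) (c.base x) := by
  have hx := mem_base_of_section hφ h
  obtain ⟨U, hU, hxU, hs, -⟩ := hφ
  have hy := c.base.map_source hx
  rw [← contMDiffAt_iff_contDiffAt]
  have h1 : ContMDiffAt 𝓘(ℝ, Fin m → ℝ) (𝓡 m) ∞ c.base.symm (c.base x) :=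
    (c.base_symm_smooth _ hy).contMDiffAt (c.base.open_target.mem_nhds hy)
  have h2 : ContMDiffAt (𝓡 m) (𝓡 (m + n)) ∞ φ (c.base.symm (c.base x)) := by
    rw [c.base.left_inv hx]
    exact (hs x hxU).contMDiffAt (hU.mem_nhds hxU)
  have h3 : ContMDiffAt (𝓡 (m + n)) 𝓘(ℝ, (Fin m → ℝ) × (Fin n → ℝ)) ∞ c.total
      (φ (c.base.symm (c.base x))) := by
    rw [c.base.left_inv hx]
    exact (c.total_smooth _ h).contMDiffAt (c.total.open_source.mem_nhds h)
  have h4 : ContMDiffAt 𝓘(ℝ, Fin m → ℝ) 𝓘(ℝ, (Fin m → ℝ) × (Fin n → ℝ)) ∞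
      (fun y => c.total (φ (c.base.symm y))) (c.base x) :=
    ContMDiffAt.comp (g := c.total) (f := fun y => φ (c.base.symm y)) (c.base x) h3
      (ContMDiffAt.comp (g := φ) (f := c.base.symm) (c.base x) h2 h1)
  rw [contMDiffAt_iff_contDiffAt] at h4 ⊢
  exact contDiff_snd.contDiffAt.comp _ h4

lemma eventually_localRep {φ : B.M → B.E} {x : B.M} (hφ : IsSectionNear B φ x)
    (h : φ x ∈ c.total.source) :
    ∀ᶠ z in 𝓝 x, c.base.symm (c.base z) = z ∧ φ z ∈ c.total.source ∧
      φ z = c.total.symm (c.base z, c.localRep φ (c.base z)) := by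
  have hx := mem_base_of_section hφ h
  obtain ⟨U, hU, hxU, hs, hp⟩ := hφ
  have hc : ContinuousAt φ x :=
    ((hs x hxU).contMDiffAt (hU.mem_nhds hxU)).continuousAt
  filter_upwards [c.base.open_source.mem_nhds hx, hU.mem_nhds hxU,
    hc (c.total.open_source.mem_nhds h)] with z hz hzU hzs
  refine ⟨c.base.left_inv hz, hzs, ?_⟩
  have h1 := c.proj_eq _ hzs
  rw [hp z hzU] at h1
  rw [localRep, c.base.left_inv hz, h1]
  exact (c.total.left_inv hzs).symm

/-- Two local sections with the same partial derivatives up to order `k` in one adapted chart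
have the same `k`-jet. -/
lemma jet_eq_of_contact {k : ℕ} {a b : JetRep B} (hpt : a.pt = b.pt)
    (hval : a.sec a.pt = b.sec b.pt) (ha : a.sec a.pt ∈ c.total.source)
    (h : ∀ I : MultiIndexLE m k,
      mpderiv I.1 (c.localRep a.sec) (c.base a.pt) = mpderiv I.1 (c.localRep b.sec) (c.base b.pt)) :
    Jet.mk k a = Jet.mk k b := by
  obtain ⟨x, φ, hφ⟩ := a
  obtain ⟨x', φ', hφ'⟩ := b
  dsimp only at hpt hval ha h
  subst hpt
  refine Quotient.sound (s := jetSetoid B k) ⟨rfl, hval, fun d hd => ?_⟩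
  dsimp only at hd ⊢
  have ha' : φ' x ∈ c.total.source := hval ▸ ha
  have hd' : φ' x ∈ d.total.source := hval ▸ hd
  have hxc := mem_base_of_section hφ ha
  have hxd := mem_base_of_section hφ hd
  have hy := d.base.map_source hxd
  rw [contact_iff k (contDiffAt_localRep hφ ha) (contDiffAt_localRep hφ' ha')] at h
  rw [contact_iff k (contDiffAt_localRep hφ hd) (contDiffAt_localRep hφ' hd')]
  have hrep : ∀ ψ : B.M → B.E, IsSectionNear B ψ x → ψ x ∈ c.total.source →
      d.localRep ψ =ᶠ[𝓝 (d.base x)]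
        (fun p => (d.total (c.total.symm p)).2) ∘ ((fun y => (y, c.localRep ψ y)) ∘
          fun y => c.base (d.base.symm y)) := by
    intro ψ hψ hψc
    have ht : Filter.Tendsto d.base.symm (𝓝 (d.base x)) (𝓝 x) := by
      have := (d.base.continuousAt_symm hy).tendsto
      rwa [d.base.left_inv hxd] at this
    filter_upwards [ht.eventually (eventually_localRep hψ hψc)] with y hy'
    simp only [Function.comp_apply]
    rw [← hy'.2.2, localRep]
  have hval' : c.localRep φ (c.base x) = c.localRep φ' (c.base x) := by
    simp [localRep, c.base.left_inv hxc, hval]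
  have hcs := contDiffAt_localRep hφ ha
  have hcs' := contDiffAt_localRep hφ' ha'
  have hpr : c.total.symm (c.base x, c.localRep φ (c.base x)) = φ x :=
    ((eventually_localRep hφ ha).self_of_nhds.2.2).symm
  have hmem : (c.base x, c.localRep φ (c.base x)) ∈ c.total.target := by
    have h1 := c.total.map_source ha
    have h2 : c.total (φ x) = (c.base x, c.localRep φ (c.base x)) := by
      have h3 := c.proj_eq _ ha
      obtain ⟨U, _, hxU, _, hp⟩ := hφ
      rw [hp x hxU] at h3
      rw [localRep, c.base.left_inv hxc]
      exact Prod.ext h3.symm rfl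
    rwa [h2] at h1
  have key := contact_comp (f := fun y => (y, c.localRep φ y)) (g := fun y => (y, c.localRep φ' y))
    (G := fun p => (d.total (c.total.symm p)).2) (ξ := fun y => c.base (d.base.symm y))
    (y' := d.base x) (y := c.base x) k
    (contDiffAt_base_change hy (by rw [d.base.left_inv hxd]; exact hxc))
    (by rw [d.base.left_inv hxd]) (contDiffAt_id.prodMk hcs) (contDiffAt_id.prodMk hcs')
    (contDiff_snd.contDiffAt.comp _ (contDiffAt_total_change hmem (by rw [hpr]; exact hd)))
    (fun r hr => by
      have hid : ContDiffAt ℝ ∞ (fun y : Fin m → ℝ => y) (c.base x) := contDiffAt_id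
      rw [iteratedFDeriv_prodMk hid hcs (natCast_le_infty r),
        iteratedFDeriv_prodMk hid hcs' (natCast_le_infty r), h r hr])
  intro r hr
  rw [(hrep φ hφ ha).iteratedFDeriv (𝕜 := ℝ) r |>.self_of_nhds,
    (hrep φ' hφ' ha').iteratedFDeriv (𝕜 := ℝ) r |>.self_of_nhds]
  exact key r hr

variable (c c')

/-- The local section whose expression in an adapted chart is a Taylor polynomial. -/
def taylorSection {k : ℕ} (v : JetModel m n k) (x : B.M) : B.E :=
  c.total.symm (c.base x, taylorAt v.1 v.2 (c.base x))

lemma taylorAt_self {m k : ℕ} {W : Type*} [NormedAddCommGroup W] [NormedSpace ℝ W]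
    (x : Fin m → ℝ) (u : MultiIndexLE m k → W) : taylorAt x u x = u (.zero m k) := by
  have h0 : dirs (0 : Fin m → ℕ) = [] := List.eq_nil_of_length_eq_zero (by simp [length_dirs])
  have := mpderiv_taylorAt x u (.zero m k)
  rw [← this, mpderiv, MultiIndexLE.zero, h0]
  rfl

variable {c} in
lemma isSectionNear_taylorSection {k : ℕ} {v : JetModel m n k}
    (hv : (v.1, v.2 (.zero m k)) ∈ c.total.target) :
    IsSectionNear B (c.taylorSection v) (c.base.symm v.1) := by
  have hb := (c.base_symm_proj hv).1
  have hT : ContDiff ℝ ∞ fun y => (y, taylorAt v.1 v.2 y) :=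
    contDiff_id.prodMk ((contDiff_taylorAt k).comp (f := fun y => (v, y)) (by fun_prop))
  have hcont : ContinuousOn (fun x => (c.base x, taylorAt v.1 v.2 (c.base x))) c.base.source :=
    hT.continuous.comp_continuousOn c.base.continuousOn
  refine ⟨c.base.source ∩ (fun x => (c.base x, taylorAt v.1 v.2 (c.base x))) ⁻¹' c.total.target,
    hcont.isOpen_inter_preimage c.base.open_source c.total.open_target,
    ⟨c.base.map_target hb, ?_⟩, ?_, ?_⟩
  · simpa [c.base.right_inv hb, taylorAt_self] using hv
  · have h1 : ContMDiffOn (𝓡 m) 𝓘(ℝ, (Fin m → ℝ) × (Fin n → ℝ)) ∞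
        (fun x => (c.base x, taylorAt v.1 v.2 (c.base x))) c.base.source :=
      hT.contMDiff.comp_contMDiffOn c.base_smooth
    exact c.total_symm_smooth.comp (h1.mono Set.inter_subset_left) (fun x hx => hx.2)
  · intro x hx
    rw [taylorSection, (c.base_symm_proj hx.2).2, c.base.left_inv hx.1]

variable {c} in
/-- The jet with given natural coordinates. -/
def jetOfCoord {k : ℕ} {v : JetModel m n k} (hv : (v.1, v.2 (.zero m k)) ∈ c.total.target) :
    Jet B k :=
  Jet.mk k ⟨c.base.symm v.1, c.taylorSection v, isSectionNear_taylorSection hv⟩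

variable {c} in
lemma target_jetOfCoord {k : ℕ} {v : JetModel m n k}
    (hv : (v.1, v.2 (.zero m k)) ∈ c.total.target) :
    (jetOfCoord hv).target = c.total.symm (v.1, v.2 (.zero m k)) := by
  rw [jetOfCoord, Jet.target_mk]
  simp only [taylorSection]
  rw [c.base.right_inv (c.base_symm_proj hv).1, taylorAt_self]

variable {c} in
lemma localRep_taylorSection {k : ℕ} {v : JetModel m n k}
    (hv : (v.1, v.2 (.zero m k)) ∈ c.total.target) :
    c.localRep (c.taylorSection v) =ᶠ[𝓝 v.1] taylorAt v.1 v.2 := by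
  have hb := (c.base_symm_proj hv).1
  have hT : Continuous fun y => (y, taylorAt v.1 v.2 y) :=
    (contDiff_id.prodMk ((contDiff_taylorAt k).comp
      (f := fun y => (v, y)) (n := ∞) (by fun_prop))).continuous
  have h1 : ∀ᶠ y in 𝓝 v.1, (y, taylorAt v.1 v.2 y) ∈ c.total.target :=
    hT.continuousAt (c.total.open_target.mem_nhds (by simpa [taylorAt_self] using hv))
  filter_upwards [h1, c.base.open_target.mem_nhds hb] with y hy hyb
  rw [localRep, taylorSection, c.base.right_inv hyb, c.total.right_inv hy]

variable {c} in
lemma jetCoord_jetOfCoord {k : ℕ} {v : JetModel m n k}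
    (hv : (v.1, v.2 (.zero m k)) ∈ c.total.target) : c.jetCoord (jetOfCoord hv) = v := by
  have hb := (c.base_symm_proj hv).1
  have ht := target_jetOfCoord hv
  rw [jetOfCoord, Jet.target_mk] at ht
  rw [jetOfCoord, jetCoord_mk]
  · dsimp only
    rw [c.base.right_inv hb]
    refine Prod.ext rfl (funext fun I => ?_)
    dsimp only
    rw [mpderiv, (lderiv_congr _ (localRep_taylorSection hv)).self_of_nhds]
    exact mpderiv_taylorAt v.1 v.2 I
  · rw [ht]
    exact c.total.map_target hv

variable {c} in
lemma jetCoord_mem {k : ℕ} {j : Jet B k} (hj : j.target ∈ c.total.source) :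
    ((c.jetCoord j).1, (c.jetCoord j).2 (.zero m k)) = c.total j.target := by
  have h0 : dirs (0 : Fin m → ℕ) = [] := List.eq_nil_of_length_eq_zero (by simp [length_dirs])
  rw [← j.mk_rep, Jet.target_mk] at hj ⊢
  rw [jetCoord_mk _ _ hj]
  have h1 := c.proj_eq _ hj
  rw [j.rep.proj_sec] at h1
  refine Prod.ext h1 ?_
  simp only [MultiIndexLE.zero, mpderiv, h0, lderiv, List.foldr_nil, localRep]
  rw [c.base.left_inv (mem_base_of_section j.rep.isSection hj)]

variable {c} in
lemma jetCoord_mem_target {k : ℕ} {j : Jet B k} (hj : j.target ∈ c.total.source) :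
    ((c.jetCoord j).1, (c.jetCoord j).2 (.zero m k)) ∈ c.total.target := by
  rw [jetCoord_mem hj]
  exact c.total.map_source hj

variable {c} in
lemma jetOfCoord_jetCoord {k : ℕ} {j : Jet B k} (hj : j.target ∈ c.total.source) :
    jetOfCoord (jetCoord_mem_target hj) = j := by
  have ht := target_jetOfCoord (jetCoord_mem_target hj)
  rw [jetCoord_mem hj, c.total.left_inv hj] at ht
  have hc := jetCoord_jetOfCoord (jetCoord_mem_target hj)
  conv_rhs => rw [← j.mk_rep]
  have hj' : j.rep.sec j.rep.pt ∈ c.total.source := by rw [j.rep_sec]; exact hj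
  have hx : c.base.symm (c.jetCoord j).1 = j.rep.pt := by
    rw [jetCoord, ← j.rep_pt]
    exact c.base.left_inv (mem_base_of_section j.rep.isSection hj')
  rw [jetOfCoord, Jet.target_mk] at ht
  refine jet_eq_of_contact (c := c) hx ?_ ?_ ?_
  · rw [ht, j.rep_sec]
  · rw [ht]; exact hj
  · intro I
    rw [jetOfCoord, jetCoord_mk _ _ (by rw [ht]; exact hj)] at hc
    have := congrArg (fun p => p.2 I) hc
    dsimp only at this ⊢
    rw [this, jetCoord, ← j.rep_pt]

lemma nonempty_jet {B : FieldBundle m n} (c : B.Chart) (k : ℕ) : Nonempty (Jet B k) := by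
  obtain ⟨d, hd⟩ := B.exists_chart (c.total.symm 0)
  exact ⟨jetOfCoord (c := d) (v := ((d.total (c.total.symm 0)).1,
    fun _ => (d.total (c.total.symm 0)).2)) (d.total.map_source hd)⟩

open Classical in
/-- The natural chart of `J^kπ` induced by an adapted chart. -/
def jetChart (k : ℕ) : PartialEquiv (Jet B k) (JetModel m n k) where
  toFun := c.jetCoord
  invFun v := if hv : (v.1, v.2 (.zero m k)) ∈ c.total.target then jetOfCoord hv
    else (c.nonempty_jet k).some
  source := {j | j.target ∈ c.total.source}
  target := {v | (v.1, v.2 (.zero m k)) ∈ c.total.target}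
  map_source' _ hj := jetCoord_mem_target hj
  map_target' v hv := by
    have hv' : (v.1, v.2 (.zero m k)) ∈ c.total.target := hv
    rw [dif_pos hv']
    change (jetOfCoord hv').target ∈ c.total.source
    rw [target_jetOfCoord]
    exact c.total.map_target hv'
  left_inv' j hj := by
    rw [dif_pos (jetCoord_mem_target hj)]
    exact jetOfCoord_jetCoord hj
  right_inv' v hv := by
    have hv' : (v.1, v.2 (.zero m k)) ∈ c.total.target := hv
    rw [dif_pos hv']
    exact jetCoord_jetOfCoord hv'

lemma jetChart_symm {k : ℕ} {v : JetModel m n k} (hv : (v.1, v.2 (.zero m k)) ∈ c.total.target) :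
    (c.jetChart k).symm v = jetOfCoord hv := dif_pos hv

lemma isOpen_jetChart_target (k : ℕ) : IsOpen (c.jetChart (B := B) k).target :=
  c.total.open_target.preimage
    (f := fun v : JetModel m n k => (v.1, v.2 (.zero m k))) (by fun_prop)

lemma mem_jetChart_trans {k : ℕ} {v : JetModel m n k} :
    v ∈ ((c.jetChart k).symm.trans (c'.jetChart k)).source ↔
      (v.1, v.2 (.zero m k)) ∈ c.total.target ∩ c.total.symm ⁻¹' c'.total.source := by
  rw [PartialEquiv.trans_source]
  refine and_congr_right fun h1 => ?_
  have h1' : (v.1, v.2 (.zero m k)) ∈ c.total.target := h1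
  change ((c.jetChart k).symm v).target ∈ c'.total.source ↔ _
  rw [jetChart_symm c h1', target_jetOfCoord]
  rfl

lemma isOpen_jetChart_trans (k : ℕ) :
    IsOpen ((c.jetChart k).symm.trans (c'.jetChart (B := B) k)).source := by
  have : ((c.jetChart k).symm.trans (c'.jetChart (B := B) k)).source
      = (fun v : JetModel m n k => (v.1, v.2 (.zero m k))) ⁻¹'
        (c.total.target ∩ c.total.symm ⁻¹' c'.total.source) :=
    Set.ext fun v => mem_jetChart_trans c c'
  rw [this]
  exact (c.total.symm.isOpen_inter_preimage c'.total.open_source).preimage (by fun_prop)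

lemma jetChart_trans {k : ℕ} {v : JetModel m n k}
    (hv : (v.1, v.2 (.zero m k)) ∈ c.total.target ∩ c.total.symm ⁻¹' c'.total.source) :
    c'.jetChart k ((c.jetChart k).symm v) = (c'.base (c.base.symm v.1), fun I =>
      mpderiv I.1 (c'.localRep (c.taylorSection v)) (c'.base (c.base.symm v.1))) := by
  rw [jetChart_symm c hv.1]
  refine (jetCoord_mk c' _ ?_)
  have := target_jetOfCoord hv.1
  rw [jetOfCoord, Jet.target_mk] at this
  rw [this]
  exact hv.2

lemma contDiffOn_jetChart (k : ℕ) :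
    ContDiffOn ℝ ∞ ((c.jetChart k).symm.trans (c'.jetChart (B := B) k))
      ((c.jetChart k).symm.trans (c'.jetChart k)).source := by
  intro v hv
  have hv' := (mem_jetChart_trans c c').1 hv
  refine ContDiffAt.contDiffWithinAt ?_
  have hcb := c.base_symm_proj hv'.1
  have hmem : c.base.symm v.1 ∈ c'.base.source := by
    rw [← hcb.2]
    exact c'.proj_mem _ hv'.2
  have heq : ((c.jetChart k).symm.trans (c'.jetChart (B := B) k)) =ᶠ[𝓝 v] fun w =>
      (c'.base (c.base.symm w.1), fun I =>
        mpderiv I.1 (c'.localRep (c.taylorSection w)) (c'.base (c.base.symm w.1))) := by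
    filter_upwards [(c.isOpen_jetChart_trans c' k).mem_nhds hv] with w hw
    exact jetChart_trans c c' ((mem_jetChart_trans c c').1 hw)
  refine ContDiffAt.congr_of_eventuallyEq ?_ heq
  have hξ : ContDiffAt ℝ ∞ (fun w : JetModel m n k => c'.base (c.base.symm w.1)) v :=
    ContDiffAt.comp (g := fun z => c'.base (c.base.symm z)) v
      (contDiffAt_base_change hcb.1 hmem) contDiffAt_fst
  refine hξ.prodMk (contDiffAt_pi.2 fun I => ?_)
  have hy : c'.base (c.base.symm v.1) ∈ c'.base.target := c'.base.map_source hmem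
  have hback : c'.base.symm (c'.base (c.base.symm v.1)) = c.base.symm v.1 := c'.base.left_inv hmem
  have hb : ContDiffAt ℝ ∞ (fun z => c.base (c'.base.symm z)) (c'.base (c.base.symm v.1)) :=
    contDiffAt_base_change hy (by rw [hback]; exact c.base.map_target hcb.1)
  have hbv : c.base (c'.base.symm (c'.base (c.base.symm v.1))) = v.1 := by
    rw [hback, c.base.right_inv hcb.1]
  have hF : ContDiffAt ℝ ∞ (fun z : JetModel m n k × (Fin m → ℝ) =>
      c'.localRep (c.taylorSection z.1) z.2) (v, c'.base (c.base.symm v.1)) := by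
    have h1 : ContDiffAt ℝ ∞ (fun z : JetModel m n k × (Fin m → ℝ) =>
        (c.base (c'.base.symm z.2))) (v, c'.base (c.base.symm v.1)) :=
      ContDiffAt.comp (g := fun z => c.base (c'.base.symm z)) _ hb contDiffAt_snd
    have h2 : ContDiffAt ℝ ∞ (fun z : JetModel m n k × (Fin m → ℝ) =>
        taylorAt z.1.1 z.1.2 (c.base (c'.base.symm z.2))) (v, c'.base (c.base.symm v.1)) :=
      ((contDiff_taylorAt (W := Fin n → ℝ) k).contDiffAt).comp
        (f := fun z : JetModel m n k × (Fin m → ℝ) => (z.1, c.base (c'.base.symm z.2))) _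
        (contDiffAt_fst.prodMk h1)
    have h3 : (c.base (c'.base.symm (c'.base (c.base.symm v.1))),
        taylorAt v.1 v.2 (c.base (c'.base.symm (c'.base (c.base.symm v.1)))))
        = (v.1, v.2 (.zero m k)) := by
      rw [hbv, taylorAt_self]
    have h4 : ContDiffAt ℝ ∞ (fun p => c'.total (c.total.symm p))
        (c.base (c'.base.symm (c'.base (c.base.symm v.1))),
        taylorAt v.1 v.2 (c.base (c'.base.symm (c'.base (c.base.symm v.1))))) := by
      rw [h3]
      exact contDiffAt_total_change hv'.1 hv'.2
    exact contDiff_snd.contDiffAt.comp _ (ContDiffAt.comp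
      (g := fun p => c'.total (c.total.symm p))
      (f := fun z : JetModel m n k × (Fin m → ℝ) => (c.base (c'.base.symm z.2),
        taylorAt z.1.1 z.1.2 (c.base (c'.base.symm z.2)))) _ h4 (h1.prodMk h2))
  exact ContDiffAt.comp (g := fun z : JetModel m n k × (Fin m → ℝ) =>
      lderiv (dirs I.1) (c'.localRep (c.taylorSection z.1)) z.2)
    (f := fun w : JetModel m n k => (w, c'.base (c.base.symm w.1))) v
    (contDiffAt_lderiv_param (F := fun w : JetModel m n k => c'.localRep (c.taylorSection w))
      (dirs I.1) hF) (contDiffAt_id.prodMk hξ)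

end AdaptedChart

/-- The natural charts of `J^kπ`. -/
def jetCharts (B : FieldBundle m n) (k : ℕ) : SmoothCharts B.Chart (Jet B k) (JetModel m n k) where
  chart c := c.jetChart k
  exists_mem j := B.exists_chart j.target
  isOpen c c' := c.isOpen_jetChart_trans c' k
  smooth c c' := c.contDiffOn_jetChart c' k

instance (B : FieldBundle m n) (k : ℕ) : TopologicalSpace (Jet B k) :=
  (jetCharts B k).topologicalSpace

instance (B : FieldBundle m n) (k : ℕ) : ChartedSpace (JetModel m n k) (Jet B k) :=
  (jetCharts B k).chartedSpace

instance (B : FieldBundle m n) (k : ℕ) :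
    IsManifold 𝓘(ℝ, JetModel m n k) ∞ (Jet B k) :=
  (jetCharts B k).isManifold

end Jets

/-! ### Momenta -/

section Forms

variable {m : ℕ} {V : Type*} [NormedAddCommGroup V] [NormedSpace ℝ V]

/-- The exterior product `ℓ¹ ∧ … ∧ ℓ^m` of `m` linear forms. -/
def wedge (ℓ : Fin m → V →L[ℝ] ℝ) : V [⋀^Fin m]→L[ℝ] ℝ :=
  { (Matrix.detRowAlternating (n := Fin m) (R := ℝ)).compLinearMap
      (ContinuousLinearMap.pi ℓ).toLinearMap with
    cont := by
      have : Continuous fun v : Fin m → V => Matrix.det (Matrix.of fun i j => ℓ j (v i)) :=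
        Continuous.matrix_det (by fun_prop)
      exact this }

lemma wedge_apply (ℓ : Fin m → V →L[ℝ] ℝ) (v : Fin m → V) :
    wedge ℓ v = Matrix.det (Matrix.of fun i j => ℓ j (v i)) := rfl

variable {W : Type*} [NormedAddCommGroup W] [NormedSpace ℝ W]

/-- A form on `ℝ^m × W` that vanishes whenever two of its arguments lie in `W`. -/
def TwoHorizontal (θ : ((Fin m → ℝ) × W) [⋀^Fin m]→L[ℝ] ℝ) : Prop :=
  ∀ v : Fin m → (Fin m → ℝ) × W, ∀ k l, k ≠ l → (v k).1 = 0 → (v l).1 = 0 → θ v = 0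

/-- A form on `ℝ^m × W` that vanishes whenever one of its arguments lies in `W`. -/
def Semibasic (θ : ((Fin m → ℝ) × W) [⋀^Fin m]→L[ℝ] ℝ) : Prop :=
  ∀ v : Fin m → (Fin m → ℝ) × W, ∀ k, (v k).1 = 0 → θ v = 0

variable (W) in
/-- The vectors `∂/∂xⁱ`. -/
def vecX (i : Fin m) : (Fin m → ℝ) × W := (Pi.single i 1, 0)

variable (W) in
/-- The linear forms `dxⁱ`. -/
def formX (i : Fin m) : (Fin m → ℝ) × W →L[ℝ] ℝ :=
  (ContinuousLinearMap.proj i).comp (ContinuousLinearMap.fst ℝ _ _)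

@[simp] lemma formX_apply (i : Fin m) (v : (Fin m → ℝ) × W) : formX W i v = v.1 i := rfl

lemma TwoHorizontal.eq_zero [FiniteDimensional ℝ W]
    {θ : ((Fin m → ℝ) × W) [⋀^Fin m]→L[ℝ] ℝ} (h : TwoHorizontal θ)
    (h0 : θ (vecX W) = 0)
    (h1 : ∀ k w, θ (Function.update (vecX W) k (0, w)) = 0) : θ = 0 := by
  apply ContinuousAlternatingMap.toAlternatingMap_injective
  let b := Module.finBasis ℝ W
  refine Module.Basis.ext_alternating ((Pi.basisFun ℝ (Fin m)).prod b) fun s hs => ?_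
  simp only [ContinuousAlternatingMap.coe_toAlternatingMap]
  change θ _ = 0
  by_cases hv : ∃ k l, k ≠ l ∧ (s k).isRight ∧ (s l).isRight
  · obtain ⟨k, l, hkl, hk, hl⟩ := hv
    obtain ⟨a, ha⟩ := Sum.isRight_iff.1 hk
    obtain ⟨a', ha'⟩ := Sum.isRight_iff.1 hl
    exact h _ k l hkl (by simp [ha]) (by simp [ha'])
  · push Not at hv
    by_cases hr : ∃ k, (s k).isRight
    · obtain ⟨k, hk⟩ := hr
      obtain ⟨a, ha⟩ := Sum.isRight_iff.1 hk
      have hl : ∀ l, l ≠ k → ∃ i, s l = Sum.inl i := by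
        intro l hlk
        have := hv k l hlk.symm hk
        rcases hsl : s l with i | i
        · exact ⟨i, rfl⟩
        · simp [hsl] at this
      have hl' : ∃ t : Fin m → Fin m, ∀ l, l ≠ k → s l = Sum.inl (t l) := by
        refine ⟨fun l => if hlk : l = k then k else (hl l hlk).choose, fun l hlk => ?_⟩
        simp only [hlk, dif_neg, not_false_eq_true]
        exact (hl l hlk).choose_spec
      obtain ⟨t, ht⟩ := hl'
      obtain ⟨e, he⟩ : ∃ e, e ∉ Finset.image t {k}ᶜ := by
        by_contra hcon
        push Not at hcon
        have h2 : Finset.univ ⊆ Finset.image t {k}ᶜ := fun x _ => hcon x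
        have h3 := (Finset.card_le_card h2).trans Finset.card_image_le
        rw [Finset.card_compl] at h3
        have := k.pos
        simp at h3
        omega
      have hinj : Function.Injective (Function.update t k e) := by
        intro x y hxy
        by_cases hx : x = k <;> by_cases hy : y = k
        · rw [hx, hy]
        · simp only [hx, hy, Function.update_self, ne_eq, not_false_eq_true,
            Function.update_of_ne] at hxy
          exact absurd (Finset.mem_image.2 ⟨y, by simpa using hy, hxy.symm⟩) he
        · simp only [hx, hy, Function.update_self, ne_eq, not_false_eq_true,
            Function.update_of_ne] at hxy
          exact absurd (Finset.mem_image.2 ⟨x, by simpa using hx, hxy⟩) he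
        · simp only [hx, hy, ne_eq, not_false_eq_true, Function.update_of_ne] at hxy
          apply hs
          rw [ht x hx, ht y hy, hxy]
      let σ : Equiv.Perm (Fin m) := Equiv.ofBijective _ (Finite.injective_iff_bijective.1 hinj)
      have : (fun i => ((Pi.basisFun ℝ (Fin m)).prod b) (s i))
          = (Function.update (vecX W) e (0, b a)) ∘ σ := by
        funext l
        simp only [σ, Function.comp_apply, Equiv.ofBijective_apply]
        by_cases hlk : l = k
        · subst hlk
          ext1 <;> simp [ha]
        · have hne : t l ≠ e := by
            rintro rfl
            exact he (Finset.mem_image.2 ⟨l, by simpa using hlk, rfl⟩)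
          rw [ht l hlk]
          ext1 <;> simp [hlk, hne, vecX]
      rw [this]
      have := θ.toAlternatingMap.map_perm (Function.update (vecX W) e (0, b a)) σ
      simp only [ContinuousAlternatingMap.coe_toAlternatingMap, h1, smul_zero] at this
      exact this
    · push Not at hr
      have hl : ∀ l, ∃ i, s l = Sum.inl i := by
        intro l
        have := hr l
        rcases hsl : s l with i | i
        · exact ⟨i, rfl⟩
        · simp [hsl] at this
      choose t ht using hl
      have hinj : Function.Injective t := fun x y hxy => hs (by rw [ht x, ht y, hxy])
      let σ : Equiv.Perm (Fin m) := Equiv.ofBijective _ (Finite.injective_iff_bijective.1 hinj)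
      have : (fun i => ((Pi.basisFun ℝ (Fin m)).prod b) (s i)) = vecX W ∘ σ := by
        funext l
        simp only [σ, Function.comp_apply, Equiv.ofBijective_apply, ht l]
        ext1 <;> simp [vecX]
      rw [this]
      have := θ.toAlternatingMap.map_perm (vecX W) σ
      simp only [ContinuousAlternatingMap.coe_toAlternatingMap, h0, smul_zero] at this
      exact this

lemma twoHorizontal_wedge (i : Fin m) (f : (Fin m → ℝ) × W →L[ℝ] ℝ) :
    TwoHorizontal (wedge (Function.update (formX W) i f)) := by
  intro v k l hkl hk hl
  rw [wedge_apply, Matrix.det_apply]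
  refine Finset.sum_eq_zero fun σ _ => ?_
  have : ∏ j, (Matrix.of fun a j => Function.update (formX W) i f j (v a)) (σ j) j = 0 := by
    by_cases h : σ.symm k = i
    · have h' : σ.symm l ≠ i := fun h'' => hkl (σ.symm.injective (h.trans h''.symm))
      exact Finset.prod_eq_zero (Finset.mem_univ (σ.symm l)) (by simp [h', hl])
    · exact Finset.prod_eq_zero (Finset.mem_univ (σ.symm k)) (by simp [h, hk])
  rw [this, smul_zero]

lemma wedge_formX_eq_zero {v : Fin m → (Fin m → ℝ) × W} {k : Fin m} (hk : (v k).1 = 0) :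
    wedge (formX W) v = 0 := by
  rw [wedge_apply]
  exact Matrix.det_eq_zero_of_row_eq_zero k (by simp [hk])

lemma wedge_formX_vecX : wedge (m := m) (formX W) (vecX W) = (1 : ℝ) := by
  rw [wedge_apply]
  convert Matrix.det_one (R := ℝ) (n := Fin m)
  ext i j
  simp [vecX, Pi.single_apply, Matrix.one_apply, eq_comm]

lemma wedge_update_vecX (i : Fin m) (f : W →L[ℝ] ℝ) :
    wedge (Function.update (formX W) i (f.comp (ContinuousLinearMap.snd ℝ _ _))) (vecX W) = 0 := by
  rw [wedge_apply]
  refine Matrix.det_eq_zero_of_row_eq_zero i fun j => ?_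
  by_cases h : j = i
  · subst h; simp [vecX]
  · simp [vecX, h]

/-- The value of `dx¹ ∧ … ∧ f ∧ … ∧ dx^m` on `m - 1` vectors of `ℝ^m` and one of `W`. -/
lemma wedge_update_apply (A : Fin m → Fin m → ℝ) (i k : Fin m) (f : W →L[ℝ] ℝ) (w : W) :
    wedge (Function.update (formX W) i (f.comp (ContinuousLinearMap.snd ℝ _ _)))
      (Function.update (fun r => (A r, (0 : W))) k (0, w)) = (Matrix.of A).adjugate i k * f w := by
  rw [wedge_apply, Matrix.adjugate_apply, Matrix.det_apply, Matrix.det_apply, Finset.sum_mul]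
  refine Finset.sum_congr rfl fun σ _ => ?_
  rw [smul_mul_assoc]
  congr 1
  by_cases h : σ i = k
  · have key : ∀ g : Fin m → Fin m → ℝ, ∏ j, g (σ j) j = g k i * ∏ j ∈ {i}ᶜ, g (σ j) j := by
      intro g
      rw [← h, ← Finset.mul_prod_erase Finset.univ _ (Finset.mem_univ i)]
      congr 1
      refine Finset.prod_congr ?_ fun _ _ => rfl
      ext; simp
    refine (key fun a j => Function.update (formX W) i (f.comp (ContinuousLinearMap.snd ℝ _ _)) j
      (Function.update (fun r => (A r, (0 : W))) k (0, w) a)).trans ?_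
    refine Eq.trans ?_ (congrArg (· * f w)
      (key ((Matrix.of A).updateRow k (Pi.single i 1)))).symm
    rw [mul_comm, mul_comm (Matrix.updateRow _ _ _ _ _), mul_assoc]
    congr 1
    · refine Finset.prod_congr rfl fun j hj => ?_
      have hji : j ≠ i := by simpa using hj
      have hjk : σ j ≠ k := fun h' => hji (σ.injective (h'.trans h.symm))
      simp [hji, hjk, Matrix.updateRow_apply]
    · simp
  · have h' : σ.symm k ≠ i := fun h' => h (by rw [← h', Equiv.apply_symm_apply])
    rw [Finset.prod_eq_zero (Finset.mem_univ (σ.symm k)) (by simp [h']),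
      Finset.prod_eq_zero (Finset.mem_univ (σ.symm k)) (by simp [h']), zero_mul]

lemma wedge_update_update (i k : Fin m) (f : W →L[ℝ] ℝ) (w : W) :
    wedge (Function.update (formX W) i (f.comp (ContinuousLinearMap.snd ℝ _ _)))
      (Function.update (vecX W) k (0, w)) = if i = k then f w else 0 := by
  have := wedge_update_apply (fun r => Pi.single r 1) i k f w
  have h1 : Matrix.of (fun r : Fin m => (Pi.single r 1 : Fin m → ℝ)) = 1 := by
    ext a b
    simp [Pi.single_apply, Matrix.one_apply, eq_comm]
  rw [h1, Matrix.adjugate_one, Matrix.one_apply] at this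
  refine this.trans ?_
  split_ifs <;> simp

/-- The linear form `w ↦ θ(∂/∂x¹, …, w, …, ∂/∂x^m)` on `W`. -/
def TwoHorizontal.slot (θ : ((Fin m → ℝ) × W) [⋀^Fin m]→L[ℝ] ℝ) (k : Fin m) : W →L[ℝ] ℝ :=
  (θ.toContinuousMultilinearMap.toContinuousLinearMap (vecX W) k).comp
    (ContinuousLinearMap.inr ℝ _ _)

lemma TwoHorizontal.slot_apply (θ : ((Fin m → ℝ) × W) [⋀^Fin m]→L[ℝ] ℝ) (k : Fin m) (w : W) :
    TwoHorizontal.slot θ k w = θ (Function.update (vecX W) k (0, w)) := rfl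

/-- The form with given components `p` and `f_k`. -/
def formOf (p : ℝ) (f : Fin m → W →L[ℝ] ℝ) : ((Fin m → ℝ) × W) [⋀^Fin m]→L[ℝ] ℝ :=
  p • wedge (formX W) +
    ∑ k, wedge (Function.update (formX W) k ((f k).comp (ContinuousLinearMap.snd ℝ _ _)))

lemma twoHorizontal_formOf (p : ℝ) (f : Fin m → W →L[ℝ] ℝ) : TwoHorizontal (formOf p f) := by
  intro v k l hkl hk hl
  simp only [formOf, ContinuousAlternatingMap.add_apply, ContinuousAlternatingMap.smul_apply,
    ContinuousAlternatingMap.sum_apply, wedge_formX_eq_zero hk, smul_zero, zero_add]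
  exact Finset.sum_eq_zero fun i _ => twoHorizontal_wedge i _ v k l hkl hk hl

lemma formOf_vecX (p : ℝ) (f : Fin m → W →L[ℝ] ℝ) : formOf p f (vecX W) = p := by
  simp [formOf, wedge_formX_vecX, wedge_update_vecX]

lemma formOf_update (p : ℝ) (f : Fin m → W →L[ℝ] ℝ) (k : Fin m) (w : W) :
    formOf p f (Function.update (vecX W) k (0, w)) = f k w := by
  have : wedge (formX W) (Function.update (vecX W) k (0, w)) = 0 :=
    wedge_formX_eq_zero (k := k) (by simp)
  simp [formOf, wedge_update_update, this]

lemma TwoHorizontal.sub {θ θ' : ((Fin m → ℝ) × W) [⋀^Fin m]→L[ℝ] ℝ} (h : TwoHorizontal θ)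
    (h' : TwoHorizontal θ') : TwoHorizontal (θ - θ') := by
  intro v k l hkl hk hl
  simp [h v k l hkl hk hl, h' v k l hkl hk hl]

lemma TwoHorizontal.eq_formOf [FiniteDimensional ℝ W]
    {θ : ((Fin m → ℝ) × W) [⋀^Fin m]→L[ℝ] ℝ} (h : TwoHorizontal θ) :
    θ = formOf (θ (vecX W)) (TwoHorizontal.slot θ) := by
  rw [← sub_eq_zero]
  refine TwoHorizontal.eq_zero (h.sub (twoHorizontal_formOf _ _)) ?_ fun k w => ?_
  · simp [formOf_vecX]
  · simp [formOf_update, slot_apply]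

/-- A form with two horizontal arguments only sees the horizontal parts of the others, if one
argument is vertical. -/
lemma TwoHorizontal.congr {θ : ((Fin m → ℝ) × W) [⋀^Fin m]→L[ℝ] ℝ} (h : TwoHorizontal θ)
    {v v' : Fin m → (Fin m → ℝ) × W} {k : Fin m} (hk : (v k).1 = 0) (hkk : v k = v' k)
    (hv : ∀ r, (v r).1 = (v' r).1) : θ v = θ v' := by
  classical
  have : ∀ s : Finset (Fin m), θ (s.piecewise v' v) = θ v := by
    intro s
    induction s using Finset.induction_on with
    | empty => simp
    | insert a s ha ih =>
      rw [Finset.piecewise_insert, ← ih]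
      by_cases hak : a = k
      · subst hak
        congr 1
        rw [← hkk]
        conv_rhs => rw [← Function.update_eq_self a (s.piecewise v' v)]
        simp [ha]
      · conv_rhs => rw [← Function.update_eq_self a (s.piecewise v' v)]
        rw [← sub_eq_zero, ← ContinuousAlternatingMap.map_update_sub]
        refine h _ a k hak (by simp [ha, hv]) ?_
        rw [Function.update_of_ne (Ne.symm hak)]
        by_cases hks : k ∈ s <;> simp [hks, hk, ← hkk]
  rw [← this Finset.univ]
  simp

lemma TwoHorizontal.apply_update [FiniteDimensional ℝ W]
    {θ : ((Fin m → ℝ) × W) [⋀^Fin m]→L[ℝ] ℝ} (h : TwoHorizontal θ)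
    (A : Fin m → Fin m → ℝ) (k : Fin m) (w : W) :
    θ (Function.update (fun r => (A r, (0 : W))) k (0, w))
      = ∑ i, (Matrix.of A).adjugate i k * TwoHorizontal.slot θ i w := by
  have : wedge (formX W) (Function.update (fun r => (A r, (0 : W))) k (0, w)) = 0 :=
    wedge_formX_eq_zero (k := k) (by simp)
  conv_lhs => rw [h.eq_formOf]
  simp [formOf, wedge_update_apply, this]

end Forms

section Momenta

variable {m n : ℕ}

lemma MultiIndexLE.eq_zero_or_one (I : MultiIndexLE m 1) :
    I = .zero m 1 ∨ ∃ i, I = .one 0 i := by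
  have h := length_dirs I.1
  have h1 := I.2
  rcases hd : dirs I.1 with _ | ⟨i, l⟩
  · left
    ext j
    rw [← count_dirs I.1 j, hd]
    rfl
  · right
    refine ⟨i, ?_⟩
    have hl : l = [] := by
      apply List.eq_nil_of_length_eq_zero
      simp [hd] at h
      omega
    ext j
    rw [← count_dirs I.1 j, hd, hl]
    by_cases hij : j = i
    · subst hij; simp [MultiIndexLE.one]
    · simp [MultiIndexLE.one, hij, Ne.symm hij]

lemma MultiIndexLE.one_injective (i j : Fin m) (h : MultiIndexLE.one 0 i = .one 0 j) : i = j := by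
  have := congrArg (fun I => I.1 i) h
  by_contra hij
  simp [MultiIndexLE.one, hij] at this

lemma MultiIndexLE.one_ne_zero (i : Fin m) : MultiIndexLE.one 0 i ≠ .zero m 1 := by
  intro h
  have := congrArg (fun I => I.1 i) h
  simp [MultiIndexLE.one, MultiIndexLE.zero] at this

lemma MultiIndexTwo.exists_pair (K : MultiIndexTwo m) : ∃ i j, K = .pair i j := by
  have h := length_dirs K.1
  rw [K.2] at h
  obtain ⟨i, j, hij⟩ := List.length_eq_two.1 h
  refine ⟨i, j, ?_⟩
  ext a
  rw [← count_dirs K.1 a, hij]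
  simp only [List.count_cons, List.count_nil, MultiIndexTwo.pair, Pi.add_apply, Pi.single_apply,
    beq_iff_eq]
  grind

lemma MultiIndexTwo.pair_comm (i j : Fin m) : MultiIndexTwo.pair i j = .pair j i :=
  Subtype.ext (add_comm _ _)

lemma MultiIndexTwo.pair_eq_iff {a b i j : Fin m} :
    MultiIndexTwo.pair a b = .pair i j ↔ (a = i ∧ b = j) ∨ (a = j ∧ b = i) := by
  constructor
  · intro h
    have h1 := congrArg (fun I => I.1 a) h
    have h2 := congrArg (fun I => I.1 b) h
    have h3 := congrArg (fun I => I.1 i) h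
    have h4 := congrArg (fun I => I.1 j) h
    simp only [MultiIndexTwo.pair, Pi.add_apply, Pi.single_apply] at h1 h2 h3 h4
    grind
  · rintro (⟨rfl, rfl⟩ | ⟨rfl, rfl⟩)
    · rfl
    · exact pair_comm _ _

lemma sum_pair (i j : Fin m) (g : Fin m → Fin m → ℝ) :
    (∑ a, ∑ b, if MultiIndexTwo.pair a b = .pair i j then g a b else 0)
      = if i = j then g i i else g i j + g j i := by
  simp only [MultiIndexTwo.pair_eq_iff]
  by_cases h : i = j
  · subst h
    simp [or_self, ite_and, Finset.sum_ite_eq']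
  · have : ∀ a b, (if (a = i ∧ b = j) ∨ (a = j ∧ b = i) then g a b else 0)
        = (if a = i then if b = j then g a b else 0 else 0)
          + (if a = j then if b = i then g a b else 0 else 0) := by
      intro a b
      grind
    simp [this, Finset.sum_add_distrib, h]

/-- Exterior `m`-forms at a point of the space with coordinates `(xⁱ, u^α, u_i^α)`. -/
abbrev JetForm (m n : ℕ) : Type := JetModel m n 1 [⋀^Fin m]→L[ℝ] ℝ

/-- The vector `∂/∂u_I^α` (without its zero component along the base). -/
def vecU {k : ℕ} (I : MultiIndexLE m k) (α : Fin n) : MultiIndexLE m k → Fin n → ℝ :=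
  Pi.single I (Pi.single α 1)

/-- The linear form `du_I^α`. -/
def formU {k : ℕ} (I : MultiIndexLE m k) (α : Fin n) : (MultiIndexLE m k → Fin n → ℝ) →L[ℝ] ℝ :=
  (ContinuousLinearMap.proj (R := ℝ) (φ := fun _ : Fin n => ℝ) α).comp
    (ContinuousLinearMap.proj (φ := fun _ : MultiIndexLE m k => Fin n → ℝ) I)

@[simp] lemma formU_apply {k : ℕ} (I : MultiIndexLE m k) (α : Fin n)
    (w : MultiIndexLE m k → Fin n → ℝ) : formU I α w = w I α := rfl

/-- The coefficient of `du_I^α ∧ d^{m-1}x_i` in a form. -/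
def JetForm.coeff (θ : JetForm m n) (I : MultiIndexLE m 1) (i : Fin m) (α : Fin n) : ℝ :=
  θ (Function.update (vecX _) i (0, vecU I α))

/-- The forms
`p dᵐx + p^i_α du^α ∧ d^{m-1}x_i + p^{ij}_α du_i^α ∧ d^{m-1}x_j` with `p^{ij}_α = p^{ji}_α`. -/
def symForms (m n : ℕ) : Submodule ℝ (JetForm m n) where
  carrier := {θ | TwoHorizontal θ ∧ ∀ i j α, θ.coeff (.one 0 i) j α = θ.coeff (.one 0 j) i α}
  zero_mem' := ⟨fun _ _ _ _ _ _ => rfl, fun _ _ _ => rfl⟩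
  add_mem' {a b} ha hb := ⟨fun v k l hkl hk hl => by
    simp [ha.1 v k l hkl hk hl, hb.1 v k l hkl hk hl], fun i j α => by
    have h1 := ha.2 i j α
    have h2 := hb.2 i j α
    simp only [JetForm.coeff, ContinuousAlternatingMap.add_apply] at *
    rw [h1, h2]⟩
  smul_mem' r a ha := ⟨fun v k l hkl hk hl => by
    simp [ha.1 v k l hkl hk hl], fun i j α => by
    have h1 := ha.2 i j α
    simp only [JetForm.coeff, ContinuousAlternatingMap.smul_apply] at *
    rw [h1]⟩

/-- The forms `p dᵐx`. -/
def semibasicForms (m n : ℕ) : Submodule ℝ (JetForm m n) where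
  carrier := {θ | Semibasic θ}
  zero_mem' := fun _ _ _ => rfl
  add_mem' {a b} ha hb := fun v k hk => by simp [ha v k hk, hb v k hk]
  smul_mem' r a ha := fun v k hk => by simp [ha v k hk]

/-- The space with coordinates `(p^i_α, p^I_α)`. -/
abbrev RestMomModel (m n : ℕ) : Type := (Fin m → Fin n → ℝ) × (MultiIndexTwo m → Fin n → ℝ)

/-- The space with coordinates `(p, p^i_α, p^I_α)`. -/
abbrev ExtMomModel (m n : ℕ) : Type := ℝ × RestMomModel m n

/-- The coordinates `(p, p^i_α, p^I_α)` of a form, where `p^{1_i+1_j}_α = n(ij) p^{ij}_α`, that is,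
`p^I_α` is the sum of the `p^{ij}_α` over all `(i, j)` with `1_i + 1_j = I`. -/
def JetForm.coord : JetForm m n →ₗ[ℝ] ExtMomModel m n where
  toFun θ := (θ (vecX _), fun i α => θ.coeff (.zero m 1) i α, fun K α =>
    ∑ i, ∑ j, if MultiIndexTwo.pair i j = K then θ.coeff (.one 0 i) j α else 0)
  map_add' θ θ' := by
    ext
    · rfl
    · rfl
    · simp only [JetForm.coeff, ContinuousAlternatingMap.add_apply, Prod.snd_add, Pi.add_apply,
        ← Finset.sum_add_distrib]
      refine Finset.sum_congr rfl fun i _ => Finset.sum_congr rfl fun j _ => ?_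
      split_ifs <;> simp
  map_smul' r θ := by
    ext
    · rfl
    · rfl
    · simp only [JetForm.coeff, ContinuousAlternatingMap.smul_apply, Prod.smul_snd, Pi.smul_apply,
        Finset.smul_sum, RingHom.id_apply]
      refine Finset.sum_congr rfl fun i _ => Finset.sum_congr rfl fun j _ => ?_
      split_ifs <;> simp

lemma JetForm.coord_pair (θ : JetForm m n) (i j : Fin m) (α : Fin n) :
    (coord θ).2.2 (.pair i j) α = if i = j then θ.coeff (.one 0 i) i α else
      θ.coeff (.one 0 i) j α + θ.coeff (.one 0 j) i α := by
  rw [← sum_pair i j fun a b => θ.coeff (.one 0 a) b α]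
  rfl

/-- The form with given coordinates `(p, p^i_α, p^I_α)`. -/
def JetForm.ofCoord (q : ExtMomModel m n) : JetForm m n :=
  formOf q.1 fun j =>
    ∑ α, (q.2.1 j α • formU (.zero m 1) α
      + ∑ i, ((nn i j)⁻¹ * q.2.2 (.pair i j) α) • formU (.one 0 i) α)

lemma JetForm.coeff_ofCoord (q : ExtMomModel m n) (I : MultiIndexLE m 1) (j : Fin m) (α : Fin n) :
    (ofCoord q).coeff I j α = (if I = .zero m 1 then q.2.1 j α else 0) +
      ∑ i, if I = .one 0 i then (nn i j)⁻¹ * q.2.2 (.pair i j) α else 0 := by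
  rw [coeff, ofCoord, formOf_update]
  simp only [vecU, sum_apply, add_apply, smul_apply,
    formU_apply, smul_eq_mul]
  rw [Finset.sum_eq_single α]
  · congr 1
    · by_cases h : I = .zero m 1
      · subst h; simp
      · simp [h]
    · refine Finset.sum_congr rfl fun i _ => ?_
      by_cases h : I = .one 0 i
      · subst h; simp
      · simp [h]
  · intro β _ hβ
    have : ∀ J : MultiIndexLE m 1,
        (Pi.single I (Pi.single α 1) : MultiIndexLE m 1 → Fin n → ℝ) J β = 0 := by
      intro J
      by_cases h : J = I
      · subst h; simp [hβ]
      · simp [h]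
    simp [this]
  · simp

lemma JetForm.coeff_ofCoord_zero (q : ExtMomModel m n) (j : Fin m) (α : Fin n) :
    (ofCoord q).coeff (.zero m 1) j α = q.2.1 j α := by
  rw [coeff_ofCoord]
  simp [(MultiIndexLE.one_ne_zero _).symm]

lemma JetForm.coeff_ofCoord_one (q : ExtMomModel m n) (i j : Fin m) (α : Fin n) :
    (ofCoord q).coeff (.one 0 i) j α = (nn i j)⁻¹ * q.2.2 (.pair i j) α := by
  rw [coeff_ofCoord, Finset.sum_eq_single i]
  · simp [MultiIndexLE.one_ne_zero]
  · intro k _ hk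
    rw [if_neg fun h => hk (MultiIndexLE.one_injective _ _ h).symm]
  · simp

lemma nn_comm (i j : Fin m) : nn i j = nn j i := by simp [nn, eq_comm]

lemma JetForm.ofCoord_mem (q : ExtMomModel m n) : ofCoord q ∈ symForms m n := by
  refine ⟨twoHorizontal_formOf _ _, fun i j α => ?_⟩
  rw [coeff_ofCoord_one, coeff_ofCoord_one, nn_comm, MultiIndexTwo.pair_comm]

lemma JetForm.coord_ofCoord (q : ExtMomModel m n) : coord (ofCoord q) = q := by
  refine Prod.ext (formOf_vecX _ _) (Prod.ext ?_ ?_)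
  · funext j α
    exact coeff_ofCoord_zero q j α
  · funext K α
    obtain ⟨i, j, rfl⟩ := K.exists_pair
    rw [coord_pair, coeff_ofCoord_one, coeff_ofCoord_one, coeff_ofCoord_one]
    split_ifs with h
    · subst h; simp [nn]
    · rw [nn_comm j i, MultiIndexTwo.pair_comm j i]
      simp only [nn, h, if_false]
      ring

lemma JetForm.eq_zero_of_coord {θ : JetForm m n} (hθ : θ ∈ symForms m n) (h : coord θ = 0) :
    θ = 0 := by
  refine hθ.1.eq_zero (congrArg Prod.fst h) fun k w => ?_
  rw [← TwoHorizontal.slot_apply]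
  suffices hs : TwoHorizontal.slot θ k = 0 by rw [hs]; rfl
  apply ContinuousLinearMap.coe_injective
  refine LinearMap.pi_ext' fun I => LinearMap.pi_ext' fun α => LinearMap.ext_ring ?_
  change θ.coeff I k α = 0
  rcases I.eq_zero_or_one with rfl | ⟨i, rfl⟩
  · exact congrFun (congrFun (congrArg (fun q => q.2.1) h) k) α
  · have h1 : (coord θ).2.2 (.pair i k) α = 0 := by rw [h]; rfl
    rw [coord_pair] at h1
    split_ifs at h1 with h2
    · subst h2; exact h1
    · have := hθ.2 i k α
      linarith

lemma JetForm.ofCoord_coord {θ : JetForm m n} (hθ : θ ∈ symForms m n) : ofCoord (coord θ) = θ := by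
  rw [← sub_eq_zero]
  refine eq_zero_of_coord (sub_mem (ofCoord_mem _) hθ) ?_
  rw [map_sub, coord_ofCoord, sub_self]

lemma JetForm.semibasic_iff {θ : JetForm m n} (hθ : θ ∈ symForms m n) :
    θ ∈ semibasicForms m n ↔ (coord θ).2 = 0 := by
  constructor
  · intro h
    have hc : ∀ I i α, θ.coeff I i α = 0 := fun I i α => h _ i (by simp)
    ext1
    · funext i α
      exact hc _ _ _
    · funext K α
      obtain ⟨i, j, rfl⟩ := K.exists_pair
      rw [coord_pair]
      simp [hc]
  · intro h v k hk
    rw [← ofCoord_coord hθ, ofCoord, h]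
    have := wedge_formX_eq_zero hk
    simp [formOf, this, wedge_apply]
    refine Finset.sum_eq_zero fun i _ => ?_
    exact Matrix.det_eq_zero_of_column_eq_zero i (by simp)

end Momenta

section Change

variable {m n : ℕ}

/-- The properties of the derivative of a change of natural coordinates of the first jet bundle
that give the transformation law of the momenta. -/
structure JetLike (L : JetModel m n 1 →L[ℝ] JetModel m n 1) (X : Matrix (Fin m) (Fin m) ℝ)
    (D : Fin n → Fin n → ℝ) : Prop where
  vertical : ∀ w, (L (0, w)).1 = 0
  inv : (Matrix.of fun r => (L (vecX _ r)).1) * X = 1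
  first : ∀ i α, L (0, vecU (.one 0 i) α) = (0, ∑ s, X s i • Pi.single (.one 0 s) (D α))

lemma JetLike.vertical' {L : JetModel m n 1 →L[ℝ] JetModel m n 1} {X D} (h : JetLike L X D)
    {v : JetModel m n 1} (hv : v.1 = 0) :
    (L v).1 = 0 := by
  have : v = (0, v.2) := Prod.ext hv rfl
  rw [this]
  exact h.vertical _

lemma JetLike.semibasic {L : JetModel m n 1 →L[ℝ] JetModel m n 1} {X D} (h : JetLike L X D)
    {θ : JetForm m n} (hθ : θ ∈ semibasicForms m n) :
    θ.compContinuousLinearMap L ∈ semibasicForms m n :=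
  fun _ k hk => hθ _ k (h.vertical' hk)

lemma JetLike.sym {L : JetModel m n 1 →L[ℝ] JetModel m n 1} {X D} (h : JetLike L X D)
    {θ : JetForm m n} (hθ : θ ∈ symForms m n) :
    θ.compContinuousLinearMap L ∈ symForms m n := by
  refine ⟨fun v k l hkl hk hl => hθ.1 _ k l hkl (h.vertical' hk) (h.vertical' hl), ?_⟩
  set A := Matrix.of fun r => (L (vecX _ r)).1 with hA
  have hadj : A.adjugate = A.det • X := by
    have h1 : A.adjugate * (A * X) = A.det • X := by
      rw [← mul_assoc, Matrix.adjugate_mul, Matrix.smul_mul, one_mul]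
    rw [h.inv, mul_one] at h1
    exact h1
  set F : Fin n → Fin m → Fin m → ℝ := fun α s l =>
    TwoHorizontal.slot θ l (Pi.single (.one 0 s) (D α)) with hF
  have hFs : ∀ α s l, F α s l = F α l s := by
    intro α s l
    have : ∀ s : Fin m, (Pi.single (.one 0 s) (D α) : MultiIndexLE m 1 → Fin n → ℝ)
        = ∑ β, D α β • vecU (.one 0 s) β := by
      intro s
      funext J β
      by_cases hJ : J = .one 0 s
      · subst hJ
        simp [vecU, Finset.sum_apply, Pi.single_apply]
      · simp [vecU, Finset.sum_apply, hJ]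
    simp only [hF, this, map_sum, map_smul]
    refine Finset.sum_congr rfl fun β _ => ?_
    congr 1
    exact hθ.2 s l β
  have key : ∀ i k α, JetForm.coeff (θ.compContinuousLinearMap L) (.one 0 i) k α
      = A.det * ∑ l, ∑ s, X l k * X s i * F α s l := by
    intro i k α
    have h1 : JetForm.coeff (θ.compContinuousLinearMap L) (.one 0 i) k α
        = θ (Function.update (fun r => (A r, 0)) k
          (0, ∑ s, X s i • Pi.single (.one 0 s) (D α))) := by
      refine hθ.1.congr (k := k) ?_ ?_ ?_
      · simp [h.first]
      · simp [h.first]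
      · intro r
        by_cases hr : r = k
        · subst hr
          simp [h.first]
        · simp only [hr, ne_eq, not_false_eq_true, Function.update_of_ne]
          rfl
    rw [h1, hθ.1.apply_update A]
    rw [Finset.mul_sum]
    refine Finset.sum_congr rfl fun l _ => ?_
    change A.adjugate l k * _ = _
    rw [hadj, map_sum, Finset.mul_sum, Finset.mul_sum]
    refine Finset.sum_congr rfl fun s _ => ?_
    simp only [Matrix.smul_apply, smul_eq_mul, map_smul, hF]
    ring
  intro i k α
  rw [key, key, Finset.sum_comm]
  congr 1
  refine Finset.sum_congr rfl fun l _ => Finset.sum_congr rfl fun s _ => ?_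
  rw [hFs]
  ring

end Change

lemma dirs_single {m : ℕ} (i : Fin m) : dirs (Pi.single i 1) = [i] := by
  have h := perm_dirs [i]
  have h2 : (fun j => List.count j [i]) = (Pi.single i 1 : Fin m → ℕ) := by
    funext j
    by_cases hij : j = i
    · subst hij; simp
    · simp [hij, Ne.symm hij]
  rw [h2] at h
  exact (List.perm_singleton.1 h.symm)

lemma mpderiv_single {m : ℕ} {W : Type*} [NormedAddCommGroup W] [NormedSpace ℝ W] (i : Fin m)
    (f : (Fin m → ℝ) → W) (y : Fin m → ℝ) : mpderiv (Pi.single i 1) f y = pderiv i f y := by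
  rw [mpderiv, dirs_single]
  rfl

lemma fderiv_taylorAt {m : ℕ} {W : Type*} [NormedAddCommGroup W] [NormedSpace ℝ W]
    (x : Fin m → ℝ) (u : MultiIndexLE m 1 → W) (w : Fin m → ℝ) :
    fderiv ℝ (taylorAt x u) x w = ∑ i, w i • u (.one 0 i) := by
  conv_lhs => rw [pi_eq_sum_univ' w]
  rw [map_sum]
  refine Finset.sum_congr rfl fun i _ => ?_
  rw [map_smul]
  congr 1
  have := mpderiv_taylorAt x u (.one 0 i)
  rw [MultiIndexLE.one, mpderiv_single] at this
  exact this

namespace AdaptedChart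

variable {m n : ℕ} {B : FieldBundle m n} (c c' : B.Chart)

/-- The change of coordinates between two natural charts. -/
def jetChange (k : ℕ) (v : JetModel m n k) : JetModel m n k :=
  c'.jetChart k ((c.jetChart k).symm v)

/-- The domain of the change of coordinates between two natural charts. -/
def jetOverlap (k : ℕ) : Set (JetModel m n k) :=
  ((c.jetChart k).symm.trans (c'.jetChart (B := B) k)).source

/-- The change of coordinates of the base. -/
def baseChange (y : Fin m → ℝ) : Fin m → ℝ := c'.base (c.base.symm y)

/-- The fibre part of the change of coordinates of the total space. -/
def fibreChange (p : (Fin m → ℝ) × (Fin n → ℝ)) : Fin n → ℝ := (c'.total (c.total.symm p)).2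

variable {c c'} {k : ℕ} {v : JetModel m n k}

lemma mem_jetOverlap : v ∈ c.jetOverlap c' k ↔
      (v.1, v.2 (.zero m k)) ∈ c.total.target ∩ c.total.symm ⁻¹' c'.total.source :=
  mem_jetChart_trans c c'

lemma base_mem_of_overlap (hv : v ∈ c.jetOverlap c' k) :
    v.1 ∈ c.base.target ∧ c.base.symm v.1 ∈ c'.base.source := by
  have hv' := mem_jetOverlap.1 hv
  have hcb := c.base_symm_proj hv'.1
  refine ⟨hcb.1, ?_⟩
  rw [← hcb.2]
  exact c'.proj_mem _ hv'.2

lemma jetChange_fst (hv : v ∈ c.jetOverlap c' k) :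
    (c.jetChange c' k v).1 = c.baseChange c' v.1 := by
  rw [jetChange, jetChart_trans c c' (mem_jetOverlap.1 hv)]
  rfl

lemma baseChange_baseChange {y : Fin m → ℝ} (hy : y ∈ c.base.target)
    (h : c.base.symm y ∈ c'.base.source) : c'.baseChange c (c.baseChange c' y) = y := by
  rw [baseChange, baseChange, c'.base.left_inv h, c.base.right_inv hy]

lemma jetChange_zero (hv : v ∈ c.jetOverlap c' k) :
    (c.jetChange c' k v).2 (.zero m k) = c.fibreChange c' (v.1, v.2 (.zero m k)) := by
  have hv' := mem_jetOverlap.1 hv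
  have h := (c.jetChart_symm hv'.1)
  have h1 : (jetOfCoord hv'.1).target ∈ c'.total.source := by
    rw [target_jetOfCoord]
    exact hv'.2
  have h2 := congrArg Prod.snd (jetCoord_mem h1)
  rw [target_jetOfCoord] at h2
  rw [jetChange, h]
  exact h2

lemma contDiffAt_fibreChange (hv : v ∈ c.jetOverlap c' k) :
    ContDiffAt ℝ ∞ (c.fibreChange c') (v.1, v.2 (.zero m k)) := by
  have hv' := mem_jetOverlap.1 hv
  exact contDiff_snd.contDiffAt.comp _ (contDiffAt_total_change hv'.1 hv'.2)

lemma jetChange_one {v : JetModel m n 1} (hv : v ∈ c.jetOverlap c' 1) (s : Fin m) :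
    (c.jetChange c' 1 v).2 (.one 0 s) = fderiv ℝ (c.fibreChange c') (v.1, v.2 (.zero m 1))
      (pderiv s (c'.baseChange c) (c.baseChange c' v.1),
        ∑ i, pderiv s (c'.baseChange c) (c.baseChange c' v.1) i • v.2 (.one 0 i)) := by
  obtain ⟨h1, h2⟩ := base_mem_of_overlap hv
  have hbb := baseChange_baseChange h1 h2
  rw [jetChange, jetChart_trans c c' (mem_jetOverlap.1 hv)]
  dsimp only
  rw [MultiIndexLE.one, mpderiv_single]
  change fderiv ℝ (fun y => c.fibreChange c' (c'.baseChange c y,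
    taylorAt v.1 v.2 (c'.baseChange c y))) (c.baseChange c' v.1) _ = _
  have hξ : HasFDerivAt (c'.baseChange c) (fderiv ℝ (c'.baseChange c) (c.baseChange c' v.1))
      (c.baseChange c' v.1) := by
    refine (ContDiffAt.differentiableAt (n := ∞) ?_ (by simp)).hasFDerivAt
    refine contDiffAt_base_change (c'.base.map_source h2) ?_
    rw [baseChange, c'.base.left_inv h2]
    exact c.base.map_target h1
  have hT : HasFDerivAt (taylorAt v.1 v.2) (fderiv ℝ (taylorAt v.1 v.2) v.1)
      (c'.baseChange c (c.baseChange c' v.1)) := by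
    rw [hbb]
    refine (ContDiffAt.differentiableAt (n := ∞) ?_ (by simp)).hasFDerivAt
    exact ((contDiff_taylorAt 1).comp (f := fun y => (v, y)) (by fun_prop)).contDiffAt
  have hG : HasFDerivAt (c.fibreChange c')
      (fderiv ℝ (c.fibreChange c') (v.1, v.2 (.zero m 1)))
      (c'.baseChange c (c.baseChange c' v.1),
        taylorAt v.1 v.2 (c'.baseChange c (c.baseChange c' v.1))) := by
    rw [hbb, taylorAt_self]
    exact ((contDiffAt_fibreChange hv).differentiableAt (by simp)).hasFDerivAt
  have hTξ := hT.comp _ hξ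
  have hcomp := (HasFDerivAt.comp (g := c.fibreChange c')
    (f := fun y => (c'.baseChange c y, taylorAt v.1 v.2 (c'.baseChange c y)))
    (c.baseChange c' v.1) hG (hξ.prodMk hTξ)).fderiv
  refine (congrArg (fun L => L (Pi.single s 1)) hcomp).trans ?_
  simp only [ContinuousLinearMap.comp_apply, ContinuousLinearMap.prod_apply, fderiv_taylorAt]
  rfl

lemma contDiffAt_jetChange (hv : v ∈ c.jetOverlap c' k) : ContDiffAt ℝ ∞ (c.jetChange c' k) v :=
  (c.contDiffOn_jetChart c' k).contDiffAt ((c.isOpen_jetChart_trans c' k).mem_nhds hv)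

lemma jetLike_fderiv {v : JetModel m n 1} (hv : v ∈ c.jetOverlap c' 1) :
    JetLike (fderiv ℝ (c.jetChange c' 1) v)
      (Matrix.of fun s i => pderiv s (c'.baseChange c) (c.baseChange c' v.1) i)
      (fun α => fderiv ℝ (c.fibreChange c') (v.1, v.2 (.zero m 1)) (0, Pi.single α 1)) := by
  obtain ⟨h1, h2⟩ := base_mem_of_overlap hv
  have hbb := baseChange_baseChange h1 h2
  have hd := ((contDiffAt_jetChange hv).differentiableAt (by simp)).hasFDerivAt
  have hζ : HasFDerivAt (c.baseChange c') (fderiv ℝ (c.baseChange c') v.1) v.1 :=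
    (ContDiffAt.differentiableAt (n := ∞) (contDiffAt_base_change h1 h2) (by simp)).hasFDerivAt
  have hfst : ∀ w, (fderiv ℝ (c.jetChange c' 1) v w).1 = fderiv ℝ (c.baseChange c') v.1 w.1 := by
    have e1 := hd.fst
    have e2 : HasFDerivAt (fun w : JetModel m n 1 => c.baseChange c' w.1)
        ((fderiv ℝ (c.baseChange c') v.1).comp (ContinuousLinearMap.fst ℝ _ _)) v :=
      HasFDerivAt.comp v hζ hasFDerivAt_fst
    have e3 : (fun w => (c.jetChange c' 1 w).1) =ᶠ[𝓝 v] fun w => c.baseChange c' w.1 := by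
      filter_upwards [(c.isOpen_jetChart_trans c' 1).mem_nhds hv] with w hw
      exact jetChange_fst hw
    have e4 := e1.unique (e2.congr_of_eventuallyEq e3)
    intro w
    exact congrArg (fun L => L w) e4
  refine ⟨fun w => by rw [hfst, map_zero], ?_, ?_⟩
  · have hξ : HasFDerivAt (c'.baseChange c) (fderiv ℝ (c'.baseChange c) (c.baseChange c' v.1))
        (c.baseChange c' v.1) := by
      refine (ContDiffAt.differentiableAt (n := ∞) ?_ (by simp)).hasFDerivAt
      refine contDiffAt_base_change (c'.base.map_source h2) ?_
      rw [baseChange, c'.base.left_inv h2]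
      exact c.base.map_target h1
    have e1 := hξ.comp v.1 hζ
    have e2 : c'.baseChange c ∘ c.baseChange c' =ᶠ[𝓝 v.1] id := by
      have : c.base.symm ⁻¹' c'.base.source ∩ c.base.target ∈ 𝓝 v.1 := by
        rw [Set.inter_comm]
        exact (c.base.symm.isOpen_inter_preimage c'.base.open_source).mem_nhds ⟨h1, h2⟩
      filter_upwards [this] with y hy
      exact baseChange_baseChange hy.2 hy.1
    have e3 := (e1.congr_of_eventuallyEq e2.symm).unique (hasFDerivAt_id v.1)
    ext r i
    rw [Matrix.mul_apply]
    have e4 := congrFun (congrArg (fun L => L (Pi.single r 1)) e3) i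
    simp only [ContinuousLinearMap.comp_apply, ContinuousLinearMap.coe_id', id_eq] at e4
    rw [pi_eq_sum_univ' (fderiv ℝ (c.baseChange c') v.1 (Pi.single r 1)), map_sum,
      Finset.sum_apply] at e4
    have e5 : (1 : Matrix (Fin m) (Fin m) ℝ) r i = (Pi.single r 1 : Fin m → ℝ) i := by
      simp [Pi.single_apply, Matrix.one_apply, eq_comm]
    rw [e5, ← e4]
    refine Finset.sum_congr rfl fun s _ => ?_
    rw [map_smul]
    simp only [Matrix.of_apply, hfst, Pi.smul_apply, smul_eq_mul]
    rfl
  · intro i α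
    have hmem : ∀ t : ℝ, v + t • (0, vecU (.one 0 i) α) ∈ c.jetOverlap c' 1 := by
      intro t
      rw [mem_jetOverlap]
      have := mem_jetOverlap.1 hv
      simpa [vecU, (MultiIndexLE.one_ne_zero i).symm] using this
    have hline : ∀ t : ℝ, c.jetChange c' 1 (v + t • (0, vecU (.one 0 i) α)) =
        c.jetChange c' 1 v + t • ((0, ∑ s, pderiv s (c'.baseChange c) (c.baseChange c' v.1) i •
          Pi.single (MultiIndexLE.one 0 s) (fderiv ℝ (c.fibreChange c') (v.1, v.2 (.zero m 1))
            (0, Pi.single α 1))) : JetModel m n 1) := by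
      intro t
      refine Prod.ext ?_ (funext fun J => ?_)
      · rw [jetChange_fst (hmem t)]
        simp [jetChange_fst hv]
      · rcases J.eq_zero_or_one with rfl | ⟨s, rfl⟩
        · rw [jetChange_zero (hmem t)]
          simp [jetChange_zero hv, vecU, (MultiIndexLE.one_ne_zero _).symm, Finset.sum_apply]
        · rw [jetChange_one (hmem t)]
          refine Eq.trans ?_ (congrArg (· + _) (jetChange_one hv s)).symm
          have z : ∀ i', (v + t • ((0, vecU (.one 0 i) α) : JetModel m n 1)).2 (.one 0 i')
              = v.2 (.one 0 i') + if i' = i then t • Pi.single α 1 else 0 := by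
            intro i'
            by_cases h : i' = i
            · subst h; simp [vecU]
            · have : MultiIndexLE.one 0 i' ≠ .one 0 i :=
                fun h' => h (MultiIndexLE.one_injective _ _ h')
              simp [vecU, h, this]
          have z0 : (v + t • ((0, vecU (.one 0 i) α) : JetModel m n 1)).2 (.zero m 1)
              = v.2 (.zero m 1) := by
            simp [vecU, (MultiIndexLE.one_ne_zero _).symm]
          have z1 : (v + t • ((0, vecU (.one 0 i) α) : JetModel m n 1)).1 = v.1 := by simp
          simp only [z, z0, z1, smul_add, Finset.sum_add_distrib, smul_ite, smul_zero,
            Finset.sum_ite_eq', Finset.mem_univ, if_true]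
          rw [← add_zero (pderiv s (c'.baseChange c) (c.baseChange c' v.1)), ← Prod.mk_add_mk,
            map_add, add_zero]
          congr 1
          have hne : ∀ s', s' ≠ s → MultiIndexLE.one 0 s ≠ .one 0 s' :=
            fun s' h h' => h (MultiIndexLE.one_injective _ _ h').symm
          have hsum : (∑ s, pderiv s (c'.baseChange c) (c.baseChange c' v.1) i •
              Pi.single (MultiIndexLE.one 0 s) (fderiv ℝ (c.fibreChange c')
                (v.1, v.2 (.zero m 1)) (0, Pi.single α 1)) : MultiIndexLE m 1 → Fin n → ℝ)
              (.one 0 s) = pderiv s (c'.baseChange c) (c.baseChange c' v.1) i •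
                fderiv ℝ (c.fibreChange c') (v.1, v.2 (.zero m 1)) (0, Pi.single α 1) := by
            rw [Finset.sum_apply, Finset.sum_eq_single s]
            · simp
            · intro s' _ hs'
              simp [hne s' hs']
            · simp
          refine Eq.trans ?_ (congrArg (t • ·) hsum).symm
          rw [← map_smul, ← map_smul, smul_comm t]
          simp
    have e1 : HasDerivAt (fun t : ℝ => v + t • ((0, vecU (.one 0 i) α) : JetModel m n 1))
        (0, vecU (.one 0 i) α) 0 := by
      simpa using ((hasDerivAt_id (0 : ℝ)).smul_const
        ((0, vecU (.one 0 i) α) : JetModel m n 1)).const_add v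
    have e2 := HasFDerivAt.comp_hasDerivAt (x := (0 : ℝ)) (l := c.jetChange c' 1)
      (l' := fderiv ℝ (c.jetChange c' 1) v) (by simpa using hd) e1
    have e3 : HasDerivAt (fun t : ℝ => c.jetChange c' 1 v + t • ((0,
        ∑ s, pderiv s (c'.baseChange c) (c.baseChange c' v.1) i •
          Pi.single (MultiIndexLE.one 0 s) (fderiv ℝ (c.fibreChange c') (v.1, v.2 (.zero m 1))
            (0, Pi.single α 1))) : JetModel m n 1)) _ 0 :=
      ((hasDerivAt_id (0 : ℝ)).smul_const _).const_add _
    have e4 := e2.unique (e3.congr_of_eventuallyEq (Filter.Eventually.of_forall hline))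
    simpa using e4

end AdaptedChart

/-! ### Bundles over a manifold -/

/-- Fibre coordinates, with values in a normed space `Q`, on a family `F` of sets over a manifold
given by coordinate systems, one for every coordinate system of the base. -/
structure FibreCharts {ι N V : Type*} [NormedAddCommGroup V] [NormedSpace ℝ V]
    (C : SmoothCharts ι N V) (F : N → Type*) (Q : Type*) [NormedAddCommGroup Q]
    [NormedSpace ℝ Q] where
  coord : ι → ∀ p, F p → Q
  bijective : ∀ i, ∀ p ∈ (C.chart i).source, Function.Bijective (coord i p)
  change : ι → ι → V → Q → Q
  coord_eq : ∀ i j, ∀ p ∈ (C.chart i).source, p ∈ (C.chart j).source →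
    ∀ f, coord j p f = change i j (C.chart i p) (coord i p f)
  smooth : ∀ i j, ContDiffOn ℝ ∞ (fun z : V × Q => change i j z.1 z.2)
    (((C.chart i).symm.trans (C.chart j)).source ×ˢ Set.univ)

namespace FibreCharts

variable {ι N V : Type*} [NormedAddCommGroup V] [NormedSpace ℝ V]
  {C : SmoothCharts ι N V} {F : N → Type*} {Q : Type*} [NormedAddCommGroup Q]
  [NormedSpace ℝ Q] (D : FibreCharts C F Q)

/-- The fibre coordinates of a bundle pulled back by a smooth map. -/
def pullback {N' V' : Type*} [NormedAddCommGroup V'] [NormedSpace ℝ V'] {C' : SmoothCharts ι N' V'}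
    (g : N' → N) (G : V' → V) (hG : ContDiff ℝ ∞ G)
    (hs : ∀ i p, p ∈ (C'.chart i).source → g p ∈ (C.chart i).source)
    (hg : ∀ i p, p ∈ (C'.chart i).source → C.chart i (g p) = G (C'.chart i p)) :
    FibreCharts C' (fun p => F (g p)) Q where
  coord i p := D.coord i (g p)
  bijective i p hp := D.bijective i _ (hs i p hp)
  change i j v := D.change i j (G v)
  coord_eq i j p hi hj f := by
    rw [D.coord_eq i j _ (hs i p hi) (hs j p hj), hg i p hi]
  smooth i j := by
    refine (D.smooth i j).comp (f := fun z : V' × Q => (G z.1, z.2))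
      ((hG.comp contDiff_fst).prodMk contDiff_snd).contDiffOn ?_
    rintro ⟨v, q⟩ ⟨⟨hv, hv'⟩, -⟩
    have h1 := (C'.chart i).map_target hv
    have h2 := hg i _ h1
    rw [(C'.chart i).right_inv hv] at h2
    refine ⟨⟨?_, ?_⟩, trivial⟩
    · change G v ∈ _
      rw [← h2]
      exact (C.chart i).map_source (hs i _ h1)
    · change (C.chart i).symm (G v) ∈ (C.chart j).source
      rw [← h2, (C.chart i).left_inv (hs i _ h1)]
      exact hs j _ hv'

variable [∀ p, Nonempty (F p)]

/-- The coordinates of the base and of the fibre together. -/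
def chart (i : ι) : PartialEquiv (Σ p, F p) (V × Q) where
  toFun z := (C.chart i z.1, D.coord i z.1 z.2)
  invFun w := ⟨(C.chart i).symm w.1, Function.invFun (D.coord i _) w.2⟩
  source := {z | z.1 ∈ (C.chart i).source}
  target := (C.chart i).target ×ˢ Set.univ
  map_source' z hz := ⟨(C.chart i).map_source hz, trivial⟩
  map_target' w hw := (C.chart i).map_target hw.1
  left_inv' z hz := by
    obtain ⟨p, f⟩ := z
    have key : ∀ q (hq : q = p) (_ : p ∈ (C.chart i).source),
        (⟨q, Function.invFun (D.coord i q) (D.coord i p f)⟩ : Σ p, F p) = ⟨p, f⟩ := by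
      rintro q rfl hp
      rw [Function.leftInverse_invFun (D.bijective i q hp).1]
    exact key _ ((C.chart i).left_inv hz) hz
  right_inv' w hw := Prod.ext ((C.chart i).right_inv hw.1)
    (Function.rightInverse_invFun (D.bijective i _ ((C.chart i).map_target hw.1)).2 w.2)

lemma trans_source (i j : ι) : ((D.chart i).symm.trans (D.chart j)).source =
    ((C.chart i).symm.trans (C.chart j)).source ×ˢ Set.univ := by
  ext w
  constructor
  · rintro ⟨h1, h2⟩
    exact ⟨⟨h1.1, h2⟩, trivial⟩
  · rintro ⟨⟨h1, h2⟩, -⟩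
    exact ⟨⟨h1, trivial⟩, h2⟩

/-- The total space of a bundle, as a manifold. -/
def total : SmoothCharts ι (Σ p, F p) (V × Q) where
  chart := D.chart
  exists_mem z := C.exists_mem z.1
  isOpen i j := by
    rw [trans_source]
    exact (C.isOpen i j).prod isOpen_univ
  smooth i j := by
    rw [trans_source]
    have h1 : ContDiffOn ℝ ∞ (fun z : V × Q => ((C.chart i).symm.trans (C.chart j)) z.1)
        (((C.chart i).symm.trans (C.chart j)).source ×ˢ Set.univ) :=
      (C.smooth i j).comp contDiffOn_fst (fun z hz => hz.1)
    refine (h1.prodMk (D.smooth i j)).congr ?_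
    rintro ⟨v, q⟩ ⟨⟨hv, hv'⟩, -⟩
    refine Prod.ext rfl ?_
    have hm := (C.chart i).map_target hv
    change D.coord j ((C.chart i).symm v) (Function.invFun (D.coord i _) q) = D.change i j v q
    rw [D.coord_eq i j _ hm hv', (C.chart i).right_inv hv,
      Function.rightInverse_invFun (D.bijective i _ hm).2 q]

end FibreCharts

/-! ### Multimomentum bundles -/

section Multimomentum

variable {m n : ℕ} {B : FieldBundle m n}

/-- The exterior `m`-forms at a point of `J¹π`. -/
abbrev FormAt (j : Jet B 1) : Type :=
  TangentSpace 𝓘(ℝ, JetModel m n 1) j [⋀^Fin m]→L[ℝ] ℝ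

namespace AdaptedChart

variable (c c' : B.Chart)

/-- The derivative of the natural coordinates `(xⁱ, u^α, u_i^α)` of `J¹π`. -/
def jetDeriv (j : Jet B 1) :
    TangentSpace 𝓘(ℝ, JetModel m n 1) j →L[ℝ] JetModel m n 1 :=
  mfderiv 𝓘(ℝ, JetModel m n 1) 𝓘(ℝ, JetModel m n 1) (c.jetChart 1) j

/-- The expression of a form at a point of `J¹π` in natural coordinates. -/
def localForm (j : Jet B 1) : FormAt j →ₗ[ℝ] JetForm m n :=
  ContinuousAlternatingMap.compContinuousLinearMapₗ (c.jetDeriv j).inverse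

variable {c c'}

lemma jetChart_mdifferentiable :
    ((jetCharts B 1).ofIndex c).MDifferentiable 𝓘(ℝ, JetModel m n 1) 𝓘(ℝ, JetModel m n 1) :=
  mdifferentiable_of_mem_atlas ((jetCharts B 1).ofIndex_mem_atlas c)

lemma isInvertible_jetDeriv {j : Jet B 1} (hj : j.target ∈ c.total.source) :
    (c.jetDeriv j).IsInvertible :=
  ⟨jetChart_mdifferentiable.mfderiv (x := j) hj, rfl⟩

lemma jetCoord_mem_overlap {k : ℕ} {j : Jet B k} (hj : j.target ∈ c.total.source)
    (hj' : j.target ∈ c'.total.source) : c.jetCoord j ∈ c.jetOverlap c' k := by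
  rw [mem_jetOverlap, jetCoord_mem hj]
  refine ⟨c.total.map_source hj, ?_⟩
  rw [Set.mem_preimage, c.total.left_inv hj]
  exact hj'

lemma jetDeriv_change {j : Jet B 1} (hj : j.target ∈ c.total.source)
    (hj' : j.target ∈ c'.total.source) :
    c'.jetDeriv j = (fderiv ℝ (c.jetChange c' 1) (c.jetCoord j)).comp (c.jetDeriv j) := by
  have h1 : MDifferentiableAt 𝓘(ℝ, JetModel m n 1) 𝓘(ℝ, JetModel m n 1) (c.jetChart 1) j :=
    jetChart_mdifferentiable.mdifferentiableAt (x := j) hj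
  have h2 : MDifferentiableAt 𝓘(ℝ, JetModel m n 1) 𝓘(ℝ, JetModel m n 1) (c.jetChange c' 1)
      (c.jetChart 1 j) :=
    ((contDiffAt_jetChange (jetCoord_mem_overlap hj hj')).differentiableAt
      (by simp)).mdifferentiableAt
  have h3 : (c'.jetChart 1 : Jet B 1 → _) =ᶠ[𝓝 j] c.jetChange c' 1 ∘ c.jetChart 1 := by
    have : (c.jetChart 1).source ∈ 𝓝 j := ((jetCharts B 1).ofIndex c).open_source.mem_nhds hj
    filter_upwards [this] with i hi
    rw [Function.comp_apply, jetChange, (c.jetChart 1).left_inv hi]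
  rw [jetDeriv, h3.mfderiv_eq, mfderiv_comp j h2 h1, mfderiv_eq_fderiv]
  rfl

lemma jetDeriv_inverse {j : Jet B 1} (hj : j.target ∈ c.total.source)
    (hj' : j.target ∈ c'.total.source) :
    (c'.jetDeriv j).inverse =
      (c.jetDeriv j).inverse.comp (fderiv ℝ (c'.jetChange c 1) (c'.jetCoord j)) := by
  refine ContinuousLinearMap.ext fun w => ?_
  apply (isInvertible_jetDeriv hj).injective
  rw [ContinuousLinearMap.comp_apply, (isInvertible_jetDeriv hj).self_apply_inverse,
    jetDeriv_change hj' hj, ContinuousLinearMap.comp_apply,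
    (isInvertible_jetDeriv hj').self_apply_inverse]

lemma localForm_change {j : Jet B 1} (hj : j.target ∈ c.total.source)
    (hj' : j.target ∈ c'.total.source) (η : FormAt j) :
    c'.localForm j η = (c.localForm j η).compContinuousLinearMap
      (fderiv ℝ (c'.jetChange c 1) (c'.jetCoord j)) := by
  change η.compContinuousLinearMap _ = _
  rw [jetDeriv_inverse hj hj']
  rfl

lemma localForm_bijective {j : Jet B 1} (hj : j.target ∈ c.total.source) :
    Function.Bijective (c.localForm j) := by
  have h := isInvertible_jetDeriv hj
  constructor
  · intro η η' hη
    have := congrArg (fun θ : JetForm m n => θ.compContinuousLinearMap (c.jetDeriv j)) hη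
    ext v
    have h2 := congrArg (fun θ => θ v) this
    simp only [localForm, ContinuousAlternatingMap.compContinuousLinearMapₗ] at h2
    change η (fun i => (c.jetDeriv j).inverse (c.jetDeriv j (v i))) =
      η' (fun i => (c.jetDeriv j).inverse (c.jetDeriv j (v i))) at h2
    simpa only [h.inverse_apply_self] using h2
  · intro θ
    refine ⟨θ.compContinuousLinearMap (c.jetDeriv j), ?_⟩
    ext v
    change θ (fun i => (c.jetDeriv j) ((c.jetDeriv j).inverse (v i))) = _
    simp only [h.self_apply_inverse]

end AdaptedChart

/-- The fibre of the extended `2`-symmetric multimomentum bundle `J²π†` over a point of `J¹π`: the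
`m`-forms that vanish on any two vertical vectors and whose coefficients satisfy
`p^{ij}_α = p^{ji}_α` in natural coordinates. -/
def symMom (j : Jet B 1) : Submodule ℝ (FormAt j) :=
  ⨅ (c : B.Chart) (_ : j.target ∈ c.total.source), (symForms m n).comap (c.localForm j)

/-- The semibasic forms in the fibre of `J²π†`, that is, those that vanish on any vertical
vector. -/
def semibasicMom (j : Jet B 1) : Submodule ℝ (symMom j) :=
  ⨅ (c : B.Chart) (_ : j.target ∈ c.total.source),
    (semibasicForms m n).comap ((c.localForm j).comp (symMom j).subtype)

/-- The fibre of the restricted `2`-symmetric multimomentum bundle `J²π‡` over a point of `J¹π`: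
the quotient of the fibre of `J²π†` by the semibasic forms. -/
abbrev RestFibre (j : Jet B 1) : Type :=
  symMom j ⧸ (semibasicMom j).toAddSubgroup

lemma mem_symMom_iff {j : Jet B 1} (c : B.Chart) (hc : j.target ∈ c.total.source) {η : FormAt j} :
    η ∈ symMom j ↔ c.localForm j η ∈ symForms m n := by
  simp only [symMom, Submodule.mem_iInf, Submodule.mem_comap]
  refine ⟨fun h => h c hc, fun h c' hc' => ?_⟩
  rw [AdaptedChart.localForm_change hc hc']
  exact (AdaptedChart.jetLike_fderiv (AdaptedChart.jetCoord_mem_overlap hc' hc)).sym h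

lemma mem_semibasicMom_iff {j : Jet B 1} (c : B.Chart) (hc : j.target ∈ c.total.source)
    {η : symMom j} : η ∈ semibasicMom j ↔ c.localForm j η ∈ semibasicForms m n := by
  simp only [semibasicMom, Submodule.mem_iInf, Submodule.mem_comap]
  refine ⟨fun h => h c hc, fun h c' hc' => ?_⟩
  change c'.localForm j η ∈ _
  rw [AdaptedChart.localForm_change hc hc']
  exact (AdaptedChart.jetLike_fderiv (AdaptedChart.jetCoord_mem_overlap hc' hc)).semibasic h

namespace AdaptedChart

variable (c c' : B.Chart)

/-- The coordinates `(p, p^i_α, p^I_α)` on the fibres of `J²π†`. -/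
def extCoord (j : Jet B 1) : symMom j →ₗ[ℝ] ExtMomModel m n :=
  (JetForm.coord.comp (c.localForm j)).comp (symMom j).subtype

variable {c} in
lemma extCoord_bijective {j : Jet B 1} (hj : j.target ∈ c.total.source) :
    Function.Bijective (c.extCoord j) := by
  constructor
  · rw [injective_iff_map_eq_zero]
    intro η hη
    have h1 := JetForm.eq_zero_of_coord ((mem_symMom_iff c hj).1 η.2) hη
    exact Subtype.ext ((localForm_bijective hj).1 (h1.trans (map_zero _).symm))
  · intro q
    obtain ⟨η, hη⟩ := (localForm_bijective hj).2 (JetForm.ofCoord q)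
    refine ⟨⟨η, (mem_symMom_iff c hj).2 (hη ▸ JetForm.ofCoord_mem q)⟩, ?_⟩
    change JetForm.coord (c.localForm j η) = q
    rw [hη, JetForm.coord_ofCoord]

variable {c} in
lemma mem_semibasicMom_iff_coord {j : Jet B 1} (hj : j.target ∈ c.total.source) {η : symMom j} :
    η ∈ semibasicMom j ↔ (c.extCoord j η).2 = 0 := by
  rw [mem_semibasicMom_iff c hj]
  exact JetForm.semibasic_iff ((mem_symMom_iff c hj).1 η.2)

/-- The coordinates `(p^i_α, p^I_α)` on the fibres of `J²π‡`. -/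
def restCoord (j : Jet B 1) : RestFibre j → RestMomModel m n := fun q =>
  (c.extCoord j q.out).2

variable {c} in
lemma restCoord_mk {j : Jet B 1} (hj : j.target ∈ c.total.source) (η : symMom j) :
    c.restCoord j (QuotientAddGroup.mk η) = (c.extCoord j η).2 := by
  have h : (QuotientAddGroup.mk (Quotient.out (QuotientAddGroup.mk η : RestFibre j)) :
      RestFibre j) = QuotientAddGroup.mk η := Quotient.out_eq _
  rw [QuotientAddGroup.eq, Submodule.mem_toAddSubgroup, mem_semibasicMom_iff_coord hj, map_add,
    map_neg, Prod.snd_add, Prod.snd_neg, neg_add_eq_zero] at h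
  exact h

variable {c} in
lemma restCoord_bijective {j : Jet B 1} (hj : j.target ∈ c.total.source) :
    Function.Bijective (c.restCoord j) := by
  constructor
  · intro q q' h
    obtain ⟨η, rfl⟩ := QuotientAddGroup.mk_surjective q
    obtain ⟨η', rfl⟩ := QuotientAddGroup.mk_surjective q'
    rw [restCoord_mk hj, restCoord_mk hj] at h
    rw [QuotientAddGroup.eq, Submodule.mem_toAddSubgroup, mem_semibasicMom_iff_coord hj, map_add,
      map_neg, Prod.snd_add, Prod.snd_neg, h, neg_add_cancel]
  · intro r
    obtain ⟨η, hη⟩ := (extCoord_bijective hj).2 (0, r)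
    refine ⟨QuotientAddGroup.mk η, ?_⟩
    rw [restCoord_mk hj, hη]

/-- The transformation law of the momenta. -/
def momChange (v : JetModel m n 1) (q : ExtMomModel m n) : ExtMomModel m n :=
  JetForm.coord ((JetForm.ofCoord q).compContinuousLinearMap
    (fderiv ℝ (c'.jetChange c 1) (c.jetChange c' 1 v)))

variable {c c'}

lemma extCoord_change {j : Jet B 1} (hj : j.target ∈ c.total.source)
    (hj' : j.target ∈ c'.total.source) (η : symMom j) :
    c'.extCoord j η = c.momChange c' (c.jetCoord j) (c.extCoord j η) := by
  have h1 : JetForm.ofCoord (c.extCoord j η) = c.localForm j η :=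
    JetForm.ofCoord_coord ((mem_symMom_iff c hj).1 η.2)
  have h2 : c.jetChange c' 1 (c.jetCoord j) = c'.jetCoord j :=
    congrArg (c'.jetChart 1) ((c.jetChart 1).left_inv hj)
  rw [momChange, h1, h2, ← localForm_change hj hj']
  rfl

end AdaptedChart
end Multimomentum

section MomentaCharts

variable {m n : ℕ}

lemma contDiff_ofCoord : ContDiff ℝ ∞ fun z : ExtMomModel m n × (Fin m → JetModel m n 1) =>
    JetForm.ofCoord z.1 z.2 := by
  have hdet : ∀ (Z : Type) [NormedAddCommGroup Z] [NormedSpace ℝ Z] (f : Z → Fin m → Fin m → ℝ),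
      (∀ i j, ContDiff ℝ ∞ fun z => f z i j) → ContDiff ℝ ∞ fun z => (Matrix.of (f z)).det := by
    intro Z _ _ f hf
    simp only [Matrix.det_apply']
    refine ContDiff.sum fun σ _ => ?_
    exact contDiff_const.mul (contDiff_prod fun i _ => hf _ _)
  simp only [JetForm.ofCoord, formOf, ContinuousAlternatingMap.add_apply,
    ContinuousAlternatingMap.smul_apply, ContinuousAlternatingMap.sum_apply, wedge_apply]
  refine ContDiff.add (contDiff_fst.fst.smul (hdet _ _ fun i j => ?_))
    (ContDiff.sum fun k _ => hdet _ _ fun i j => ?_)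
  · simp only [formX_apply]
    fun_prop
  · by_cases h : j = k
    · subst h
      simp only [Function.update_self, ContinuousLinearMap.comp_apply, sum_apply, add_apply,
        smul_apply, formU_apply, ContinuousLinearMap.coe_snd', smul_eq_mul]
      fun_prop
    · simp only [h, ne_eq, not_false_eq_true, Function.update_of_ne, formX_apply]
      fun_prop

lemma contDiffOn_coord {Z : Type*} [NormedAddCommGroup Z] [NormedSpace ℝ Z] {s : Set Z}
    {f : Z → JetForm m n} (hf : ∀ u, ContDiffOn ℝ ∞ (fun z => f z u) s) :
    ContDiffOn ℝ ∞ (fun z => JetForm.coord (f z)) s := by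
  refine (hf _).prodMk (ContDiffOn.prodMk ?_ ?_)
  · exact contDiffOn_pi.2 fun i => contDiffOn_pi.2 fun α => hf _
  · refine contDiffOn_pi.2 fun K => contDiffOn_pi.2 fun α => ?_
    refine ContDiffOn.sum fun i _ => ContDiffOn.sum fun j _ => ?_
    split_ifs
    · exact hf _
    · exact contDiffOn_const

variable {B : FieldBundle m n}

lemma AdaptedChart.contDiffOn_momChange (c c' : B.Chart) :
    ContDiffOn ℝ ∞ (fun z : JetModel m n 1 × ExtMomModel m n => c.momChange c' z.1 z.2)
      (c.jetOverlap c' 1 ×ˢ Set.univ) := by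
  refine contDiffOn_coord fun u => ?_
  rintro ⟨v, q⟩ ⟨hv, -⟩
  refine ContDiffAt.contDiffWithinAt ?_
  have hv2 : c.jetChange c' 1 v ∈ c'.jetOverlap c 1 := by
    have h : v ∈ ((c.jetChart 1).symm.trans (c'.jetChart (B := B) 1)).source := hv
    have := ((c.jetChart 1).symm.trans (c'.jetChart (B := B) 1)).map_source h
    exact this
  have h1 : ContDiffAt ℝ ∞ (fun w => fderiv ℝ (c'.jetChange c 1) (c.jetChange c' 1 w)) v :=
    ContDiffAt.comp v ((contDiffAt_jetChange hv2).fderiv_right (m := ∞) (by simp))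
      (contDiffAt_jetChange hv)
  have h2 : ContDiffAt ℝ ∞ (fun z : JetModel m n 1 × ExtMomModel m n =>
      (z.2, fun i => fderiv ℝ (c'.jetChange c 1) (c.jetChange c' 1 z.1) (u i))) (v, q) := by
    refine contDiffAt_snd.prodMk (contDiffAt_pi.2 fun i => ?_)
    exact (ContDiffAt.comp (g := fun w => fderiv ℝ (c'.jetChange c 1) (c.jetChange c' 1 w))
      (v, q) h1 contDiffAt_fst).clm_apply contDiffAt_const
  exact contDiff_ofCoord.contDiffAt.comp (v, q) h2

variable (B)

/-- The natural fibre coordinates of `J²π†`. -/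
def extFibreCharts : FibreCharts (jetCharts B 1) (fun j => symMom j) (ExtMomModel m n) where
  coord c j := c.extCoord j
  bijective _ _ hj := AdaptedChart.extCoord_bijective hj
  change c c' := c.momChange c'
  coord_eq _ _ _ hj hj' f := AdaptedChart.extCoord_change hj hj' f
  smooth c c' := c.contDiffOn_momChange c'

/-- The natural fibre coordinates of `J²π‡`. -/
def restFibreCharts : FibreCharts (jetCharts B 1) (fun j => RestFibre j) (RestMomModel m n) where
  coord c j := c.restCoord j
  bijective _ _ hj := AdaptedChart.restCoord_bijective hj
  change c c' v r := (c.momChange c' v (0, r)).2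
  coord_eq c c' j hj hj' f := by
    obtain ⟨θ, rfl⟩ := QuotientAddGroup.mk_surjective f
    obtain ⟨θ', hθ'⟩ := (AdaptedChart.extCoord_bijective (c := c) hj).2
      (0, (c.extCoord j θ).2)
    have h : (QuotientAddGroup.mk θ : RestFibre j) = QuotientAddGroup.mk θ' := by
      rw [QuotientAddGroup.eq, Submodule.mem_toAddSubgroup,
        AdaptedChart.mem_semibasicMom_iff_coord (c := c) hj, map_add, map_neg, Prod.snd_add,
        Prod.snd_neg, hθ', neg_add_cancel]
    rw [AdaptedChart.restCoord_mk (c := c) hj, h, AdaptedChart.restCoord_mk (c := c') hj',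
      AdaptedChart.extCoord_change (c := c) hj hj', hθ']
    rfl
  smooth c c' := by
    refine contDiff_snd.comp_contDiffOn ((c.contDiffOn_momChange c').comp
      (f := fun z : JetModel m n 1 × RestMomModel m n => (z.1, ((0 : ℝ), z.2))) ?_ ?_)
    · exact contDiffOn_fst.prodMk (contDiffOn_const.prodMk contDiffOn_snd)
    · exact fun z hz => ⟨hz.1, trivial⟩

variable {B}

/-- The local expression of the projection `J³π → J¹π`. -/
def truncModel {k : ℕ} (r : ℕ) (h : r ≤ k) (v : JetModel m n k) : JetModel m n r :=
  (v.1, fun I => v.2 (I.castLE h))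

lemma contDiff_truncModel {k : ℕ} (r : ℕ) (h : r ≤ k) :
    ContDiff ℝ ∞ (truncModel (m := m) (n := n) r h) :=
  contDiff_fst.prodMk (contDiff_pi.2 fun I => by fun_prop)

@[simp] lemma Jet.target_trunc {k : ℕ} (r : ℕ) (h : r ≤ k) (j : Jet B k) :
    (j.trunc r h).target = j.target := by
  rw [← j.mk_rep]
  rfl

lemma AdaptedChart.jetCoord_trunc (c : B.Chart) {k : ℕ} (r : ℕ) (h : r ≤ k) {j : Jet B k}
    (hj : j.target ∈ c.total.source) :
    c.jetCoord (j.trunc r h) = truncModel r h (c.jetCoord j) := by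
  rw [← j.mk_rep, Jet.target_mk] at hj
  rw [← j.mk_rep, Jet.trunc_mk, c.jetCoord_mk _ hj, c.jetCoord_mk _ hj]
  rfl

variable (B)

/-- The extended `2`-symmetric multimomentum bundle `J²π†`. -/
def ExtMom : Type _ := Σ j : Jet B 1, symMom j

/-- The restricted `2`-symmetric multimomentum bundle `J²π‡`. -/
def RestMom : Type _ := Σ j : Jet B 1, RestFibre j

/-- The extended `2`-symmetric jet-multimomentum bundle `𝒲 = J³π ×_{J¹π} J²π†`. -/
def ExtUnified : Type _ := Σ a : Jet B 3, symMom (a.trunc 1 (by norm_num))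

/-- The restricted `2`-symmetric jet-multimomentum bundle `𝒲_r = J³π ×_{J¹π} J²π‡`. -/
def RestUnified : Type _ := Σ a : Jet B 3, RestFibre (a.trunc 1 (by norm_num))

/-- The natural charts of `J²π†`, with coordinates `(xⁱ, u^α, u_i^α, p, p^i_α, p^I_α)`. -/
def extMomCharts : SmoothCharts B.Chart (ExtMom B) (JetModel m n 1 × ExtMomModel m n) :=
  (extFibreCharts B).total

/-- The natural charts of `J²π‡`, with coordinates `(xⁱ, u^α, u_i^α, p^i_α, p^I_α)`. -/
def restMomCharts : SmoothCharts B.Chart (RestMom B) (JetModel m n 1 × RestMomModel m n) :=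
  (restFibreCharts B).total

/-- The natural charts of `𝒲`. -/
def extUnifiedCharts : SmoothCharts B.Chart (ExtUnified B) (JetModel m n 3 × ExtMomModel m n) :=
  ((extFibreCharts B).pullback (C' := jetCharts B 3) (Jet.trunc 1 (by norm_num))
    (truncModel 1 (by norm_num)) (contDiff_truncModel _ _)
    (fun c j hj => by
      change (j.trunc 1 _).target ∈ c.total.source
      rw [Jet.target_trunc]; exact hj)
    (fun c j hj => c.jetCoord_trunc _ _ hj)).total

/-- The natural charts of `𝒲_r`. -/
def restUnifiedCharts :
    SmoothCharts B.Chart (RestUnified B) (JetModel m n 3 × RestMomModel m n) :=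
  ((restFibreCharts B).pullback (C' := jetCharts B 3) (Jet.trunc 1 (by norm_num))
    (truncModel 1 (by norm_num)) (contDiff_truncModel _ _)
    (fun c j hj => by
      change (j.trunc 1 _).target ∈ c.total.source
      rw [Jet.target_trunc]; exact hj)
    (fun c j hj => c.jetCoord_trunc _ _ hj)).total

instance : TopologicalSpace (ExtMom B) := (extMomCharts B).topologicalSpace
instance : ChartedSpace (JetModel m n 1 × ExtMomModel m n) (ExtMom B) :=
  (extMomCharts B).chartedSpace
instance : IsManifold 𝓘(ℝ, JetModel m n 1 × ExtMomModel m n) ∞ (ExtMom B) :=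
  (extMomCharts B).isManifold

instance : TopologicalSpace (RestMom B) := (restMomCharts B).topologicalSpace
instance : ChartedSpace (JetModel m n 1 × RestMomModel m n) (RestMom B) :=
  (restMomCharts B).chartedSpace
instance : IsManifold 𝓘(ℝ, JetModel m n 1 × RestMomModel m n) ∞ (RestMom B) :=
  (restMomCharts B).isManifold

instance : TopologicalSpace (ExtUnified B) := (extUnifiedCharts B).topologicalSpace
instance : ChartedSpace (JetModel m n 3 × ExtMomModel m n) (ExtUnified B) :=
  (extUnifiedCharts B).chartedSpace
instance : IsManifold 𝓘(ℝ, JetModel m n 3 × ExtMomModel m n) ∞ (ExtUnified B) :=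
  (extUnifiedCharts B).isManifold

instance : TopologicalSpace (RestUnified B) := (restUnifiedCharts B).topologicalSpace
instance : ChartedSpace (JetModel m n 3 × RestMomModel m n) (RestUnified B) :=
  (restUnifiedCharts B).chartedSpace
instance : IsManifold 𝓘(ℝ, JetModel m n 3 × RestMomModel m n) ∞ (RestUnified B) :=
  (restUnifiedCharts B).isManifold

end MomentaCharts

/-! ### Differential forms -/

section DifferentialForms

variable {V : Type*} [NormedAddCommGroup V] [NormedSpace ℝ V]
  {N : Type*} [TopologicalSpace N] [ChartedSpace V N]
  {V' : Type*} [NormedAddCommGroup V'] [NormedSpace ℝ V']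
  {N' : Type*} [TopologicalSpace N'] [ChartedSpace V' N'] {k : ℕ}

variable (V N k) in
/-- Differential forms of degree `k` on a manifold `N` modelled on `V` (not assumed smooth). -/
abbrev DiffForm : Type _ := ∀ p : N, TangentSpace 𝓘(ℝ, V) p [⋀^Fin k]→L[ℝ] ℝ

namespace DiffForm

/-- The expression of a form in the preferred chart at a point. -/
def inChart (θ : DiffForm V N k) (p : N) (y : V) : V [⋀^Fin k]→L[ℝ] ℝ :=
  (θ ((chartAt V p).symm y)).compContinuousLinearMap
    (mfderiv 𝓘(ℝ, V) 𝓘(ℝ, V) (chartAt V p).symm y)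

/-- A form is smooth if its expressions in charts are. -/
def IsSmooth (θ : DiffForm V N k) : Prop :=
  ∀ p, ContDiffOn ℝ ∞ (θ.inChart p) (chartAt V p).target

/-- The exterior derivative. -/
def d (θ : DiffForm V N k) : DiffForm V N (k + 1) := fun p =>
  (extDeriv (θ.inChart p) (chartAt V p p)).compContinuousLinearMap
    (mfderiv 𝓘(ℝ, V) 𝓘(ℝ, V) (chartAt V p) p)

/-- The pull-back `f^*θ`. -/
def pullback (f : N' → N) (θ : DiffForm V N k) : DiffForm V' N' k := fun p =>
  (θ (f p)).compContinuousLinearMap (mfderiv 𝓘(ℝ, V') 𝓘(ℝ, V) f p)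

/-- The interior product `i(X)θ`. -/
def interior (X : ∀ p : N, TangentSpace 𝓘(ℝ, V) p) (θ : DiffForm V N (k + 1)) :
    DiffForm V N k := fun p =>
  ContinuousAlternatingMap.curryLeft (E := V) (θ p) (X p)

end DiffForm

/-- Smooth vector fields. -/
def IsVectorField [IsManifold 𝓘(ℝ, V) ∞ N] (X : ∀ p : N, TangentSpace 𝓘(ℝ, V) p) : Prop :=
  ContMDiff 𝓘(ℝ, V) 𝓘(ℝ, V).tangent ∞ fun p => (⟨p, X p⟩ : TangentBundle 𝓘(ℝ, V) N)

end DifferentialForms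

/-! ### The unified formalism -/

section Formalism

variable {m n : ℕ} {B : FieldBundle m n}

variable (B) in
/-- A volume form on the base manifold. -/
structure VolumeForm where
  form : DiffForm (EuclideanSpace ℝ (Fin m)) B.M m
  isSmooth : form.IsSmooth
  ne_zero : ∀ x, form x ≠ 0

/-- The projection `J²π† → J¹π`. -/
def ExtMom.proj (z : ExtMom B) : Jet B 1 := z.1

/-- The projection `J²π‡ → J¹π`. -/
def RestMom.proj (z : RestMom B) : Jet B 1 := z.1

/-- The projection `ρ_1^r : 𝒲_r → J³π`. -/
def RestUnified.rho1 (z : RestUnified B) : Jet B 3 := z.1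

/-- The projection `ρ_2^r : 𝒲_r → J²π‡`. -/
def RestUnified.rho2 (z : RestUnified B) : RestMom B := Sigma.mk (z.1.trunc 1 (by norm_num)) z.2

/-- The projection `ρ_1 : 𝒲 → J³π`. -/
def ExtUnified.rho1 (z : ExtUnified B) : Jet B 3 := z.1

/-- The projection `ρ_2 : 𝒲 → J²π†`. -/
def ExtUnified.rho2 (z : ExtUnified B) : ExtMom B := Sigma.mk (z.1.trunc 1 (by norm_num)) z.2

/-- The projection `μ_𝒲 : 𝒲 → 𝒲_r`. -/
def ExtUnified.mu (z : ExtUnified B) : RestUnified B := Sigma.mk z.1 (QuotientAddGroup.mk z.2)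

variable (B) in
/-- The symmetrized Liouville form `Θ_1^s` of `J²π†`: at a form `z` on `J¹π`, it is the pull-back
of `z` by the projection onto `J¹π`. -/
def liouvilleForm : DiffForm (JetModel m n 1 × ExtMomModel m n) (ExtMom B) m := fun z =>
  (z.2 : FormAt z.1).compContinuousLinearMap
    (mfderiv 𝓘(ℝ, JetModel m n 1 × ExtMomModel m n) 𝓘(ℝ, JetModel m n 1) ExtMom.proj z)

variable (B) in
/-- The symmetrized Liouville form `Ω_1^s = -dΘ_1^s` of `J²π†`. -/
def multisymplecticForm :
    DiffForm (JetModel m n 1 × ExtMomModel m n) (ExtMom B) (m + 1) :=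
  fun z => -(liouvilleForm B).d z

open Classical in
/-- The prolongation `x ↦ j^k_xφ` of a local section; its value is immaterial (it is `a`) where
`φ` is not a smooth section. -/
def prolong (k : ℕ) (φ : B.M → B.E) (a : Jet B k) (x : B.M) : Jet B k :=
  if h : IsSectionNear B φ x then Jet.mk k ⟨x, φ, h⟩ else a

/-- The pairing `𝒞^s(j²_xφ, θ) = (j¹φ)^*_x θ` of `J²π ×_{J¹π} J²π†` with values in the `m`-forms on
`T_xM`, composed with `J³π → J²π`. -/
def coupling (z : ExtUnified B) :
    TangentSpace (𝓡 m) z.rho1.source [⋀^Fin m]→L[ℝ] ℝ :=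
  (z.2 : FormAt (z.1.trunc 1 (by norm_num))).compContinuousLinearMap
    (mfderiv (𝓡 m) 𝓘(ℝ, JetModel m n 1)
      (prolong 1 z.rho1.rep.sec (z.rho1.trunc 1 (by norm_num))) z.rho1.source)

/-- The hypersurface `𝒲_o` of `𝒲` where the coupling function coincides with the Lagrangian
density `𝓛 = L η`. -/
def couplingZero (η : VolumeForm B) (L : Jet B 2 → ℝ) : Set (ExtUnified B) :=
  {z | L (z.rho1.trunc 2 (by norm_num)) • η.form z.rho1.source = coupling z}

open Classical in
/-- The Hamiltonian section `ĥ : 𝒲_r → 𝒲`, the inverse of the restriction of `μ_𝒲` to `𝒲_o`. -/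
def hamSection (η : VolumeForm B) (L : Jet B 2 → ℝ) (w : RestUnified B) : ExtUnified B :=
  if h : ∃ z ∈ couplingZero η L, z.mu = w then h.choose else Sigma.mk w.1 0

/-- The form `Ω_r = (ρ_2 ∘ ĥ)^*Ω_1^s` of `𝒲_r`. -/
def unifiedForm (η : VolumeForm B) (L : Jet B 2 → ℝ) :
    DiffForm (JetModel m n 3 × RestMomModel m n) (RestUnified B) (m + 1) :=
  (multisymplecticForm B).pullback fun w => (hamSection η L w).rho2

/-- Smooth sections, over an open subset of the base, of `𝒲_r → M`. -/
def RestUnified.IsSectionOn (ψ : B.M → RestUnified B) (U : Set B.M) : Prop :=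
  ContMDiffOn (𝓡 m) 𝓘(ℝ, JetModel m n 3 × RestMomModel m n) ∞ ψ U ∧
    ∀ x ∈ U, (ψ x).rho1.source = x

/-- Smooth sections, over an open subset of the base, of `J²π‡ → M`. -/
def RestMom.IsSectionOn (σ : B.M → RestMom B) (U : Set B.M) : Prop :=
  ContMDiffOn (𝓡 m) 𝓘(ℝ, JetModel m n 1 × RestMomModel m n) ∞ σ U ∧
    ∀ x ∈ U, (σ x).proj.source = x

/-- A section `ψ` of `𝒲_r` is holonomic if `ρ_1^r ∘ ψ = j³φ`, where `φ = π³ ∘ ρ_1^r ∘ ψ`. -/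
def RestUnified.IsHolonomicOn (ψ : B.M → RestUnified B) (U : Set B.M) : Prop :=
  ∀ x ∈ U, ∃ h : IsSectionNear B (fun y => (ψ y).rho1.target) x,
    (ψ x).rho1 = Jet.mk 3 ⟨x, fun y => (ψ y).rho1.target, h⟩

/-- The unified field equation: `ψ^*i(X)Ω_r = 0` for every vector field `X` on `𝒲_r`. -/
def SolvesUnified (η : VolumeForm B) (L : Jet B 2 → ℝ) (ψ : B.M → RestUnified B)
    (U : Set B.M) : Prop :=
  ∀ X : ∀ w : RestUnified B, TangentSpace 𝓘(ℝ, JetModel m n 3 × RestMomModel m n) w,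
    IsVectorField X → ∀ x ∈ U,
      (((unifiedForm η L).interior X).pullback ψ : DiffForm (EuclideanSpace ℝ (Fin m)) B.M m) x = 0

/-! ### The Legendre map -/

/-- The coefficient of the volume form in the chart of the base given by an adapted chart. -/
def volumeCoeff (η : VolumeForm B) (c : B.Chart) (y : Fin m → ℝ) : ℝ :=
  η.form (c.base.symm y) fun i =>
    mfderiv 𝓘(ℝ, Fin m → ℝ) (𝓡 m) c.base.symm y (Pi.single i 1 : Fin m → ℝ)

/-- The local Lagrangian function: the coefficient of `dᵐx` in the Lagrangian density `L η`, in
natural coordinates. -/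
def localLagrangian (η : VolumeForm B) (L : Jet B 2 → ℝ) (c : B.Chart) (v : JetModel m n 2) : ℝ :=
  L ((c.jetChart 2).symm v) * volumeCoeff η c v.1

/-- The partial derivative `∂F/∂u_I^α`. -/
def partialU {k : ℕ} (I : MultiIndexLE m k) (α : Fin n) (F : JetModel m n k → ℝ)
    (v : JetModel m n k) : ℝ :=
  fderiv ℝ F v (0, vecU I α)

/-- The total derivative `dF/dx^j = ∂F/∂x^j + ∑ u_{I+1_j}^α ∂F/∂u_I^α`, where `|I| ≤ 2`. -/
def totalDeriv (j : Fin m) (F : JetModel m n 2 → ℝ) (v : JetModel m n 3) : ℝ :=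
  fderiv ℝ F (truncModel 2 (by norm_num) v) (Pi.single j 1, fun I => v.2 (I.succ j))

/-- The local expression of the restricted Legendre map:
`p^i_α = ∂L/∂u_i^α - ∑_j (1/n(ij)) d/dx^j (∂L/∂u_{1_i+1_j}^α)` and `p^I_α = ∂L/∂u_I^α`. -/
def legendreCoord (F : JetModel m n 2 → ℝ) (v : JetModel m n 3) : RestMomModel m n :=
  (fun i α => partialU (.one 1 i) α F (truncModel 2 (by norm_num) v)
      - ∑ j, (nn i j)⁻¹ * totalDeriv j (partialU (MultiIndexTwo.pair i j).toLE α F) v,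
    fun I α => partialU I.toLE α F (truncModel 2 (by norm_num) v))

/-- The restricted Legendre map `ℱL : J³π → J²π‡`, computed in an adapted chart around the target of
the jet; the result does not depend on the chart. -/
def legendreMap (η : VolumeForm B) (L : Jet B 2 → ℝ) (a : Jet B 3) : RestMom B :=
  let c := (B.exists_chart a.target).choose
  ((restMomCharts B).chart c).symm (c.jetCoord (a.trunc 1 (by norm_num)),
    legendreCoord (localLagrangian η L c) (c.jetCoord a))

open Classical in
/-- The point of `𝒲_r` given by a point of `J³π` and a point of `J²π‡` over the same point
of `J¹π`. -/
def RestUnified.pair (a : Jet B 3) (q : RestMom B) : RestUnified B :=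
  Sigma.mk a (if h : q.proj = a.trunc 1 (by norm_num) then h ▸ q.2 else 0)

/-- The extended Legendre map `J³π → J²π†`, which is `ρ_2 ∘ ĥ` on the graph of `ℱL`. -/
def extLegendreMap (η : VolumeForm B) (L : Jet B 2 → ℝ) (a : Jet B 3) : ExtMom B :=
  (hamSection η L (RestUnified.pair a (legendreMap η L a))).rho2

/-- `Υ` is a (smooth) global section of the Legendre map. The Lagrangian density is hyperregular if
there is one. -/
def IsLegendreSection (η : VolumeForm B) (L : Jet B 2 → ℝ) (Υ : RestMom B → Jet B 3) : Prop :=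
  ContMDiff 𝓘(ℝ, JetModel m n 1 × RestMomModel m n) 𝓘(ℝ, JetModel m n 3) ∞ Υ ∧
    ∀ q, legendreMap η L (Υ q) = q

/-! ### The Hamiltonian formalism -/

/-- The Hamiltonian section `h : J²π‡ → J²π†` of a hyperregular Lagrangian density. -/
def hamiltonianSection (η : VolumeForm B) (L : Jet B 2 → ℝ) (Υ : RestMom B → Jet B 3)
    (q : RestMom B) : ExtMom B :=
  extLegendreMap η L (Υ q)

/-- The Hamilton–Cartan form `Ω_h = h^*Ω_1^s`. -/
def hamiltonCartanForm (η : VolumeForm B) (L : Jet B 2 → ℝ) (Υ : RestMom B → Jet B 3) :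
    DiffForm (JetModel m n 1 × RestMomModel m n) (RestMom B) (m + 1) :=
  (multisymplecticForm B).pullback (hamiltonianSection η L Υ)

/-- The Hamiltonian field equation: `σ^*i(X)Ω_h = 0` for every vector field `X` on `J²π‡`. -/
def SolvesHamilton (η : VolumeForm B) (L : Jet B 2 → ℝ) (Υ : RestMom B → Jet B 3)
    (σ : B.M → RestMom B) (U : Set B.M) : Prop :=
  ∀ X : ∀ q : RestMom B, TangentSpace 𝓘(ℝ, JetModel m n 1 × RestMomModel m n) q,
    IsVectorField X → ∀ x ∈ U,
      (((hamiltonCartanForm η L Υ).interior X).pullback σ :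
        DiffForm (EuclideanSpace ℝ (Fin m)) B.M m) x = 0

/-- The local Hamiltonian function `H`, for which
`h(xⁱ, u^α, u_i^α, p^i_α, p^I_α) = (xⁱ, u^α, u_i^α, -H, p^i_α, p^I_α)` in natural coordinates. -/
def localHamiltonian (η : VolumeForm B) (L : Jet B 2 → ℝ) (Υ : RestMom B → Jet B 3)
    (c : B.Chart) (w : JetModel m n 1 × RestMomModel m n) : ℝ :=
  -((extMomCharts B).chart c
    (hamiltonianSection η L Υ (((restMomCharts B).chart c).symm w))).2.1

/-- The local expression of a section of `J²π‡ → M` in natural coordinates. -/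
def AdaptedChart.localSection (c : B.Chart) (σ : B.M → RestMom B) (y : Fin m → ℝ) :
    JetModel m n 1 × RestMomModel m n :=
  (restMomCharts B).chart c (σ (c.base.symm y))

/-- The Hamilton–De Donder–Weyl equations at a point, for a function `s` of `(xⁱ)` with values in
`(xⁱ, u^α, u_i^α, p^i_α, p^I_α)` and a Hamiltonian function `H`. -/
structure HamiltonDeDonderWeyl (H : JetModel m n 1 × RestMomModel m n → ℝ)
    (s : (Fin m → ℝ) → JetModel m n 1 × RestMomModel m n) (y : Fin m → ℝ) : Prop where
  eq_u : ∀ i α, pderiv i (fun z => (s z).1.2 (.zero m 1) α) y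
    = fderiv ℝ H (s y) (0, (Pi.single i (Pi.single α 1), 0))
  eq_u_one : ∀ I α, (∑ i, ∑ j, if MultiIndexTwo.pair i j = I then
      (nn i j)⁻¹ * pderiv j (fun z => (s z).1.2 (.one 0 i) α) y else 0)
    = fderiv ℝ H (s y) (0, (0, Pi.single I (Pi.single α 1)))
  eq_p : ∀ α, (∑ i, pderiv i (fun z => (s z).2.1 i α) y)
    = -fderiv ℝ H (s y) ((0, vecU (.zero m 1) α), 0)
  eq_p_two : ∀ i α, (∑ j, (nn i j)⁻¹ * pderiv j (fun z => (s z).2.2 (.pair i j) α) y)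
    = -fderiv ℝ H (s y) ((0, vecU (.one 0 i) α), 0)

/-- The Hamilton–De Donder–Weyl equations hold for a section over `U` in all natural charts. -/
def SolvesHamiltonDeDonderWeyl (η : VolumeForm B) (L : Jet B 2 → ℝ) (Υ : RestMom B → Jet B 3)
    (σ : B.M → RestMom B) (U : Set B.M) : Prop :=
  ∀ c : B.Chart, ∀ x ∈ U, (σ x).proj.target ∈ c.total.source →
    HamiltonDeDonderWeyl (localHamiltonian η L Υ c) (c.localSection σ) (c.base x)

end Formalism

end FieldTheory

end

open FieldTheory

open scoped Manifold ContDiff Topology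

noncomputable section

/-! In natural coordinates the Liouville form is linear in the momenta. Hence, up to sign,
`multisymplecticForm` is the pull-back by the natural chart of one constant form, `dTaut`. Both
field equations then have the same pointwise shape, `LocalFieldEq Φ s y`: `dTaut` vanishes on a
vector `dΦ(X)` followed by the images under `d(Φ ∘ s)` of the coordinate vectors of the base.
`forall_isVectorField_iff` makes this translation, since every tangent vector extends to a vector
field.

For the second statement `Φ` is `hamModel H`. Vectors tangent to the section contribute nothing
because the form is alternating, so only vertical `X` matter. The formula `dTaut_vertical`,
evaluated on the coordinate vectors of `u`, `u_i`, `p^i` and `p^I`, gives the four families of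
Hamilton–De Donder–Weyl equations (`localFieldEq_hamModel_iff`).

For the first statement, the coupling condition in coordinates is `p + p^i u_i + p^I u_I = L̂`. It
determines `p`, and the section `ĥ` followed by the projection to the momenta becomes `cartanModel
L̂`. Along the coordinate vectors of the second-order derivatives the unified equation says `p^I =
∂L̂/∂u_I`. Along those of the first-order derivatives it gives the formula for `p^i`, holonomy
turning derivatives along the section into total derivatives. So a holonomic solution lies on the
graph of the Legendre map (`eq_legendreCoord`, `SolvesUnified.legendreMap_eq`).

It remains to pass to the section `h`, which is the same map evaluated at `(Υ q, q)`. Since `Υ` is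
only a right inverse of the Legendre map, `Υ (ℱL a)` need not be `a`. But `cartanModel` ignores
third derivatives, and up to order two the two jets agree (`IsLegendreSection.trunc_two_eq`).
Indeed, over a fixed point of `J¹π`, the map `u_I ↦ ∂L̂/∂u_I` is a self-map of a finite-dimensional
space with a smooth right inverse, obtained from `Υ`; such a map is injective
(`injective_of_contDiff_rightInverse`). The chain rule (`LocalFieldEq.of_comp`) then carries the
unified equation over to the Hamiltonian one. -/

namespace FieldTheory

/-! ### The Liouville form and its differential in natural coordinates -/

section Model

variable {m n : ℕ}

/-- The linear forms `p^k_α du^α + p^{ik}_α du_i^α` that a point of the restricted multimomentum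
fibre gives, one for every `k`. -/
def momSlot (r : RestMomModel m n) (k : Fin m) : (MultiIndexLE m 1 → Fin n → ℝ) →L[ℝ] ℝ :=
  ∑ α, (r.1 k α • formU (.zero m 1) α
      + ∑ i, ((nn i k)⁻¹ * r.2 (.pair i k) α) • formU (.one 0 i) α)

lemma momSlot_apply (r : RestMomModel m n) (k : Fin m) (w : MultiIndexLE m 1 → Fin n → ℝ) :
    momSlot r k w = ∑ α, (r.1 k α * w (.zero m 1) α
      + ∑ i, (nn i k)⁻¹ * r.2 (.pair i k) α * w (.one 0 i) α) := by
  simp [momSlot, sum_apply]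

lemma JetForm.ofCoord_eq (q : ExtMomModel m n) : JetForm.ofCoord q = formOf q.1 (momSlot q.2) :=
  rfl

variable (m n) in
/-- `momSlot` as a linear map. -/
def momSlotL : RestMomModel m n →ₗ[ℝ] (Fin m → (MultiIndexLE m 1 → Fin n → ℝ) →L[ℝ] ℝ) where
  toFun r k := momSlot r k
  map_add' r r' := by
    ext k w
    simp only [momSlot_apply, Pi.add_apply, add_apply,
      Prod.fst_add, Prod.snd_add, ← Finset.sum_add_distrib]
    refine Finset.sum_congr rfl fun α _ => ?_
    simp only [add_mul, mul_add, Finset.sum_add_distrib]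
    ring
  map_smul' a r := by
    ext k w
    simp only [momSlot_apply, Pi.smul_apply, smul_apply, RingHom.id_apply,
      Prod.smul_fst, Prod.smul_snd, smul_eq_mul, Finset.mul_sum]
    refine Finset.sum_congr rfl fun α _ => ?_
    rw [mul_add, Finset.mul_sum]
    congr 1
    · ring
    · exact Finset.sum_congr rfl fun i _ => by ring

variable (m n) in
/-- `JetForm.ofCoord` as a continuous linear map. -/
def ofCoordL : ExtMomModel m n →L[ℝ] JetForm m n :=
  LinearMap.toContinuousLinearMap
    { toFun := JetForm.ofCoord
      -- Linearity is tested after applying `JetForm.coord`, which is injective on `symForms` and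
      -- undoes `JetForm.ofCoord`.
      map_add' := fun a b => by
        rw [← sub_eq_zero]
        refine JetForm.eq_zero_of_coord (sub_mem (JetForm.ofCoord_mem _)
          (add_mem (JetForm.ofCoord_mem _) (JetForm.ofCoord_mem _))) ?_
        rw [map_sub, map_add, JetForm.coord_ofCoord, JetForm.coord_ofCoord, JetForm.coord_ofCoord,
          sub_self]
      map_smul' := fun a b => by
        rw [← sub_eq_zero]
        refine JetForm.eq_zero_of_coord (sub_mem (JetForm.ofCoord_mem _)
          (Submodule.smul_mem _ _ (JetForm.ofCoord_mem _))) ?_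
        rw [map_sub, RingHom.id_apply, map_smul, JetForm.coord_ofCoord, JetForm.coord_ofCoord,
          sub_self] }

/-- These arguments are the tangent vectors of a section in coordinates. The horizontal parts form
the identity matrix, so each wedge is a determinant that differs from the identity in at most one
column. -/
lemma formOf_graph {W : Type*} [NormedAddCommGroup W] [NormedSpace ℝ W] (p : ℝ)
    (f : Fin m → W →L[ℝ] ℝ) (t : Fin m → W) :
    formOf p f (fun i => (Pi.single i 1, t i)) = p + ∑ k, f k (t k) := by
  have h1 : wedge (formX W) (fun i => ((Pi.single i 1 : Fin m → ℝ), t i)) = 1 := by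
    rw [wedge_apply]
    convert Matrix.det_one (R := ℝ) (n := Fin m)
    ext i j
    simp [Pi.single_apply, Matrix.one_apply, eq_comm]
  have h2 : ∀ k, wedge (Function.update (formX W) k
      ((f k).comp (ContinuousLinearMap.snd ℝ _ _)))
      (fun i => ((Pi.single i 1 : Fin m → ℝ), t i)) = f k (t k) := by
    intro k
    rw [wedge_apply]
    -- Replacing the column `k` of the identity matrix makes this a Cramer determinant, equal to the
    -- entry `k` of the new column.
    have : (Matrix.of fun i j => Function.update (formX W) k
        ((f k).comp (ContinuousLinearMap.snd ℝ _ _)) j ((Pi.single i 1 : Fin m → ℝ), t i))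
        = (1 : Matrix (Fin m) (Fin m) ℝ).updateCol k fun i => f k (t i) := by
      ext i j
      by_cases h : j = k
      · subst h; simp
      · simp [h, Pi.single_apply, Matrix.one_apply, eq_comm]
    rw [this, ← Matrix.cramer_apply, Matrix.cramer_one]
    rfl
  simp [formOf, h1, h2]

/-- Once one argument is vertical, a form that vanishes on two vertical vectors does not see the
vertical parts `t i` of the others. -/
lemma formOf_graph_update {W : Type*} [NormedAddCommGroup W] [NormedSpace ℝ W] (p : ℝ)
    (f : Fin m → W →L[ℝ] ℝ) (t : Fin m → W) (k : Fin m) (w : W) :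
    formOf p f (Function.update (fun i => (Pi.single i 1, t i)) k (0, w)) = f k w := by
  rw [← formOf_update p f k w]
  refine (twoHorizontal_formOf p f).congr (k := k) (by simp) (by simp) fun r => ?_
  by_cases h : r = k
  · subst h; simp
  · simp [h, vecX]

variable (m n) in
/-- The expression of the Liouville form in natural coordinates, which is linear in the
coordinates. -/
def tautForm : (JetModel m n 1 × ExtMomModel m n) →L[ℝ]
    (JetModel m n 1 × ExtMomModel m n) [⋀^Fin m]→L[ℝ] ℝ :=
  ((ContinuousAlternatingMap.compContinuousLinearMapCLM
    (ContinuousLinearMap.fst ℝ (JetModel m n 1) (ExtMomModel m n))).comp (ofCoordL m n)).comp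
    (ContinuousLinearMap.snd ℝ _ _)

variable (m n) in
/-- The exterior derivative of the expression of the Liouville form in natural coordinates. -/
def dTaut : (JetModel m n 1 × ExtMomModel m n) [⋀^Fin (m + 1)]→L[ℝ] ℝ :=
  ContinuousAlternatingMap.alternatizeUncurryFin (tautForm m n)

/-- A linear map is its own derivative at every point. The constancy of the differential is what
makes the field equations algebraic in the first derivatives. -/
lemma extDeriv_tautForm (z : JetModel m n 1 × ExtMomModel m n) :
    extDeriv (tautForm m n) z = dTaut m n := by
  rw [extDeriv, ContinuousLinearMap.fderiv]
  rfl

/-- The alternating sum has one term in which the form is differentiated along `Y`, and one for each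
`T k`. Moving `Y` from the front to the place `k` costs the sign `(-1)^k`, which against
`(-1)^(k+1)` leaves a minus sign in every such term. -/
lemma dTaut_vecCons (Y : JetModel m n 1 × ExtMomModel m n)
    (T : Fin m → JetModel m n 1 × ExtMomModel m n) :
    dTaut m n (Matrix.vecCons Y T) = tautForm m n Y T
      - ∑ k, tautForm m n (T k) (Function.update T k Y) := by
  rw [dTaut, ContinuousAlternatingMap.alternatizeUncurryFin_apply, Fin.sum_univ_succ,
    sub_eq_add_neg, ← Finset.sum_neg_distrib]
  congr 1
  · simp [Matrix.vecCons]
  · refine Finset.sum_congr rfl fun k _ => ?_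
    -- Removing the entry `k` from `T` requires a nonempty index set of the form `Fin (m + 1)`.
    cases m with
    | zero => exact k.elim0
    | succ m =>
      have h1 : Fin.removeNth k.succ (Matrix.vecCons Y T)
          = Matrix.vecCons Y (Fin.removeNth k T) := by
        ext i : 1
        refine Fin.cases ?_ (fun i => ?_) i
        · simp [Fin.removeNth]
        · simp [Fin.removeNth, Fin.succ_succAbove_succ]
      have h2 : Function.update T k Y = Fin.insertNth k Y (Fin.removeNth k T) := by
        rw [Fin.insertNth_removeNth]
      rw [h1, h2, ContinuousAlternatingMap.map_insertNth]
      simp [pow_succ]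

/-- All the coordinate equations are read off from this formula. The first two terms come from
differentiating the coefficients of the Liouville form along the vertical vector, by `formOf_graph`.
The last one comes from differentiating them along the section, with the vertical vector in the slot
`k`, by `formOf_graph_update`. -/
lemma dTaut_vertical (w : MultiIndexLE m 1 → Fin n → ℝ) (q : ExtMomModel m n)
    (T : Fin m → JetModel m n 1 × ExtMomModel m n) (hT : ∀ i, (T i).1.1 = Pi.single i 1) :
    dTaut m n (Matrix.vecCons ((0, w), q) T) =
      q.1 + ∑ k, momSlot q.2 k (T k).1.2 - ∑ k, momSlot (T k).2.2 k w := by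
  have h1 : (fun i => (T i).1) = fun i => (Pi.single i 1, (T i).1.2) :=
    funext fun i => Prod.ext (hT i) rfl
  have h2 : ∀ k, (fun i => (Function.update T k ((0, w), q) i).1)
      = Function.update (fun i => (Pi.single i 1, (T i).1.2)) k (0, w) := by
    intro k
    rw [← h1]
    ext1 i
    by_cases h : i = k
    · subst h; simp
    · simp [h]
  have e : ∀ (z : JetModel m n 1 × ExtMomModel m n) T, tautForm m n z T
      = formOf z.2.1 (momSlot z.2.2) fun i => (T i).1 := fun _ _ => rfl
  rw [dTaut_vecCons]
  simp only [e]
  rw [h1, formOf_graph]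
  congr 1
  refine Finset.sum_congr rfl fun k _ => ?_
  rw [h2, formOf_graph_update]

end Model

/-! ### The Hamiltonian equation in coordinates -/

section FieldEquations

variable {m n : ℕ} {V : Type*} [NormedAddCommGroup V] [NormedSpace ℝ V]

/-- The field equation `s^*i(X)Φ^*dΘ = 0` at a point, in coordinates. -/
def LocalFieldEq (Φ : V → JetModel m n 1 × ExtMomModel m n) (s : (Fin m → ℝ) → V)
    (y : Fin m → ℝ) : Prop :=
  ∀ X : V, dTaut m n (Matrix.vecCons (fderiv ℝ Φ (s y) X)
    fun i => fderiv ℝ Φ (s y) (fderiv ℝ s y (Pi.single i 1))) = 0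

lemma pderiv_clm_comp {s : (Fin m → ℝ) → V} {y : Fin m → ℝ} {W : Type*} [NormedAddCommGroup W]
    [NormedSpace ℝ W] (hs : DifferentiableAt ℝ s y) (L : V →L[ℝ] W) (i : Fin m) :
    pderiv i (fun z => L (s z)) y = L (fderiv ℝ s y (Pi.single i 1)) := by
  have h : HasFDerivAt (fun z => L (s z)) (L.comp (fderiv ℝ s y)) y :=
    L.hasFDerivAt.comp y hs.hasFDerivAt
  rw [pderiv, h.fderiv]
  rfl

/-- Applied with `L` the projection to the base coordinates: the derivative of a section projects to
the identity. -/
lemma fderiv_single_of_eventually {s : (Fin m → ℝ) → V} {y : Fin m → ℝ}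
    (hs : DifferentiableAt ℝ s y) (L : V →L[ℝ] (Fin m → ℝ)) (h : ∀ᶠ z in 𝓝 y, L (s z) = z)
    (w : Fin m → ℝ) : L (fderiv ℝ s y w) = w := by
  have h1 : HasFDerivAt (fun z => L (s z)) (L.comp (fderiv ℝ s y)) y :=
    L.hasFDerivAt.comp y hs.hasFDerivAt
  have h2 := h1.unique ((hasFDerivAt_id y).congr_of_eventuallyEq h)
  exact congrArg (fun L => L w) h2

lemma linearMap_eq_zero_of_coord {lam : ((MultiIndexLE m 1 → Fin n → ℝ) × RestMomModel m n) →ₗ[ℝ] ℝ}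
    (h1 : ∀ α, lam (vecU (.zero m 1) α, 0) = 0) (h2 : ∀ i α, lam (vecU (.one 0 i) α, 0) = 0)
    (h3 : ∀ i α, lam (0, (Pi.single i (Pi.single α 1), 0)) = 0)
    (h4 : ∀ I α, lam (0, (0, Pi.single I (Pi.single α 1))) = 0) : lam = 0 := by
  refine LinearMap.prod_ext ?_ (LinearMap.prod_ext ?_ ?_)
  · refine LinearMap.pi_ext' fun I => LinearMap.pi_ext' fun α => LinearMap.ext_ring ?_
    rcases I.eq_zero_or_one with rfl | ⟨i, rfl⟩
    · exact h1 α
    · exact h2 i α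
  · exact LinearMap.pi_ext' fun i => LinearMap.pi_ext' fun α => LinearMap.ext_ring (h3 i α)
  · exact LinearMap.pi_ext' fun I => LinearMap.pi_ext' fun α => LinearMap.ext_ring (h4 I α)

/-- This evaluation and the next three compute the pairings in `dTaut_vertical` on the coordinate
vectors. With derivatives along the section inserted, they become the left-hand sides of the four
families of Hamilton–De Donder–Weyl equations. -/
lemma sum_momSlot_zero (r : Fin m → RestMomModel m n) (α : Fin n) :
    ∑ k, momSlot (r k) k (vecU (.zero m 1) α) = ∑ k, (r k).1 k α := by
  refine Finset.sum_congr rfl fun k _ => ?_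
  rw [momSlot_apply, Finset.sum_eq_single α]
  · simp [vecU, MultiIndexLE.one_ne_zero]
  · intro β _ hβ
    simp [vecU, MultiIndexLE.one_ne_zero, hβ]
  · simp

lemma vecU_one_apply (i j : Fin m) (α : Fin n) :
    vecU (.one 0 i) α (.one 0 j) = if j = i then Pi.single α (1 : ℝ) else 0 := by
  by_cases h : j = i
  · subst h; simp [vecU]
  · have : MultiIndexLE.one 0 j ≠ .one 0 i := fun h' => h (MultiIndexLE.one_injective _ _ h')
    simp [vecU, h, this]

lemma sum_momSlot_one (r : Fin m → RestMomModel m n) (i : Fin m) (α : Fin n) :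
    ∑ k, momSlot (r k) k (vecU (.one 0 i) α)
      = ∑ k, (nn i k)⁻¹ * (r k).2 (.pair i k) α := by
  refine Finset.sum_congr rfl fun k _ => ?_
  rw [momSlot_apply, Finset.sum_eq_single α]
  · rw [Finset.sum_eq_single i]
    · simp [vecU, (MultiIndexLE.one_ne_zero _).symm]
    · intro j _ hj
      simp [vecU_one_apply, hj]
    · simp
  · intro β _ hβ
    have : ∀ j, vecU (.one 0 i) α (.one 0 j) β = (0 : ℝ) := by
      intro j
      rw [vecU_one_apply]
      split_ifs <;> simp [hβ]
    have h0 : vecU (.one 0 i) α (.zero m 1) β = (0 : ℝ) := by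
      simp [vecU, (MultiIndexLE.one_ne_zero _).symm]
    simp [h0, this]
  · simp

/-- Here it is the momentum that is a coordinate vector: for a variation of `p^i_α` only the
component `t i` at the zero multi-index survives, which will be `∂u^α/∂x^i`. -/
lemma sum_momSlot_single (i : Fin m) (α : Fin n) (t : Fin m → MultiIndexLE m 1 → Fin n → ℝ) :
    ∑ k, momSlot (Pi.single i (Pi.single α 1), 0) k (t k) = t i (.zero m 1) α := by
  rw [Finset.sum_eq_single i]
  · rw [momSlot_apply, Finset.sum_eq_single α]
    · simp
    · intro β _ hβ
      simp [hβ]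
    · simp
  · intro k _ hk
    simp [momSlot_apply, hk]
  · simp

/-- The momentum `p^I_α` enters `p^{ij}_α` for every ordered pair with `1_i + 1_j = I`, with weight
`1/n(ij)`; hence the sum over ordered pairs. -/
lemma sum_momSlot_single_two (I : MultiIndexTwo m) (α : Fin n)
    (t : Fin m → MultiIndexLE m 1 → Fin n → ℝ) :
    ∑ k, momSlot (0, Pi.single I (Pi.single α 1)) k (t k) =
      ∑ i, ∑ k, if MultiIndexTwo.pair i k = I then (nn i k)⁻¹ * t k (.one 0 i) α else 0 := by
  rw [Finset.sum_comm]
  refine Finset.sum_congr rfl fun k _ => ?_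
  rw [momSlot_apply, Finset.sum_eq_single α]
  · simp only [Pi.zero_apply, zero_mul, zero_add]
    refine Finset.sum_congr rfl fun i _ => ?_
    by_cases h : MultiIndexTwo.pair i k = I
    · subst h; simp
    · simp [h]
  · intro β _ hβ
    simp only [Pi.zero_apply, zero_mul, zero_add]
    refine Finset.sum_eq_zero fun i _ => ?_
    by_cases h : MultiIndexTwo.pair i k = I
    · subst h; simp [hβ]
    · simp [h]
  · simp

/-- `X ↦ dΘ(X, T₁, …, T_m)` as a linear form. -/
def dTautLeft (T : Fin m → JetModel m n 1 × ExtMomModel m n) :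
    (JetModel m n 1 × ExtMomModel m n) →ₗ[ℝ] ℝ where
  toFun Y := dTaut m n (Matrix.vecCons Y T)
  map_add' Y Y' := (dTaut m n).toContinuousMultilinearMap.toMultilinearMap.cons_add T Y Y'
  map_smul' a Y := (dTaut m n).toContinuousMultilinearMap.toMultilinearMap.cons_smul T a Y

/-- An alternating form vanishes on a repeated argument. This removes the directions tangent to the
section from the field equation. -/
lemma dTautLeft_self (T : Fin m → JetModel m n 1 × ExtMomModel m n) (i : Fin m) :
    dTautLeft T (T i) = 0 :=
  (dTaut m n).map_eq_zero_of_eq (Matrix.vecCons (T i) T) (i := 0) (j := i.succ) (by simp)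
    (Fin.succ_ne_zero i).symm

/-- The section `(xⁱ, u^α, u_i^α, p^i_α, p^I_α) ↦ (xⁱ, u^α, u_i^α, -H, p^i_α, p^I_α)`. -/
def hamModel (H : JetModel m n 1 × RestMomModel m n → ℝ) (w : JetModel m n 1 × RestMomModel m n) :
    JetModel m n 1 × ExtMomModel m n := (w.1, (-H w, w.2))

/-- The tangent vectors of the section span a complement of the vertical vectors and are killed by
alternation. The equation is therefore the vanishing of a linear form on vertical vectors, and its
values on the coordinate basis are the four families of equations. -/
lemma localFieldEq_hamModel_iff {H : JetModel m n 1 × RestMomModel m n → ℝ}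
    {s : (Fin m → ℝ) → JetModel m n 1 × RestMomModel m n} {y : Fin m → ℝ}
    (hH : DifferentiableAt ℝ H (s y)) (hs : DifferentiableAt ℝ s y)
    (h : ∀ᶠ z in 𝓝 y, (s z).1.1 = z) :
    LocalFieldEq (hamModel H) s y ↔ HamiltonDeDonderWeyl H s y := by
  have hΦ : ∀ X, fderiv ℝ (hamModel H) (s y) X = (X.1, (-fderiv ℝ H (s y) X, X.2)) := by
    intro X
    have : HasFDerivAt (hamModel H) ((ContinuousLinearMap.fst ℝ _ _).prod
        ((-fderiv ℝ H (s y)).prod (ContinuousLinearMap.snd ℝ _ _))) (s y) :=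
      hasFDerivAt_fst.prodMk (hH.hasFDerivAt.neg.prodMk hasFDerivAt_snd)
    rw [this.fderiv]
    rfl
  set D : Fin m → JetModel m n 1 × RestMomModel m n := fun i => fderiv ℝ s y (Pi.single i 1)
    with hD
  set T : Fin m → JetModel m n 1 × ExtMomModel m n := fun i => fderiv ℝ (hamModel H) (s y) (D i)
    with hTdef
  have hDx : ∀ i, (D i).1.1 = Pi.single i 1 := fun i =>
    fderiv_single_of_eventually hs ((ContinuousLinearMap.fst ℝ _ _).comp
      (ContinuousLinearMap.fst ℝ _ _)) h _
  have hT : ∀ i, T i = ((D i).1, (-fderiv ℝ H (s y) (D i), (D i).2)) := fun i => hΦ _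
  -- The field equation restricted to vertical vectors `X`.
  let lam : ((MultiIndexLE m 1 → Fin n → ℝ) × RestMomModel m n) →ₗ[ℝ] ℝ :=
    ((dTautLeft T).comp (fderiv ℝ (hamModel H) (s y) : _ →ₗ[ℝ] _)).comp
      (LinearMap.prodMap (LinearMap.inr ℝ (Fin m → ℝ) _) LinearMap.id)
  have hlam : ∀ w P, lam (w, P) = -fderiv ℝ H (s y) ((0, w), P) + ∑ k, momSlot P k (D k).1.2
      - ∑ k, momSlot (D k).2 k w := by
    intro w P
    change dTaut m n (Matrix.vecCons (fderiv ℝ (hamModel H) (s y) ((0, w), P)) T) = _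
    rw [hΦ, dTaut_vertical _ _ _ (fun i => by rw [hT]; exact hDx i)]
    simp only [hT]
  have hiff : LocalFieldEq (hamModel H) s y ↔ lam = 0 := by
    constructor
    · intro hX
      ext1
      · ext w; exact hX _
      · ext w
        · exact hX _
        · exact hX _
    · intro h0 X
      -- Since `D i` has horizontal part the `i`-th basis vector, subtracting the combination with
      -- coefficients `X.1.1` leaves a vertical vector.
      have hdec : X = ((0, X.1.2 - ∑ i, X.1.1 i • (D i).1.2), X.2 - ∑ i, X.1.1 i • (D i).2)
          + ∑ i, X.1.1 i • D i := by
        refine Prod.ext (Prod.ext ?_ ?_) ?_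
        · simp only [Prod.fst_add, Prod.fst_sum, Prod.smul_fst, hDx, zero_add]
          exact pi_eq_sum_univ' X.1.1
        · simp [Prod.fst_sum, Prod.snd_sum]
        · simp [Prod.snd_sum]
      change dTautLeft T (fderiv ℝ (hamModel H) (s y) X) = 0
      rw [hdec, map_add, map_sum, map_add, map_sum]
      have e1 : ∀ i, dTautLeft T (fderiv ℝ (hamModel H) (s y) (X.1.1 i • D i)) = 0 := by
        intro i
        rw [map_smul, map_smul]
        change _ • dTautLeft T (T i) = 0
        rw [dTautLeft_self, smul_zero]
      simp only [e1, Finset.sum_const_zero, add_zero]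
      exact congrArg (fun l => l (X.1.2 - ∑ i, X.1.1 i • (D i).1.2,
        X.2 - ∑ i, X.1.1 i • (D i).2)) h0
  -- The partial derivatives in the Hamilton–De Donder–Weyl equations are the components of the
  -- tangent vectors `D i`.
  have c1 : ∀ i α, pderiv i (fun z => (s z).1.2 (.zero m 1) α) y = (D i).1.2 (.zero m 1) α :=
    fun i α => pderiv_clm_comp hs (((formU (.zero m 1) α).comp
      (ContinuousLinearMap.snd ℝ _ _)).comp (ContinuousLinearMap.fst ℝ _ _)) i
  have c2 : ∀ i j α, pderiv j (fun z => (s z).1.2 (.one 0 i) α) y = (D j).1.2 (.one 0 i) α :=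
    fun i j α => pderiv_clm_comp hs (((formU (.one 0 i) α).comp
      (ContinuousLinearMap.snd ℝ _ _)).comp (ContinuousLinearMap.fst ℝ _ _)) j
  have c3 : ∀ i α, pderiv i (fun z => (s z).2.1 i α) y = (D i).2.1 i α :=
    fun i α => pderiv_clm_comp hs ((((ContinuousLinearMap.proj (R := ℝ)
      (φ := fun _ : Fin n => ℝ) α).comp (ContinuousLinearMap.proj (R := ℝ)
      (φ := fun _ : Fin m => Fin n → ℝ) i)).comp (ContinuousLinearMap.fst ℝ _ _)).comp
      (ContinuousLinearMap.snd ℝ _ _)) i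
  have c4 : ∀ i j α, pderiv j (fun z => (s z).2.2 (.pair i j) α) y = (D j).2.2 (.pair i j) α :=
    fun i j α => pderiv_clm_comp hs ((((ContinuousLinearMap.proj (R := ℝ)
      (φ := fun _ : Fin n => ℝ) α).comp (ContinuousLinearMap.proj (R := ℝ)
      (φ := fun _ : MultiIndexTwo m => Fin n → ℝ) (.pair i j))).comp
      (ContinuousLinearMap.snd ℝ _ _)).comp (ContinuousLinearMap.snd ℝ _ _)) j
  -- Variations of `u` and `u_i` pair with the derivatives of the momenta, and variations of the
  -- momenta pair with the derivatives of `u` and `u_i`.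
  have z1 : ∀ w, lam (w, 0) = -fderiv ℝ H (s y) ((0, w), 0) - ∑ k, momSlot (D k).2 k w := by
    intro w
    simp [hlam, momSlot_apply]
  have z2 : ∀ P, lam (0, P) = -fderiv ℝ H (s y) (0, P) + ∑ k, momSlot P k (D k).1.2 := by
    intro P
    rw [hlam]
    simp only [map_zero, Finset.sum_const_zero, sub_zero]
    rfl
  rw [hiff]
  constructor
  · intro h0
    have h0' : ∀ w P, lam (w, P) = 0 := fun w P => by rw [h0]; rfl
    refine ⟨fun i α => ?_, fun I α => ?_, fun α => ?_, fun i α => ?_⟩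
    · have := h0' 0 (Pi.single i (Pi.single α 1), 0)
      rw [z2, sum_momSlot_single] at this
      rw [c1]; linarith
    · have := h0' 0 (0, Pi.single I (Pi.single α 1))
      rw [z2, sum_momSlot_single_two] at this
      simp only [c2]; linarith
    · have := h0' (vecU (.zero m 1) α) 0
      rw [z1, sum_momSlot_zero] at this
      simp only [c3]; linarith
    · have := h0' (vecU (.one 0 i) α) 0
      rw [z1, sum_momSlot_one] at this
      simp only [c4]; linarith
  · intro hw
    refine linearMap_eq_zero_of_coord (fun α => ?_) (fun i α => ?_) (fun i α => ?_) (fun I α => ?_)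
    · have := hw.eq_p α
      simp only [c3] at this
      rw [z1, sum_momSlot_zero]; linarith
    · have := hw.eq_p_two i α
      simp only [c4] at this
      rw [z1, sum_momSlot_one]; linarith
    · have := hw.eq_u i α
      rw [c1] at this
      rw [z2, sum_momSlot_single]; linarith
    · have := hw.eq_u_one I α
      simp only [c2] at this
      rw [z2, sum_momSlot_single_two]; linarith

end FieldEquations

/-! ### The unified equation in coordinates and the Legendre map -/

section UnifiedEquations

variable {m n : ℕ}

/-- The pairing `p^i_α u_i^α + p^I_α u_I^α`. -/
def momPairing (r : RestMomModel m n) (u : MultiIndexLE m 2 → Fin n → ℝ) : ℝ :=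
  ∑ k, momSlot r k fun I => u (I.succ k)

variable (m n) in
/-- The pairing `p^i_α u_i^α + p^I_α u_I^α` as a bilinear map. -/
def momPairingB : RestMomModel m n →L[ℝ] (MultiIndexLE m 2 → Fin n → ℝ) →L[ℝ] ℝ :=
  LinearMap.toContinuousLinearMap (LinearMap.toContinuousLinearMap.toLinearMap ∘ₗ
    LinearMap.mk₂ ℝ momPairing
      (fun r r' u => by
        have : ∀ k, momSlot (r + r') k = momSlot r k + momSlot r' k := fun k =>
          congrFun (map_add (momSlotL m n) r r') k
        simp [momPairing, this, Finset.sum_add_distrib])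
      (fun a r u => by
        have : ∀ k, momSlot (a • r) k = a • momSlot r k := fun k =>
          congrFun (map_smul (momSlotL m n) a r) k
        simp [momPairing, this, Finset.mul_sum])
      (fun r u u' => by
        rw [momPairing, momPairing, momPairing, ← Finset.sum_add_distrib]
        exact Finset.sum_congr rfl fun k _ => map_add (momSlot r k) (fun I => u (I.succ k)) _)
      (fun a r u => by
        rw [momPairing, momPairing, Finset.smul_sum]
        exact Finset.sum_congr rfl fun k _ => map_smul (momSlot r k) a (fun I => u (I.succ k))))

lemma MultiIndexLE.succ_zero (k : Fin m) : (MultiIndexLE.zero m 1).succ k = .one 1 k := by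
  apply Subtype.ext
  simp [MultiIndexLE.zero, MultiIndexLE.succ, MultiIndexLE.one]

lemma MultiIndexLE.succ_one (i k : Fin m) :
    (MultiIndexLE.one 0 i).succ k = (MultiIndexTwo.pair i k).toLE := rfl

lemma MultiIndexLE.one_succ_injective (i j : Fin m) (h : MultiIndexLE.one 1 i = .one 1 j) :
    i = j :=
  MultiIndexLE.one_injective i j (Subtype.ext (congrArg (fun I => I.1) h))

lemma MultiIndexTwo.toLE_ne_one (K : MultiIndexTwo m) (i : Fin m) : K.toLE ≠ .one 1 i := by
  intro h
  have h1 := congrArg (fun I : MultiIndexLE m 2 => ∑ j, I.1 j) h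
  simp [MultiIndexTwo.toLE, MultiIndexLE.one, K.2] at h1

lemma MultiIndexTwo.toLE_injective (K K' : MultiIndexTwo m) (h : K.toLE = K'.toLE) : K = K' :=
  Subtype.ext (congrArg (fun I : MultiIndexLE m 2 => I.1) h)

/-- There are `n(ij)` ordered pairs with sum `K = 1_i + 1_j`, each of weight `1/n(ij)`, so the
momentum `p^K` appears with total weight one. -/
lemma momPairing_vecU_two (r : RestMomModel m n) (K : MultiIndexTwo m) (α : Fin n) :
    momPairing r (vecU K.toLE α) = r.2 K α := by
  have h1 : ∀ k, (momSlot r k fun I => vecU K.toLE α (I.succ k)) =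
      ∑ i, if MultiIndexTwo.pair i k = K then (nn i k)⁻¹ * r.2 K α else 0 := by
    intro k
    rw [momSlot_apply, Finset.sum_eq_single α]
    · simp only [MultiIndexLE.succ_zero, MultiIndexLE.succ_one]
      have : vecU K.toLE α (.one 1 k) α = (0 : ℝ) := by
        simp [vecU, (K.toLE_ne_one k).symm]
      rw [this, mul_zero, zero_add]
      refine Finset.sum_congr rfl fun i _ => ?_
      split_ifs with h
      · subst h; simp [vecU]
      · have h' : (MultiIndexTwo.pair i k).toLE ≠ K.toLE :=
          fun h' => h (MultiIndexTwo.toLE_injective _ _ h')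
        simp [vecU, h']
    · intro β _ hβ
      have : ∀ J, vecU K.toLE α J β = (0 : ℝ) := by
        intro J
        by_cases h : J = K.toLE
        · subst h; simp [vecU, hβ]
        · simp [vecU, h]
      simp [this]
    · simp
  rw [momPairing]
  simp only [h1]
  obtain ⟨a, b, rfl⟩ := K.exists_pair
  rw [Finset.sum_comm, sum_pair a b fun i k => (nn i k)⁻¹ * r.2 (.pair a b) α]
  split_ifs with h
  · subst h; simp [nn]
  · simp only [nn, h, Ne.symm h, if_false]
    ring

/-- Only the zero multi-index is raised to one of length one; the other components read by `momSlot`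
are raised to length two, where this vector vanishes. -/
lemma momPairing_vecU_one (r : RestMomModel m n) (i : Fin m) (α : Fin n) :
    momPairing r (vecU (.one 1 i) α) = r.1 i α := by
  rw [momPairing, Finset.sum_eq_single i]
  · rw [momSlot_apply, Finset.sum_eq_single α]
    · simp only [MultiIndexLE.succ_zero, MultiIndexLE.succ_one]
      simp [vecU, MultiIndexTwo.toLE_ne_one]
    · intro β _ hβ
      simp only [MultiIndexLE.succ_zero, MultiIndexLE.succ_one]
      simp [vecU, MultiIndexTwo.toLE_ne_one, hβ]
    · simp
  · intro k _ hk
    have : MultiIndexLE.one 1 k ≠ .one 1 i := fun h => hk (MultiIndexLE.one_succ_injective _ _ h)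
    rw [momSlot_apply]
    simp only [MultiIndexLE.succ_zero, MultiIndexLE.succ_one]
    simp [vecU, MultiIndexTwo.toLE_ne_one, this]
  · simp

/-- The map `(x, u, u_i, u_I, p^i, p^I) ↦ (x, u, u_i, L - p^i u_i - p^I u_I, p^i, p^I)`. -/
def cartanModel (G : JetModel m n 2 → ℝ) (z : JetModel m n 2 × RestMomModel m n) :
    JetModel m n 1 × ExtMomModel m n :=
  (truncModel 1 (by norm_num) z.1, (G z.1 - momPairing z.2 z.1.2, z.2))

/-- `truncModel` as a continuous linear map. -/
def truncModelL {k : ℕ} (r : ℕ) (h : r ≤ k) : JetModel m n k →L[ℝ] JetModel m n r :=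
  LinearMap.toContinuousLinearMap
    { toFun := truncModel r h
      map_add' := fun _ _ => rfl
      map_smul' := fun _ _ => rfl }

/-- The projection `(v, r) ↦ (v', r)` that forgets the derivatives of order three. -/
def truncFst (m n : ℕ) : (JetModel m n 3 × RestMomModel m n) →L[ℝ]
    (JetModel m n 2 × RestMomModel m n) :=
  ((truncModelL 2 (by norm_num)).comp (ContinuousLinearMap.fst ℝ _ _)).prod
    (ContinuousLinearMap.snd ℝ _ _)

lemma truncFst_apply (z : JetModel m n 3 × RestMomModel m n) :
    truncFst m n z = (truncModel 2 (by norm_num) z.1, z.2) := rfl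

/-- The derivative of `cartanModel` at `z`, where `A` is the derivative of `G`. -/
def cartanDeriv (A : JetModel m n 2 →L[ℝ] ℝ) (z : JetModel m n 2 × RestMomModel m n) :
    (JetModel m n 2 × RestMomModel m n) →L[ℝ] (JetModel m n 1 × ExtMomModel m n) :=
  let p₁ := ContinuousLinearMap.fst ℝ (JetModel m n 2) (RestMomModel m n)
  let p₂ := ContinuousLinearMap.snd ℝ (JetModel m n 2) (RestMomModel m n)
  let q : JetModel m n 2 →L[ℝ] (MultiIndexLE m 2 → Fin n → ℝ) := ContinuousLinearMap.snd ℝ _ _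
  let b : (JetModel m n 2 × RestMomModel m n) →L[ℝ] ℝ :=
    (momPairingB m n z.2).comp (q.comp p₁) + ((momPairingB m n).comp p₂).flip z.1.2
  let a : (JetModel m n 2 × RestMomModel m n) →L[ℝ] ℝ := A.comp p₁ - b
  ((truncModelL 1 (by norm_num)).comp p₁).prod (a.prod p₂)

lemma cartanDeriv_apply (A : JetModel m n 2 →L[ℝ] ℝ) (z X : JetModel m n 2 × RestMomModel m n) :
    cartanDeriv A z X = (truncModel 1 (by norm_num) X.1,
      (A X.1 - (momPairing z.2 X.1.2 + momPairing X.2 z.1.2), X.2)) := rfl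

lemma hasFDerivAt_cartanModel {G : JetModel m n 2 → ℝ} {z : JetModel m n 2 × RestMomModel m n}
    (hG : DifferentiableAt ℝ G z.1) :
    HasFDerivAt (cartanModel G) (cartanDeriv (fderiv ℝ G z.1) z) z := by
  have h1 : HasFDerivAt (fun w : JetModel m n 2 × RestMomModel m n => G w.1)
      ((fderiv ℝ G z.1).comp (ContinuousLinearMap.fst ℝ _ _)) z :=
    hG.hasFDerivAt.comp z hasFDerivAt_fst
  have h2 : HasFDerivAt (fun w : JetModel m n 2 × RestMomModel m n => momPairingB m n w.2)
      ((momPairingB m n).comp (ContinuousLinearMap.snd ℝ _ _)) z :=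
    ((momPairingB m n).comp (ContinuousLinearMap.snd ℝ (JetModel m n 2) _)).hasFDerivAt
  have h3 : HasFDerivAt (fun w : JetModel m n 2 × RestMomModel m n => w.1.2)
      ((ContinuousLinearMap.snd ℝ _ _).comp (ContinuousLinearMap.fst ℝ _ _)) z :=
    ((ContinuousLinearMap.snd ℝ _ _).comp
      (ContinuousLinearMap.fst ℝ (JetModel m n 2) (RestMomModel m n))).hasFDerivAt
  have h4 : HasFDerivAt (fun w : JetModel m n 2 × RestMomModel m n =>
      truncModel (m := m) (n := n) 1 (by norm_num : 1 ≤ 2) w.1)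
      ((truncModelL 1 (by norm_num)).comp (ContinuousLinearMap.fst ℝ _ _)) z :=
    ((truncModelL 1 (by norm_num)).comp
      (ContinuousLinearMap.fst ℝ (JetModel m n 2) (RestMomModel m n))).hasFDerivAt
  exact h4.prodMk ((h1.sub (h2.clm_apply h3)).prodMk hasFDerivAt_snd)

/-- The field equation for `cartanModel`, along a holonomic section, contains the equations of the
Legendre map. -/
lemma eq_legendreCoord {G : JetModel m n 2 → ℝ}
    {s : (Fin m → ℝ) → JetModel m n 3 × RestMomModel m n} {y : Fin m → ℝ}
    (hG : ∀ᶠ z in 𝓝 y, ContDiffAt ℝ ∞ G (truncModel 2 (by norm_num) (s z).1))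
    (hs : ∀ᶠ z in 𝓝 y, DifferentiableAt ℝ s z)
    (hx : ∀ᶠ z in 𝓝 y, (s z).1.1 = z)
    (hol : ∀ j, ∀ I : MultiIndexLE m 2,
      (fderiv ℝ s y (Pi.single j 1)).1.2 (I.castLE (by norm_num)) = (s y).1.2 (I.succ j))
    (h : ∀ᶠ z in 𝓝 y, LocalFieldEq (cartanModel G ∘ truncFst m n) s z) :
    (s y).2 = legendreCoord G (s y).1 := by
  -- The equation tested on a variation `w` of the jet coordinates alone. The derivative of `-p`
  -- pairs with no momentum variation, so only `∂L̂`, the pairing with `w` and the derivatives of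
  -- the momenta along the section remain.
  have key : ∀ z, ContDiffAt ℝ ∞ G (truncModel 2 (by norm_num) (s z).1) →
      DifferentiableAt ℝ s z → (∀ᶠ z' in 𝓝 z, (s z').1.1 = z') →
      LocalFieldEq (cartanModel G ∘ truncFst m n) s z → ∀ w : MultiIndexLE m 3 → Fin n → ℝ,
      fderiv ℝ G (truncModel 2 (by norm_num) (s z).1) (0, fun I => w (I.castLE (by norm_num)))
        - momPairing (s z).2 (fun I => w (I.castLE (by norm_num)))
        - ∑ k, momSlot (fderiv ℝ s z (Pi.single k 1)).2 k
          (fun I => w (I.castLE (by norm_num))) = 0 := by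
    intro z hGz hsz hxz hz w
    have hd : HasFDerivAt (cartanModel G ∘ truncFst m n) _ (s z) :=
      (hasFDerivAt_cartanModel (z := truncFst m n (s z))
        (hGz.differentiableAt (by simp))).comp (s z) (truncFst m n).hasFDerivAt
    have hz' := hz ((0, w), 0)
    rw [hd.fderiv] at hz'
    have hx1 : ∀ i, (fderiv ℝ s z (Pi.single i 1)).1.1 = Pi.single i 1 := fun i =>
      fderiv_single_of_eventually hsz ((ContinuousLinearMap.fst ℝ _ _).comp
        (ContinuousLinearMap.fst ℝ _ _)) hxz _
    have hv := dTaut_vertical (fun I : MultiIndexLE m 1 => w (I.castLE (by norm_num)))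
      (fderiv ℝ G (truncModel 2 (by norm_num) (s z).1) (0, fun I => w (I.castLE (by norm_num)))
        - (momPairing (s z).2 (fun I => w (I.castLE (by norm_num)))
          + momPairing 0 (truncModel 2 (by norm_num) (s z).1).2), (0 : RestMomModel m n))
      (fun i => cartanDeriv (fderiv ℝ G (truncFst m n (s z)).1) (truncFst m n (s z))
        (truncFst m n (fderiv ℝ s z (Pi.single i 1)))) hx1
    have e := hv.symm.trans hz'
    have e0 : ∀ k, momSlot (0 : RestMomModel m n) k = 0 := fun k =>
      congrFun (map_zero (momSlotL m n)) k
    have e1 : momPairing (0 : RestMomModel m n) (truncModel 2 (by norm_num) (s z).1).2 = 0 := by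
      simp [momPairing, e0]
    rw [e1] at e
    simp only [e0, add_zero] at e
    simp only [cartanDeriv_apply, truncFst_apply] at e
    simpa using e
  have hxx := hx.eventually_nhds
  -- The test vector is the coordinate vector of `u_K^α` with `|K| = 2`. The identity is needed on a
  -- whole neighbourhood because it is differentiated below.
  have two : ∀ᶠ z in 𝓝 y, ∀ K α, (s z).2.2 K α =
      partialU K.toLE α G (truncModel 2 (by norm_num) (s z).1) := by
    filter_upwards [hG, hs, hxx, h] with z h1 h2 h3 h4 K α
    have := key z h1 h2 h3 h4 (vecU (K.toLE.castLE (by norm_num)) α)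
    have e1 : (fun I : MultiIndexLE m 2 => vecU (K.toLE.castLE (by norm_num : 2 ≤ 3)) α
        (I.castLE (by norm_num))) = vecU K.toLE α := by
      funext I
      by_cases hI : I = K.toLE
      · subst hI; simp [vecU]
      · have : I.castLE (by norm_num : 2 ≤ 3) ≠ K.toLE.castLE (by norm_num) := fun h' =>
          hI (Subtype.ext (congrArg (fun J : MultiIndexLE m 3 => J.1) h'))
        simp [vecU, hI, this]
    -- A variation of a second-order coordinate is invisible in `J¹π`, so the derivatives of the
    -- momenta drop out.
    have e2 : (fun I : MultiIndexLE m 1 => vecU (K.toLE.castLE (by norm_num : 2 ≤ 3)) α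
        (I.castLE (by norm_num))) = 0 := by
      funext I
      have : I.castLE (by norm_num : 1 ≤ 3) ≠ K.toLE.castLE (by norm_num) := fun h' => by
        have h5 := congrArg (fun J : MultiIndexLE m 3 => ∑ j, J.1 j) h'
        have h6 := I.2
        have h7 := K.2
        simp only [MultiIndexLE.castLE, MultiIndexTwo.toLE] at h5
        omega
      simp [vecU, this]
    rw [e1, e2, momPairing_vecU_two] at this
    simp only [map_zero, Finset.sum_const_zero, sub_zero] at this
    rw [partialU]
    linarith
  refine Prod.ext (funext fun i => funext fun α => ?_)
    (funext fun K => funext fun α => two.self_of_nhds K α)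
  -- The coordinate vector of `u_i^α` survives in `J¹π`, so now the terms `(1/n(ik))
  -- ∂p^{1_i+1_k}/∂x^k` appear.
  have one := key y hG.self_of_nhds hs.self_of_nhds hx h.self_of_nhds (vecU (.one 2 i) α)
  have e1 : (fun I : MultiIndexLE m 2 => vecU (.one 2 i) α
      (I.castLE (by norm_num : 2 ≤ 3))) = vecU (.one 1 i) α := by
    funext I
    by_cases hI : I = .one 1 i
    · subst hI
      have : (MultiIndexLE.one 1 i).castLE (by norm_num : 2 ≤ 3) = .one 2 i := rfl
      simp [vecU, this]
    · have : I.castLE (by norm_num : 2 ≤ 3) ≠ .one 2 i := fun h' =>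
        hI (Subtype.ext (congrArg (fun J : MultiIndexLE m 3 => J.1) h'))
      simp [vecU, hI, this]
  have e2 : (fun I : MultiIndexLE m 1 => vecU (.one 2 i) α
      (I.castLE (by norm_num : 1 ≤ 3))) = vecU (.one 0 i) α := by
    funext I
    by_cases hI : I = .one 0 i
    · subst hI
      have : (MultiIndexLE.one 0 i).castLE (by norm_num : 1 ≤ 3) = .one 2 i := rfl
      simp [vecU, this]
    · have : I.castLE (by norm_num : 1 ≤ 3) ≠ .one 2 i := fun h' =>
        hI (Subtype.ext (congrArg (fun J : MultiIndexLE m 3 => J.1) h'))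
      simp [vecU, hI, this]
  rw [e1, e2, momPairing_vecU_one, sum_momSlot_one] at one
  have hsy := hs.self_of_nhds
  -- Differentiating the equation for `p^K` along the section: by the chain rule and holonomy, the
  -- tangent vector at the second jet is the one that defines the total derivative.
  have hD : ∀ k, (fderiv ℝ s y (Pi.single k 1)).2.2 (.pair i k) α
      = totalDeriv k (partialU (MultiIndexTwo.pair i k).toLE α G) (s y).1 := by
    intro k
    have c4 : pderiv k (fun z => (s z).2.2 (.pair i k) α) y
        = (fderiv ℝ s y (Pi.single k 1)).2.2 (.pair i k) α :=
      pderiv_clm_comp hsy ((((ContinuousLinearMap.proj (R := ℝ)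
        (φ := fun _ : Fin n => ℝ) α).comp (ContinuousLinearMap.proj (R := ℝ)
        (φ := fun _ : MultiIndexTwo m => Fin n → ℝ) (.pair i k))).comp
        (ContinuousLinearMap.snd ℝ _ _)).comp (ContinuousLinearMap.snd ℝ _ _)) k
    have hev : (fun z => (s z).2.2 (.pair i k) α) =ᶠ[𝓝 y] fun z =>
        partialU (MultiIndexTwo.pair i k).toLE α G (truncModel 2 (by norm_num) (s z).1) := by
      filter_upwards [two] with z hz
      exact hz _ _
    rw [← c4, (pderiv_congr k hev).self_of_nhds, totalDeriv, pderiv]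
    have hp : DifferentiableAt ℝ (partialU (MultiIndexTwo.pair i k).toLE α G)
        (truncModel 2 (by norm_num) (s y).1) :=
      (((hG.self_of_nhds.fderiv_right (m := ∞) (by simp)).clm_apply
        contDiffAt_const).differentiableAt (by simp))
    have hc : HasFDerivAt (fun z => truncModel (m := m) (n := n) 2 (by norm_num : 2 ≤ 3) (s z).1)
        (((truncModelL 2 (by norm_num)).comp (ContinuousLinearMap.fst ℝ _ _)).comp
          (fderiv ℝ s y)) y :=
      ((truncModelL 2 (by norm_num)).comp (ContinuousLinearMap.fst ℝ (JetModel m n 3)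
        (RestMomModel m n))).hasFDerivAt.comp y hsy.hasFDerivAt
    have hcomp : HasFDerivAt (fun z => partialU (MultiIndexTwo.pair i k).toLE α G
        (truncModel 2 (by norm_num) (s z).1)) _ y :=
      HasFDerivAt.comp (g := partialU (MultiIndexTwo.pair i k).toLE α G) y hp.hasFDerivAt hc
    rw [hcomp.fderiv]
    rw [ContinuousLinearMap.comp_apply]
    congr 1
    -- The base component comes from the section property and the fibre components from holonomy.
    refine Prod.ext ?_ (funext fun I => hol k I)
    exact fderiv_single_of_eventually hsy ((ContinuousLinearMap.fst ℝ _ _).comp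
        (ContinuousLinearMap.fst ℝ _ _)) hx _
  simp only [hD] at one
  change _ = partialU (.one 1 i) α G _ - _
  rw [partialU]
  linarith

end UnifiedEquations

/-! ### Exterior derivatives and field equations in charts of a manifold -/

section Manifolds

variable {V : Type*} [NormedAddCommGroup V] [NormedSpace ℝ V]
  {N : Type*} [TopologicalSpace N] [ChartedSpace V N] {k : ℕ}

/-- The exterior derivative may be computed in any chart. -/
lemma DiffForm.d_eq_of_chart [IsManifold 𝓘(ℝ, V) ∞ N] (θ : DiffForm V N k)
    {e : OpenPartialHomeomorph N V} (he : e ∈ IsManifold.maximalAtlas 𝓘(ℝ, V) ∞ N) {p : N}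
    (hp : p ∈ e.source) {τ : V → V [⋀^Fin k]→L[ℝ] ℝ} (hτ : DifferentiableAt ℝ τ (e p))
    (h : ∀ q ∈ e.source, θ q =
      (τ (e q)).compContinuousLinearMap (mfderiv 𝓘(ℝ, V) 𝓘(ℝ, V) e q)) :
    θ.d p = (extDeriv τ (e p)).compContinuousLinearMap (mfderiv 𝓘(ℝ, V) 𝓘(ℝ, V) e p) := by
  set e₀ := chartAt V p with he₀
  have hp₀ : p ∈ e₀.source := mem_chart_source V p
  have hm₀ : e₀ ∈ IsManifold.maximalAtlas 𝓘(ℝ, V) ∞ N := IsManifold.chart_mem_maximalAtlas p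
  have hes : ∀ q ∈ e.source, MDifferentiableAt 𝓘(ℝ, V) 𝓘(ℝ, V) e q := fun q hq =>
    ((contMDiffOn_of_mem_maximalAtlas he).contMDiffAt
      (e.open_source.mem_nhds hq)).mdifferentiableAt (by simp)
  have hes₀ : MDifferentiableAt 𝓘(ℝ, V) 𝓘(ℝ, V) e₀ p :=
    ((contMDiffOn_of_mem_maximalAtlas hm₀).contMDiffAt
      (e₀.open_source.mem_nhds hp₀)).mdifferentiableAt (by simp)
  have hsy : ∀ y ∈ e₀.target, ContMDiffAt 𝓘(ℝ, V) 𝓘(ℝ, V) ∞ e₀.symm y := fun y hy =>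
    (contMDiffOn_symm_of_mem_maximalAtlas hm₀).contMDiffAt (e₀.open_target.mem_nhds hy)
  set g : V → V := fun y => e (e₀.symm y) with hg
  have hU : ∀ᶠ y in 𝓝 (e₀ p), y ∈ e₀.target ∧ e₀.symm y ∈ e.source :=
    Filter.inter_mem (e₀.open_target.mem_nhds (e₀.map_source hp₀))
      ((e₀.continuousAt_symm (e₀.map_source hp₀)).preimage_mem_nhds
        (e.open_source.mem_nhds (by rwa [e₀.left_inv hp₀])))
  -- The expression in the preferred chart is the pull-back of `τ` by the transition map `g`.
  have hin : θ.inChart p =ᶠ[𝓝 (e₀ p)] fun y =>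
      (τ (g y)).compContinuousLinearMap (fderiv ℝ g y) := by
    filter_upwards [hU] with y hy
    have h1 := mfderiv_comp y (hes _ hy.2) ((hsy y hy.1).mdifferentiableAt (by simp))
    rw [DiffForm.inChart, ← he₀, h _ hy.2, ← mfderiv_eq_fderiv]
    change _ = (τ (g y)).compContinuousLinearMap (mfderiv 𝓘(ℝ, V) 𝓘(ℝ, V) (e ∘ e₀.symm) y)
    rw [h1]
    rfl
  have hgp : g (e₀ p) = e p := by rw [hg]; simp only [e₀.left_inv hp₀]
  have hgs : ContDiffAt ℝ ∞ g (e₀ p) := by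
    rw [← contMDiffAt_iff_contDiffAt]
    refine ContMDiffAt.comp (g := e) _ ?_ (hsy _ (e₀.map_source hp₀))
    rw [e₀.left_inv hp₀]
    exact (contMDiffOn_of_mem_maximalAtlas he).contMDiffAt (e.open_source.mem_nhds hp)
  have hcomp : mfderiv 𝓘(ℝ, V) 𝓘(ℝ, V) e p
      = (fderiv ℝ g (e₀ p)).comp (mfderiv 𝓘(ℝ, V) 𝓘(ℝ, V) e₀ p) := by
    have h2 : (e : N → V) =ᶠ[𝓝 p] g ∘ e₀ := by
      filter_upwards [e₀.open_source.mem_nhds hp₀] with q hq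
      simp only [hg, Function.comp_apply, e₀.left_inv hq]
    rw [h2.mfderiv_eq, mfderiv_comp p (hgs.differentiableAt (by simp)).mdifferentiableAt hes₀,
      mfderiv_eq_fderiv]
    rfl
  -- The exterior derivative commutes with the pull-back by `g`, and `hcomp` recombines the
  -- derivatives of `g` and of the preferred chart into that of `e`.
  rw [DiffForm.d, ← he₀, hin.extDeriv_eq,
    extDeriv_pullback (r := ∞) (by rwa [hgp]) hgs (by simpa using natCast_le_infty 2),
    hgp, hcomp]
  rfl

/-- Every tangent vector is the value of a smooth vector field. -/
lemma exists_isVectorField [IsManifold 𝓘(ℝ, V) ∞ N] [FiniteDimensional ℝ V] [T2Space N] (p : N)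
    (v : TangentSpace 𝓘(ℝ, V) p) :
    ∃ X : ∀ q : N, TangentSpace 𝓘(ℝ, V) q, IsVectorField X ∧ X p = v := by
  -- A local extension of the vector is multiplied by a bump function whose closed support lies
  -- where the extension is smooth; at `p` the bump function is one.
  obtain ⟨s, hs, hX⟩ := FiberBundle.exists_contMDiffOn_extend (k := ∞) 𝓘(ℝ, V) V v
  obtain ⟨f, -, hf⟩ := (SmoothBumpFunction.nhds_basis_tsupport (I := 𝓘(ℝ, V)) p).mem_iff.1
    (interior_mem_nhds.2 hs)
  refine ⟨fun q => f q • FiberBundle.extend V v q, ?_, ?_⟩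
  · exact ContMDiffOn.smul_section_of_tsupport f.contMDiff.contMDiffOn isOpen_interior hf
      (hX.mono interior_subset)
  · simp

variable {V' : Type*} [NormedAddCommGroup V'] [NormedSpace ℝ V']
  {N' : Type*} [TopologicalSpace N'] [ChartedSpace V' N']
  {V₀ : Type*} [NormedAddCommGroup V₀] [NormedSpace ℝ V₀]
  {M : Type*} [TopologicalSpace M] [ChartedSpace V₀ M]

/-- Tangent spaces at propositionally equal points are different types. With the derivative regarded
as a map of the model spaces, the chain rule can be applied at `b.symm (b x)` with a derivative
taken at `x`. -/
lemma hasMFDerivAt_of_eq {f : M → N} {x x' : M} (h : x' = x)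
    (hf : MDifferentiableAt 𝓘(ℝ, V₀) 𝓘(ℝ, V) f x) :
    HasMFDerivAt 𝓘(ℝ, V₀) 𝓘(ℝ, V) f x' (mfderiv 𝓘(ℝ, V₀) 𝓘(ℝ, V) f x : V₀ →L[ℝ] V) := by
  subst h
  exact hf.hasMFDerivAt

/-- The equation `σ^*i(X)F^*Ω = 0` for all vector fields `X`, in coordinates, where `Ω` has constant
coefficients in some chart. -/
lemma forall_isVectorField_iff [IsManifold 𝓘(ℝ, V) ∞ N] [IsManifold 𝓘(ℝ, V') ∞ N']
    [FiniteDimensional ℝ V] [T2Space N] {m : ℕ}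
    {Om : DiffForm V' N' (m + 1)} {F : N → N'} {σ : M → N} {x : M}
    {A : V' [⋀^Fin (m + 1)]→L[ℝ] ℝ}
    {e : OpenPartialHomeomorph N V} (he : e ∈ IsManifold.maximalAtlas 𝓘(ℝ, V) ∞ N)
    (hx : σ x ∈ e.source)
    {e' : OpenPartialHomeomorph N' V'} (he' : e' ∈ IsManifold.maximalAtlas 𝓘(ℝ, V') ∞ N')
    (hx' : F (σ x) ∈ e'.source)
    (hOm : Om (F (σ x)) = -A.compContinuousLinearMap (mfderiv 𝓘(ℝ, V') 𝓘(ℝ, V') e' (F (σ x))))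
    (hF : MDifferentiableAt 𝓘(ℝ, V) 𝓘(ℝ, V') F (σ x))
    (hσ : MDifferentiableAt 𝓘(ℝ, V₀) 𝓘(ℝ, V) σ x)
    {b : OpenPartialHomeomorph M (Fin m → ℝ)} (hxb : x ∈ b.source)
    (hb : MDifferentiableAt 𝓘(ℝ, V₀) 𝓘(ℝ, Fin m → ℝ) b x)
    (hbs : MDifferentiableAt 𝓘(ℝ, Fin m → ℝ) 𝓘(ℝ, V₀) b.symm (b x)) :
    (∀ X : ∀ q : N, TangentSpace 𝓘(ℝ, V) q, IsVectorField X →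
      (((Om.pullback F).interior X).pullback σ : DiffForm V₀ M m) x = 0) ↔
    ∀ X : V, A (Matrix.vecCons
      (fderiv ℝ (fun z => e' (F (e.symm z))) (e (σ (b.symm (b x)))) X)
      fun i => fderiv ℝ (fun z => e' (F (e.symm z))) (e (σ (b.symm (b x))))
        (fderiv ℝ (fun z => e (σ (b.symm z))) (b x) (Pi.single i 1))) = 0 := by
  have hbx : b.symm (b x) = x := b.left_inv hxb
  set Φ : V → V' := fun z => e' (F (e.symm z)) with hΦ
  have me : MDifferentiableAt 𝓘(ℝ, V) 𝓘(ℝ, V) e (σ x) :=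
    ((contMDiffOn_of_mem_maximalAtlas he).contMDiffAt
      (e.open_source.mem_nhds hx)).mdifferentiableAt (by simp)
  have mes : MDifferentiableAt 𝓘(ℝ, V) 𝓘(ℝ, V) e.symm (e (σ x)) :=
    ((contMDiffOn_symm_of_mem_maximalAtlas he).contMDiffAt
      (e.open_target.mem_nhds (e.map_source hx))).mdifferentiableAt (by simp)
  have me' : MDifferentiableAt 𝓘(ℝ, V') 𝓘(ℝ, V') e' (F (σ x)) :=
    ((contMDiffOn_of_mem_maximalAtlas he').contMDiffAt
      (e'.open_source.mem_nhds hx')).mdifferentiableAt (by simp)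
  have mΦ : MDifferentiableAt 𝓘(ℝ, V) 𝓘(ℝ, V') Φ (e (σ x)) := by
    refine MDifferentiableAt.comp (g := e') (I' := 𝓘(ℝ, V')) (e (σ x)) ?_
      (MDifferentiableAt.comp (g := F) (I' := 𝓘(ℝ, V)) (e (σ x)) ?_ mes)
    · simpa only [Function.comp_apply, e.left_inv hx] using me'
    · simpa only [e.left_inv hx] using hF
  -- The two charts intertwine the derivative of `F` with that of its local expression `Φ`.
  have f1 : ∀ w : TangentSpace 𝓘(ℝ, V) (σ x), fderiv ℝ Φ (e (σ x))
      (mfderiv 𝓘(ℝ, V) 𝓘(ℝ, V) e (σ x) w) = mfderiv 𝓘(ℝ, V') 𝓘(ℝ, V') e' (F (σ x))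
        (mfderiv 𝓘(ℝ, V) 𝓘(ℝ, V') F (σ x) w) := by
    have h1 : Φ ∘ e =ᶠ[𝓝 (σ x)] e' ∘ F := by
      filter_upwards [e.open_source.mem_nhds hx] with q hq
      simp only [hΦ, Function.comp_apply, e.left_inv hq]
    have h2 := h1.mfderiv_eq (I := 𝓘(ℝ, V)) (I' := 𝓘(ℝ, V'))
    rw [mfderiv_comp (σ x) mΦ me, mfderiv_comp (σ x) me' hF, mfderiv_eq_fderiv] at h2
    exact fun w => congrArg (fun L => L w) h2
  -- The derivative of a chart is onto, so testing on tangent vectors at `σ x` is testing on all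
  -- vectors of the model space. `f4` plays the same role on the base.
  have f2 : ∀ w : V, ∃ v : TangentSpace 𝓘(ℝ, V) (σ x),
      mfderiv 𝓘(ℝ, V) 𝓘(ℝ, V) e (σ x) v = w := by
    have h1 : e ∘ e.symm =ᶠ[𝓝 (e (σ x))] id := by
      filter_upwards [e.open_target.mem_nhds (e.map_source hx)] with q hq
      simp only [Function.comp_apply, e.right_inv hq, id]
    have h2 := h1.mfderiv_eq (I := 𝓘(ℝ, V)) (I' := 𝓘(ℝ, V))
    rw [mfderiv_comp (e (σ x)) (by rwa [e.left_inv hx]) mes, mfderiv_id, e.left_inv hx] at h2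
    intro w
    exact ⟨mfderiv 𝓘(ℝ, V) 𝓘(ℝ, V) e.symm (e (σ x)) w, congrArg (fun L => L w) h2⟩
  have f3 : ∀ w : Fin m → ℝ, fderiv ℝ (fun z => e (σ (b.symm z))) (b x) w =
      mfderiv 𝓘(ℝ, V) 𝓘(ℝ, V) e (σ x) (mfderiv 𝓘(ℝ, V₀) 𝓘(ℝ, V) σ x
        (mfderiv 𝓘(ℝ, Fin m → ℝ) 𝓘(ℝ, V₀) b.symm (b x) w)) := by
    intro w
    have e1 := hasMFDerivAt_of_eq hbx hσ
    have e2 := hasMFDerivAt_of_eq (congrArg σ hbx) me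
    have h1 := HasMFDerivAt.comp (b x) e1 hbs.hasMFDerivAt
    have h2 := HasMFDerivAt.comp (b x) e2 h1
    have h3 := h2.mfderiv
    rw [mfderiv_eq_fderiv] at h3
    exact congrArg (fun L => L w) h3
  have f4 : ∀ v : TangentSpace 𝓘(ℝ, V₀) x, ∃ w : Fin m → ℝ,
      mfderiv 𝓘(ℝ, Fin m → ℝ) 𝓘(ℝ, V₀) b.symm (b x) w = v := by
    have h1 : b.symm ∘ b =ᶠ[𝓝 x] id := by
      filter_upwards [b.open_source.mem_nhds hxb] with q hq
      simp only [Function.comp_apply, b.left_inv hq, id]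
    have h2 := h1.mfderiv_eq (I := 𝓘(ℝ, V₀)) (I' := 𝓘(ℝ, V₀))
    rw [mfderiv_comp x hbs hb, mfderiv_id] at h2
    intro v
    exact ⟨mfderiv 𝓘(ℝ, V₀) 𝓘(ℝ, Fin m → ℝ) b x v, congrArg (fun L => L v) h2⟩
  rw [hbx]
  -- On images of vectors of `ℝ^m` the pulled-back form is minus the local expression, for every
  -- vector field, and depends on it only through its value at `σ x`.
  have key : ∀ (X : ∀ q : N, TangentSpace 𝓘(ℝ, V) q) (w : Fin m → Fin m → ℝ),
      (((Om.pullback F).interior X).pullback σ : DiffForm V₀ M m) x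
        (fun i => mfderiv 𝓘(ℝ, Fin m → ℝ) 𝓘(ℝ, V₀) b.symm (b x) (w i)) =
      -A (Matrix.vecCons (fderiv ℝ Φ (e (σ x)) (mfderiv 𝓘(ℝ, V) 𝓘(ℝ, V) e (σ x) (X (σ x))))
        fun i => fderiv ℝ Φ (e (σ x)) (fderiv ℝ (fun z => e (σ (b.symm z))) (b x) (w i))) := by
    intro X w
    simp only [f3, f1]
    change Om (F (σ x)) _ = _
    rw [hOm]
    change -A _ = -A _
    congr 2
    funext i
    refine Fin.cases rfl (fun i => rfl) i
  constructor
  · intro h w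
    obtain ⟨v, rfl⟩ := f2 w
    -- The global quantifier over vector fields becomes pointwise here, since any vector at `σ x` is
    -- the value of one.
    obtain ⟨X, hX, rfl⟩ := exists_isVectorField (σ x) v
    have := key X fun i => Pi.single i 1
    rw [h X hX] at this
    exact neg_eq_zero.1 this.symm
  · intro h X _
    -- A form of degree `m` on `ℝ^m` vanishes as soon as it vanishes on the standard basis;
    -- surjectivity of the derivative of `b.symm` then covers all tangent vectors of the base.
    have h0 : ((((Om.pullback F).interior X).pullback σ :
        DiffForm V₀ M m) x).compContinuousLinearMap
        (mfderiv 𝓘(ℝ, Fin m → ℝ) 𝓘(ℝ, V₀) b.symm (b x)) = 0 := by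
      apply ContinuousAlternatingMap.toAlternatingMap_injective
      refine (AlternatingMap.map_basis_eq_zero_iff (Pi.basisFun ℝ (Fin m)) _).1 ?_
      have h1 := (key X fun i => Pi.single i 1).trans (neg_eq_zero.2 (h _))
      refine Eq.trans ?_ h1
      have h2 : ⇑(Pi.basisFun ℝ (Fin m)) = fun i => Pi.single i 1 :=
        funext fun i => Pi.basisFun_apply ℝ (Fin m) i
      rw [h2]
      rfl
    ext v
    choose w hw using fun i => f4 (v i)
    have h1 := congrArg (fun B => B w) h0
    have h2 : v = fun i => mfderiv 𝓘(ℝ, Fin m → ℝ) 𝓘(ℝ, V₀) b.symm (b x) (w i) :=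
      funext fun i => (hw i).symm
    rw [h2]
    exact h1

end Manifolds

/-! ### Smoothness and separation from charts -/

section ChartLemmas

variable {V : Type*} [NormedAddCommGroup V] [NormedSpace ℝ V]
  {N : Type*} [TopologicalSpace N] [ChartedSpace V N]
  {V' : Type*} [NormedAddCommGroup V'] [NormedSpace ℝ V']
  {N' : Type*} [TopologicalSpace N'] [ChartedSpace V' N']

/-- Near `p` the map is the composite of a chart, the smooth local expression `G` and an inverse
chart. That values stay in the second chart near `p` is part of the hypothesis, so no continuity is
assumed beforehand. -/
lemma contMDiffAt_of_chart [IsManifold 𝓘(ℝ, V) ∞ N] [IsManifold 𝓘(ℝ, V') ∞ N'] {f : N → N'} {p : N}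
    {e : OpenPartialHomeomorph N V} (he : e ∈ IsManifold.maximalAtlas 𝓘(ℝ, V) ∞ N)
    {e' : OpenPartialHomeomorph N' V'} (he' : e' ∈ IsManifold.maximalAtlas 𝓘(ℝ, V') ∞ N')
    (hp : p ∈ e.source) {G : V → V'} (hG : ContDiffAt ℝ ∞ G (e p))
    (h : ∀ᶠ q in 𝓝 p, f q ∈ e'.source ∧ e' (f q) = G (e q)) :
    ContMDiffAt 𝓘(ℝ, V) 𝓘(ℝ, V') ∞ f p := by
  have h1 : f =ᶠ[𝓝 p] fun q => e'.symm (G (e q)) := by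
    filter_upwards [h] with q hq
    rw [← hq.2, e'.left_inv hq.1]
  refine ContMDiffAt.congr_of_eventuallyEq ?_ h1
  have h2 := h.self_of_nhds
  have h3 : G (e p) ∈ e'.target := h2.2 ▸ e'.map_source h2.1
  exact ((contMDiffOn_symm_of_mem_maximalAtlas he').contMDiffAt
      (e'.open_target.mem_nhds h3)).comp p (hG.contMDiffAt.comp p
    ((contMDiffOn_of_mem_maximalAtlas he).contMDiffAt (e.open_source.mem_nhds hp)))

/-- Points with different images are separated by preimages. Points with the same image lie in a
common chart, which is injective, and are separated there. -/
lemma t2Space_of_charts {N V Y : Type*} [TopologicalSpace N] [TopologicalSpace V] [T2Space V]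
    [TopologicalSpace Y] [T2Space Y] {t : N → Y} (ht : Continuous t)
    (h : ∀ p, ∃ e : OpenPartialHomeomorph N V, ∀ q, t q = t p → q ∈ e.source) : T2Space N := by
  refine ⟨fun p q hpq => ?_⟩
  by_cases htpq : t q = t p
  · obtain ⟨e, he⟩ := h p
    have hp := he p rfl
    have hq := he q htpq
    obtain ⟨u, v, hu, hv, hpu, hqv, huv⟩ := t2_separation fun h' => hpq (e.injOn hp hq h')
    refine ⟨_, _, e.isOpen_inter_preimage hu, e.isOpen_inter_preimage hv, ⟨hp, hpu⟩, ⟨hq, hqv⟩, ?_⟩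
    exact Set.disjoint_left.2 fun a ha ha' => Set.disjoint_left.1 huv ha.2 ha'.2
  · obtain ⟨u, v, hu, hv, hpu, hqv, huv⟩ := t2_separation fun h' => htpq h'.symm
    exact ⟨_, _, hu.preimage ht, hv.preimage ht, hpu, hqv, huv.preimage t⟩

end ChartLemmas

/-! ### The natural charts, and the Liouville form in them -/

section NaturalCharts

variable {m n : ℕ} {B : FieldBundle m n}

namespace AdaptedChart

variable (c : B.Chart)

/-- The natural chart of `J^kπ`, as a chart of the manifold. -/
def jetOpenChart (k : ℕ) : OpenPartialHomeomorph (Jet B k) (JetModel m n k) :=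
  (jetCharts B k).ofIndex c

/-- The natural chart of `J²π†`, as a chart of the manifold. -/
def extMomOpenChart :
    OpenPartialHomeomorph (ExtMom B) (JetModel m n 1 × ExtMomModel m n) :=
  (extMomCharts B).ofIndex c

/-- The natural chart of `J²π‡`, as a chart of the manifold. -/
def restMomOpenChart :
    OpenPartialHomeomorph (RestMom B) (JetModel m n 1 × RestMomModel m n) :=
  (restMomCharts B).ofIndex c

/-- The natural chart of `𝒲_r`, as a chart of the manifold. -/
def restUnifiedOpenChart :
    OpenPartialHomeomorph (RestUnified B) (JetModel m n 3 × RestMomModel m n) :=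
  (restUnifiedCharts B).ofIndex c

lemma jetOpenChart_mem (k : ℕ) : c.jetOpenChart k ∈
    IsManifold.maximalAtlas 𝓘(ℝ, JetModel m n k) ∞ (Jet B k) :=
  IsManifold.subset_maximalAtlas ((jetCharts B k).ofIndex_mem_atlas c)

lemma extMomOpenChart_mem : c.extMomOpenChart ∈
    IsManifold.maximalAtlas 𝓘(ℝ, JetModel m n 1 × ExtMomModel m n) ∞ (ExtMom B) :=
  IsManifold.subset_maximalAtlas ((extMomCharts B).ofIndex_mem_atlas c)

lemma restMomOpenChart_mem : c.restMomOpenChart ∈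
    IsManifold.maximalAtlas 𝓘(ℝ, JetModel m n 1 × RestMomModel m n) ∞ (RestMom B) :=
  IsManifold.subset_maximalAtlas ((restMomCharts B).ofIndex_mem_atlas c)

lemma restUnifiedOpenChart_mem : c.restUnifiedOpenChart ∈
    IsManifold.maximalAtlas 𝓘(ℝ, JetModel m n 3 × RestMomModel m n) ∞ (RestUnified B) :=
  IsManifold.subset_maximalAtlas ((restUnifiedCharts B).ofIndex_mem_atlas c)

lemma jetOpenChart_apply {k : ℕ} (j : Jet B k) : c.jetOpenChart k j = c.jetCoord j := rfl

lemma mem_jetOpenChart_source {k : ℕ} {j : Jet B k} :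
    j ∈ (c.jetOpenChart k).source ↔ j.target ∈ c.total.source := Iff.rfl

lemma mem_extMomOpenChart_source {z : ExtMom B} :
    z ∈ c.extMomOpenChart.source ↔ z.1.target ∈ c.total.source := Iff.rfl

lemma mem_restMomOpenChart_source {z : RestMom B} :
    z ∈ c.restMomOpenChart.source ↔ z.1.target ∈ c.total.source := Iff.rfl

lemma mem_restUnifiedOpenChart_source {z : RestUnified B} :
    z ∈ c.restUnifiedOpenChart.source ↔ z.1.target ∈ c.total.source := Iff.rfl

end AdaptedChart

/-- The coordinates of the target in `E` are among the natural coordinates of the jet, so the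
projection is a composite of charts with a linear projection. -/
lemma Jet.continuous_target {k : ℕ} : Continuous (Jet.target : Jet B k → B.E) := by
  rw [continuous_iff_continuousAt]
  intro j
  obtain ⟨c, hc⟩ := B.exists_chart j.target
  have h1 : (Jet.target : Jet B k → B.E) =ᶠ[𝓝 j] fun i =>
      c.total.symm ((c.jetOpenChart k i).1, (c.jetOpenChart k i).2 (.zero m k)) := by
    filter_upwards [(c.jetOpenChart k).open_source.mem_nhds
      (c.mem_jetOpenChart_source.2 hc)] with i hi
    rw [c.jetOpenChart_apply, AdaptedChart.jetCoord_mem hi, c.total.left_inv hi]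
  refine ContinuousAt.congr ?_ h1.symm
  have h2 : ContinuousAt (c.jetOpenChart k) j :=
    (c.jetOpenChart k).continuousAt (c.mem_jetOpenChart_source.2 hc)
  have h3 : ContinuousAt c.total.symm
      ((c.jetOpenChart k j).1, (c.jetOpenChart k j).2 (.zero m k)) :=
    c.total.continuousAt_symm (AdaptedChart.jetCoord_mem_target hc)
  exact ContinuousAt.comp (f := fun i =>
    ((c.jetOpenChart k i).1, (c.jetOpenChart k i).2 (.zero m k))) h3
    (ContinuousAt.comp (g := fun v : JetModel m n k => (v.1, v.2 (.zero m k)))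
      (by fun_prop) h2)

lemma contMDiff_extMomProj : ContMDiff 𝓘(ℝ, JetModel m n 1 × ExtMomModel m n)
    𝓘(ℝ, JetModel m n 1) ∞ (ExtMom.proj : ExtMom B → Jet B 1) := by
  intro z
  obtain ⟨c, hc⟩ := B.exists_chart z.1.target
  refine contMDiffAt_of_chart c.extMomOpenChart_mem (c.jetOpenChart_mem 1)
    (c.mem_extMomOpenChart_source.2 hc) (G := Prod.fst) contDiffAt_fst ?_
  filter_upwards [c.extMomOpenChart.open_source.mem_nhds
    (c.mem_extMomOpenChart_source.2 hc)] with q hq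
  exact ⟨hq, rfl⟩

lemma contMDiff_restMomProj : ContMDiff 𝓘(ℝ, JetModel m n 1 × RestMomModel m n)
    𝓘(ℝ, JetModel m n 1) ∞ (RestMom.proj : RestMom B → Jet B 1) := by
  intro z
  obtain ⟨c, hc⟩ := B.exists_chart z.1.target
  refine contMDiffAt_of_chart c.restMomOpenChart_mem (c.jetOpenChart_mem 1)
    (c.mem_restMomOpenChart_source.2 hc) (G := Prod.fst) contDiffAt_fst ?_
  filter_upwards [c.restMomOpenChart.open_source.mem_nhds
    (c.mem_restMomOpenChart_source.2 hc)] with q hq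
  exact ⟨hq, rfl⟩

lemma contMDiff_rho1 : ContMDiff 𝓘(ℝ, JetModel m n 3 × RestMomModel m n)
    𝓘(ℝ, JetModel m n 3) ∞ (RestUnified.rho1 : RestUnified B → Jet B 3) := by
  intro z
  obtain ⟨c, hc⟩ := B.exists_chart z.1.target
  refine contMDiffAt_of_chart c.restUnifiedOpenChart_mem (c.jetOpenChart_mem 3)
    (c.mem_restUnifiedOpenChart_source.2 hc) (G := Prod.fst) contDiffAt_fst ?_
  filter_upwards [c.restUnifiedOpenChart.open_source.mem_nhds
    (c.mem_restUnifiedOpenChart_source.2 hc)] with q hq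
  exact ⟨hq, rfl⟩

/-- The projection to the multimomentum bundle keeps the momenta and truncates the jet to order one;
this local form gives its smoothness. -/
lemma restMomOpenChart_rho2 (c : B.Chart) {z : RestUnified B} (hz : z.1.target ∈ c.total.source) :
    c.restMomOpenChart z.rho2 = (truncModel 1 (by norm_num) (c.restUnifiedOpenChart z).1,
      (c.restUnifiedOpenChart z).2) :=
  Prod.ext (c.jetCoord_trunc 1 (by norm_num) hz) rfl

lemma contMDiff_rho2 : ContMDiff 𝓘(ℝ, JetModel m n 3 × RestMomModel m n)
    𝓘(ℝ, JetModel m n 1 × RestMomModel m n) ∞ (RestUnified.rho2 : RestUnified B → RestMom B) := by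
  intro z
  obtain ⟨c, hc⟩ := B.exists_chart z.1.target
  refine contMDiffAt_of_chart c.restUnifiedOpenChart_mem c.restMomOpenChart_mem
    (c.mem_restUnifiedOpenChart_source.2 hc)
    (G := fun v => (truncModel 1 (by norm_num) v.1, v.2))
    (((contDiff_truncModel 1 (by norm_num)).comp contDiff_fst).prodMk contDiff_snd).contDiffAt ?_
  filter_upwards [c.restUnifiedOpenChart.open_source.mem_nhds
    (c.mem_restUnifiedOpenChart_source.2 hc)] with q hq
  exact ⟨(congrArg (· ∈ c.total.source) (Jet.target_trunc 1 (by norm_num) q.1)).mpr hq,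
    restMomOpenChart_rho2 c hq⟩

/-- Separation is what the cut-off in `exists_isVectorField` needs. A natural chart contains whole
fibres over points of `E`, and `E` is Hausdorff, so `t2Space_of_charts` applies. -/
instance : T2Space (RestMom B) := by
  refine t2Space_of_charts (V := JetModel m n 1 × RestMomModel m n)
    (t := fun z : RestMom B => z.proj.target)
    (Jet.continuous_target.comp contMDiff_restMomProj.continuous) fun p => ?_
  obtain ⟨c, hc⟩ := B.exists_chart p.proj.target
  refine ⟨c.restMomOpenChart, fun q hq => ?_⟩
  rw [c.mem_restMomOpenChart_source]
  change q.proj.target ∈ _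
  rw [hq]
  exact hc

instance : T2Space (RestUnified B) := by
  refine t2Space_of_charts (V := JetModel m n 3 × RestMomModel m n)
    (t := fun z : RestUnified B => z.rho1.target)
    (Jet.continuous_target.comp contMDiff_rho1.continuous) fun p => ?_
  obtain ⟨c, hc⟩ := B.exists_chart p.rho1.target
  refine ⟨c.restUnifiedOpenChart, fun q hq => ?_⟩
  rw [c.mem_restUnifiedOpenChart_source]
  change q.rho1.target ∈ _
  rw [hq]
  exact hc

lemma mdifferentiableAt_extMomOpenChart (c : B.Chart) {z : ExtMom B}
    (hz : z.1.target ∈ c.total.source) :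
    MDifferentiableAt 𝓘(ℝ, JetModel m n 1 × ExtMomModel m n)
      𝓘(ℝ, JetModel m n 1 × ExtMomModel m n) c.extMomOpenChart z :=
  ((contMDiffOn_of_mem_maximalAtlas c.extMomOpenChart_mem).contMDiffAt
    (c.extMomOpenChart.open_source.mem_nhds
      (c.mem_extMomOpenChart_source.2 hz))).mdifferentiableAt (by simp)

/-- The Liouville form in natural coordinates. -/
lemma liouvilleForm_eq (c : B.Chart) {z : ExtMom B} (hz : z.1.target ∈ c.total.source) :
    liouvilleForm B z = (tautForm m n (c.extMomOpenChart z)).compContinuousLinearMap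
      (mfderiv 𝓘(ℝ, JetModel m n 1 × ExtMomModel m n)
        𝓘(ℝ, JetModel m n 1 × ExtMomModel m n) c.extMomOpenChart z) := by
  have h1 : MDifferentiableAt 𝓘(ℝ, JetModel m n 1) 𝓘(ℝ, JetModel m n 1) (c.jetChart 1) z.1 :=
    AdaptedChart.jetChart_mdifferentiable.mdifferentiableAt (x := z.1) hz
  have h2 : MDifferentiableAt 𝓘(ℝ, JetModel m n 1 × ExtMomModel m n) 𝓘(ℝ, JetModel m n 1)
      ExtMom.proj z := (contMDiff_extMomProj z).mdifferentiableAt (by simp)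
  have h3 := mdifferentiableAt_extMomOpenChart c hz
  have h4 := mfderiv_comp z (g := c.jetChart 1) h1 h2
  have h5 := mfderiv_comp z (I'' := 𝓘(ℝ, JetModel m n 1))
    (g := (Prod.fst : JetModel m n 1 × ExtMomModel m n → JetModel m n 1))
    (differentiableAt_fst.mdifferentiableAt) h3
  -- The jet coordinates of the projection are the first component of the natural coordinates of
  -- `J²π†`; this one map is differentiated in two ways.
  have h6 := h4.symm.trans h5
  have hinv := AdaptedChart.isInvertible_jetDeriv (c := c) hz
  have hloc : JetForm.ofCoord (c.extCoord z.1 z.2) = c.localForm z.1 z.2 :=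
    JetForm.ofCoord_coord ((mem_symMom_iff c hz).1 z.2.2)
  ext v
  have h7 : ∀ w : TangentSpace 𝓘(ℝ, JetModel m n 1 × ExtMomModel m n) z,
      c.jetDeriv z.1 (mfderiv 𝓘(ℝ, JetModel m n 1 × ExtMomModel m n)
        𝓘(ℝ, JetModel m n 1) ExtMom.proj z w) =
      (mfderiv 𝓘(ℝ, JetModel m n 1 × ExtMomModel m n)
        𝓘(ℝ, JetModel m n 1 × ExtMomModel m n) c.extMomOpenChart z w :
        JetModel m n 1 × ExtMomModel m n).1 := by
    intro w
    have h8 := congrArg (fun L => L w) h6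
    rw [mfderiv_eq_fderiv, fderiv_fst] at h8
    exact h8
  have h9 : ∀ i, (c.jetDeriv z.1).inverse
      (mfderiv 𝓘(ℝ, JetModel m n 1 × ExtMomModel m n)
        𝓘(ℝ, JetModel m n 1 × ExtMomModel m n) c.extMomOpenChart z (v i) :
        JetModel m n 1 × ExtMomModel m n).1 = mfderiv 𝓘(ℝ, JetModel m n 1 × ExtMomModel m n)
        𝓘(ℝ, JetModel m n 1) ExtMom.proj z (v i) := fun i =>
    (congrArg (c.jetDeriv z.1).inverse (h7 (v i)).symm).trans (hinv.inverse_apply_self _)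
  -- The form `z` is recovered from its coordinates, so its local expression on these vectors is its
  -- value on their projections to `J¹π`.
  have h10 := congrArg (fun θ : JetForm m n => θ fun i =>
    (mfderiv 𝓘(ℝ, JetModel m n 1 × ExtMomModel m n)
        𝓘(ℝ, JetModel m n 1 × ExtMomModel m n) c.extMomOpenChart z (v i) :
        JetModel m n 1 × ExtMomModel m n).1) hloc
  refine Eq.trans ?_ h10.symm
  exact congrArg z.2.1 (funext fun i => (h9 i).symm)

/-- The multisymplectic form in natural coordinates. -/
lemma multisymplecticForm_eq (c : B.Chart) {z : ExtMom B} (hz : z.1.target ∈ c.total.source) :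
    multisymplecticForm B z = -(dTaut m n).compContinuousLinearMap
      (mfderiv 𝓘(ℝ, JetModel m n 1 × ExtMomModel m n)
        𝓘(ℝ, JetModel m n 1 × ExtMomModel m n) c.extMomOpenChart z) := by
  rw [multisymplecticForm, DiffForm.d_eq_of_chart (liouvilleForm B) c.extMomOpenChart_mem
    (c.mem_extMomOpenChart_source.2 hz) (tautForm m n).differentiableAt
    (fun q hq => liouvilleForm_eq c hq), extDeriv_tautForm]

end NaturalCharts

/-! ### Smoothness of the local Lagrangian function -/

section Lagrangian

variable {m n : ℕ} {B : FieldBundle m n}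

lemma AdaptedChart.mdifferentiableAt_base (c : B.Chart) {x : B.M} (hx : x ∈ c.base.source) :
    MDifferentiableAt (𝓡 m) 𝓘(ℝ, Fin m → ℝ) c.base x :=
  ((c.base_smooth _ hx).contMDiffAt (c.base.open_source.mem_nhds hx)).mdifferentiableAt (by simp)

lemma AdaptedChart.mdifferentiableAt_base_symm (c : B.Chart) {y : Fin m → ℝ}
    (hy : y ∈ c.base.target) : MDifferentiableAt 𝓘(ℝ, Fin m → ℝ) (𝓡 m) c.base.symm y :=
  ((c.base_symm_smooth _ hy).contMDiffAt
    (c.base.open_target.mem_nhds hy)).mdifferentiableAt (by simp)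

lemma AdaptedChart.surjective_mfderiv_base_symm (c : B.Chart) {y : Fin m → ℝ}
    (hy : y ∈ c.base.target) :
    Function.Surjective (mfderiv 𝓘(ℝ, Fin m → ℝ) (𝓡 m) c.base.symm y) := by
  intro v
  have hx := c.base.map_target hy
  have h1 := c.mdifferentiableAt_base hx
  have h2 : HasMFDerivAt 𝓘(ℝ, Fin m → ℝ) (𝓡 m) c.base.symm (c.base (c.base.symm y))
      (mfderiv 𝓘(ℝ, Fin m → ℝ) (𝓡 m) c.base.symm y :
        (Fin m → ℝ) →L[ℝ] EuclideanSpace ℝ (Fin m)) :=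
    hasMFDerivAt_of_eq (c.base.right_inv hy) (c.mdifferentiableAt_base_symm hy)
  have h3 := h2.comp (c.base.symm y) h1.hasMFDerivAt
  have h4 : c.base.symm ∘ c.base =ᶠ[𝓝 (c.base.symm y)] id := by
    filter_upwards [c.base.open_source.mem_nhds hx] with z hz using c.base.left_inv hz
  have h5 := (h3.congr_of_eventuallyEq h4.symm).mfderiv
  rw [mfderiv_id] at h5
  refine ⟨mfderiv (𝓡 m) 𝓘(ℝ, Fin m → ℝ) c.base (c.base.symm y) v, ?_⟩
  exact (congrArg (fun L => L v) h5).symm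

/-- Forms of top degree are equal if they agree on the image of the standard basis. -/
lemma topForm_ext {V : Type*} [NormedAddCommGroup V] [NormedSpace ℝ V]
    {L : (Fin m → ℝ) →L[ℝ] V} (hL : Function.Surjective L) {a b : V [⋀^Fin m]→L[ℝ] ℝ}
    (h : a (fun i => L (Pi.single i 1)) = b fun i => L (Pi.single i 1)) : a = b := by
  have h1 : ((a - b).compContinuousLinearMap L).toAlternatingMap (Pi.basisFun ℝ (Fin m)) = 0 := by
    change a _ - b _ = 0
    rw [sub_eq_zero]
    simpa [Function.comp_def] using h
  rw [AlternatingMap.map_basis_eq_zero_iff] at h1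
  rw [← sub_eq_zero]
  ext v
  choose g hg using hL
  have h2 := congrArg (fun θ => θ fun i => g (v i)) h1
  have h3 : (a - b) (fun i => L (g (v i))) = 0 := h2
  simp only [hg] at h3
  exact h3

/-- Smoothness of the volume form is given in the preferred charts only. The coefficient in an
adapted chart is the preferred expression, composed with the transition map `g` and evaluated on the
columns of its derivative. -/
lemma contDiffAt_volumeCoeff (η : VolumeForm B) (c : B.Chart) {y : Fin m → ℝ}
    (hy : y ∈ c.base.target) : ContDiffAt ℝ ∞ (volumeCoeff η c) y := by
  set p := c.base.symm y with hp
  set e := chartAt (EuclideanSpace ℝ (Fin m)) p with he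
  have hpe : p ∈ e.source := mem_chart_source _ p
  have hem : e ∈ IsManifold.maximalAtlas (𝓡 m) ∞ B.M := IsManifold.chart_mem_maximalAtlas p
  set g : (Fin m → ℝ) → EuclideanSpace ℝ (Fin m) := fun z => e (c.base.symm z) with hg
  have hbs : ∀ z ∈ c.base.target, ContMDiffAt 𝓘(ℝ, Fin m → ℝ) (𝓡 m) ∞ c.base.symm z :=
    fun z hz => (c.base_symm_smooth _ hz).contMDiffAt (c.base.open_target.mem_nhds hz)
  have hnear : ∀ᶠ z in 𝓝 y, z ∈ c.base.target ∧ c.base.symm z ∈ e.source :=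
    (c.base.open_target.mem_nhds hy |> Filter.Eventually.and <|
      (hbs y hy).continuousAt (e.open_source.mem_nhds hpe))
  have hgs : ContDiffAt ℝ ∞ g y := by
    rw [← contMDiffAt_iff_contDiffAt]
    exact ((contMDiffOn_of_mem_maximalAtlas hem).contMDiffAt
      (e.open_source.mem_nhds hpe)).comp y (hbs y hy)
  have hφ : ContDiffAt ℝ ∞ (η.form.inChart p) (g y) :=
    (η.isSmooth p).contDiffAt (e.open_target.mem_nhds (e.map_source hpe))
  have key : volumeCoeff η c =ᶠ[𝓝 y] fun z =>
      η.form.inChart p (g z) fun i => fderiv ℝ g z (Pi.single i 1) := by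
    filter_upwards [hnear] with z hz
    have h1 : MDifferentiableAt 𝓘(ℝ, EuclideanSpace ℝ (Fin m)) (𝓡 m) e.symm (g z) :=
      ((contMDiffOn_symm_of_mem_maximalAtlas hem).contMDiffAt
        (e.open_target.mem_nhds (e.map_source hz.2))).mdifferentiableAt (by simp)
    have h2 : MDifferentiableAt 𝓘(ℝ, Fin m → ℝ) 𝓘(ℝ, EuclideanSpace ℝ (Fin m)) g z :=
      (((contMDiffOn_of_mem_maximalAtlas hem).contMDiffAt
        (e.open_source.mem_nhds hz.2)).comp z (hbs z hz.1)).mdifferentiableAt (by simp)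
    have h3 := (h1.hasMFDerivAt.comp z h2.hasMFDerivAt)
    have h4 : c.base.symm =ᶠ[𝓝 z] e.symm ∘ g := by
      filter_upwards [(hbs z hz.1).continuousAt (e.open_source.mem_nhds hz.2)] with w hw
      exact (e.left_inv hw).symm
    have h5 := (h3.congr_of_eventuallyEq h4).mfderiv
    have h6 : ∀ q q' : B.M, q = q' → ∀ v : Fin m → EuclideanSpace ℝ (Fin m),
        (η.form q : EuclideanSpace ℝ (Fin m) [⋀^Fin m]→L[ℝ] ℝ) v =
        (η.form q' : EuclideanSpace ℝ (Fin m) [⋀^Fin m]→L[ℝ] ℝ) v := by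
      rintro q _ rfl v; rfl
    have h7 : ∀ i : Fin m, (mfderiv 𝓘(ℝ, Fin m → ℝ) (𝓡 m) c.base.symm z
        (Pi.single i 1 : Fin m → ℝ) : EuclideanSpace ℝ (Fin m)) =
        mfderiv 𝓘(ℝ, EuclideanSpace ℝ (Fin m)) (𝓡 m) e.symm (g z)
          (fderiv ℝ g z (Pi.single i 1)) := by
      intro i
      rw [← mfderiv_eq_fderiv]
      exact congrArg (fun L => L (Pi.single i 1 : Fin m → ℝ)) h5
    refine (h6 _ _ (e.left_inv hz.2).symm _).trans ?_
    exact congrArg (η.form (e.symm (g z)) :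
      EuclideanSpace ℝ (Fin m) [⋀^Fin m]→L[ℝ] ℝ) (funext h7)
  refine ContDiffAt.congr_of_eventuallyEq ?_ key
  have h8 : ContDiffAt ℝ ∞ (fun z => ((ContinuousAlternatingMap.toContinuousMultilinearMapCLM ℝ
      (η.form.inChart p (g z)), fun i => fderiv ℝ g z (Pi.single i 1)) :
      (ContinuousMultilinearMap ℝ (fun _ : Fin m => EuclideanSpace ℝ (Fin m)) ℝ) ×
        (Fin m → EuclideanSpace ℝ (Fin m)))) y := by
    refine ContDiffAt.prodMk ?_ (contDiffAt_pi.2 fun i => ?_)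
    · exact (ContinuousLinearMap.contDiff _).contDiffAt.comp y (hφ.comp y hgs)
    · exact (hgs.fderiv_right (m := ∞) (by simp)).clm_apply contDiffAt_const
  -- Evaluation of a multilinear map is analytic jointly in the map and its arguments; this is why
  -- the form is viewed as a multilinear map in `h8`.
  exact ((ContinuousLinearMap.id ℝ (ContinuousMultilinearMap ℝ
    (fun _ : Fin m => EuclideanSpace ℝ (Fin m))
      ℝ)).analyticAt_uncurry_of_multilinear.contDiffAt).comp y h8

lemma contDiffAt_localLagrangian (η : VolumeForm B) {L : Jet B 2 → ℝ}
    (hL : ContMDiff 𝓘(ℝ, JetModel m n 2) 𝓘(ℝ, ℝ) ∞ L) (c : B.Chart) {v : JetModel m n 2}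
    (hv : (v.1, v.2 (.zero m 2)) ∈ c.total.target) :
    ContDiffAt ℝ ∞ (localLagrangian η L c) v := by
  refine ContDiffAt.mul (f := fun v => L ((c.jetChart 2).symm v)) ?_
    ((contDiffAt_volumeCoeff η c (c.base_symm_proj hv).1).comp v contDiffAt_fst)
  rw [← contMDiffAt_iff_contDiffAt]
  exact (hL _).comp v ((contMDiffOn_symm_of_mem_maximalAtlas (c.jetOpenChart_mem 2)).contMDiffAt
    ((c.jetOpenChart 2).open_target.mem_nhds hv))

end Lagrangian

/-! ### Prolongations of sections -/

section Prolongation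

variable {m n : ℕ} {B : FieldBundle m n}

/-- Partial derivatives commute, and the list `j :: dirs I` is a permutation of the list of
directions of `I + 1_j`. -/
lemma pderiv_mpderiv {W : Type*} [NormedAddCommGroup W] [NormedSpace ℝ W]
    {f : (Fin m → ℝ) → W} {y : Fin m → ℝ} (hf : ContDiffAt ℝ ∞ f y) (I : Fin m → ℕ) (j : Fin m) :
    pderiv j (mpderiv I f) y = mpderiv (I + Pi.single j 1) f y := by
  refine (lderiv_perm (l := j :: dirs I) ?_ hf).self_of_nhds
  rw [List.perm_iff_count]
  intro a
  rw [count_dirs, List.count_cons, count_dirs]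
  by_cases h : j = a
  · subst h; simp
  · simp [h]

lemma IsSectionNear.eventually {φ : B.M → B.E} {x : B.M} (hφ : IsSectionNear B φ x) :
    ∀ᶠ z in 𝓝 x, IsSectionNear B φ z := by
  obtain ⟨U, hU, hx, h⟩ := hφ
  filter_upwards [hU.mem_nhds hx] with z hz using ⟨U, hU, hz, h⟩

lemma jetCoord_prolong (c : B.Chart) {k : ℕ} {φ : B.M → B.E} {x : B.M} (hφ : IsSectionNear B φ x)
    (hx : φ x ∈ c.total.source) (a : Jet B k) :
    c.jetCoord (prolong k φ a x) = (c.base x, fun I => mpderiv I.1 (c.localRep φ) (c.base x)) := by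
  rw [prolong, dif_pos hφ]
  exact c.jetCoord_mk _ hx

lemma target_prolong {k : ℕ} {φ : B.M → B.E} {x : B.M} (hφ : IsSectionNear B φ x) (a : Jet B k) :
    (prolong k φ a x).target = φ x := by
  rw [prolong, dif_pos hφ]
  rfl

/-- The prolongation of a section in natural coordinates. -/
lemma eventually_prolong (c : B.Chart) {k : ℕ} {φ : B.M → B.E} {x : B.M}
    (hφ : IsSectionNear B φ x) (hx : φ x ∈ c.total.source) (a : Jet B k) :
    ∀ᶠ z in 𝓝 x, (prolong k φ a z).target ∈ c.total.source ∧
      c.jetCoord (prolong k φ a z) =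
        (c.base z, fun I => mpderiv I.1 (c.localRep φ) (c.base z)) := by
  filter_upwards [hφ.eventually, AdaptedChart.eventually_localRep hφ hx] with z hz hz'
  exact ⟨(target_prolong hz a).symm ▸ hz'.2.1, jetCoord_prolong c hz hz'.2.1 a⟩

lemma contDiffAt_mpderiv_localRep (c : B.Chart) {φ : B.M → B.E} {x : B.M}
    (hφ : IsSectionNear B φ x) (hx : φ x ∈ c.total.source) (k : ℕ) :
    ContDiffAt ℝ ∞ (fun y => ((y, fun I : MultiIndexLE m k => mpderiv I.1 (c.localRep φ) y) :
      JetModel m n k)) (c.base x) :=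
  contDiffAt_id.prodMk (contDiffAt_pi.2 fun I =>
    ContDiffAt.lderiv' (dirs I.1) (AdaptedChart.contDiffAt_localRep hφ hx))

/-- Along a prolongation the derivative of `u_I` in the direction `j` is `u_{I+1_j}`. This serves
both for the coupling and for the holonomy condition of `eq_legendreCoord`. -/
lemma fderiv_mpderiv_localRep (c : B.Chart) {φ : B.M → B.E} {x : B.M}
    (hφ : IsSectionNear B φ x) (hx : φ x ∈ c.total.source) (k : ℕ) (j : Fin m) :
    fderiv ℝ (fun y => ((y, fun I : MultiIndexLE m k => mpderiv I.1 (c.localRep φ) y) :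
      JetModel m n k)) (c.base x) (Pi.single j 1) =
    (Pi.single j 1, fun I => mpderiv (I.1 + Pi.single j 1) (c.localRep φ) (c.base x)) := by
  have h1 := (contDiffAt_mpderiv_localRep c hφ hx k).differentiableAt (by simp)
  have hf := AdaptedChart.contDiffAt_localRep hφ hx
  have h2 : ∀ I : MultiIndexLE m k, DifferentiableAt ℝ (mpderiv I.1 (c.localRep φ)) (c.base x) :=
    fun I => (ContDiffAt.lderiv' (dirs I.1) hf).differentiableAt (by simp)
  have h3 := (hasFDerivAt_id (𝕜 := ℝ) (c.base x)).prodMk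
    (hasFDerivAt_pi.2 fun I => (h2 I).hasFDerivAt)
  have h4 := h3.fderiv
  refine (congrArg (fun L => L (Pi.single j 1)) h4).trans ?_
  refine Prod.ext rfl (funext fun I => ?_)
  exact pderiv_mpderiv hf I.1 j

/-- Near `x` the prolongation is the inverse natural chart applied to the partial derivatives of the
local expression, so its fallback value plays no role. -/
lemma contMDiffAt_prolong {k : ℕ} {φ : B.M → B.E} {x : B.M} (hφ : IsSectionNear B φ x)
    (a : Jet B k) : ContMDiffAt (𝓡 m) 𝓘(ℝ, JetModel m n k) ∞ (prolong k φ a) x := by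
  obtain ⟨c, hc⟩ := B.exists_chart (φ x)
  have hx := AdaptedChart.mem_base_of_section hφ hc
  have hev := eventually_prolong c hφ hc a
  have h1 : prolong k φ a =ᶠ[𝓝 x] fun z => (c.jetOpenChart k).symm
      (c.base z, fun I => mpderiv I.1 (c.localRep φ) (c.base z)) := by
    filter_upwards [hev] with z hz
    rw [← hz.2]
    exact ((c.jetOpenChart k).left_inv (c.mem_jetOpenChart_source.2 hz.1)).symm
  refine ContMDiffAt.congr_of_eventuallyEq ?_ h1
  have h2 := hev.self_of_nhds
  have h3 : (c.base x, fun I : MultiIndexLE m k => mpderiv I.1 (c.localRep φ) (c.base x)) ∈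
      (c.jetOpenChart k).target := by
    rw [← h2.2]
    exact (c.jetOpenChart k).map_source (c.mem_jetOpenChart_source.2 h2.1)
  exact ((contMDiffOn_symm_of_mem_maximalAtlas (c.jetOpenChart_mem k)).contMDiffAt
      ((c.jetOpenChart k).open_target.mem_nhds h3)).comp x
    (((contDiffAt_mpderiv_localRep c hφ hc k).contMDiffAt).comp x
      ((c.base_smooth _ hx).contMDiffAt (c.base.open_source.mem_nhds hx)))

/-- The derivative of the first prolongation of a section in natural coordinates. -/
lemma jetDeriv_mfderiv_prolong (c : B.Chart) {φ : B.M → B.E} {x : B.M} (hφ : IsSectionNear B φ x)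
    (hx : φ x ∈ c.total.source) (a : Jet B 1) (j : Fin m) :
    c.jetDeriv (prolong 1 φ a x) (mfderiv (𝓡 m) 𝓘(ℝ, JetModel m n 1) (prolong 1 φ a) x
      (mfderiv 𝓘(ℝ, Fin m → ℝ) (𝓡 m) c.base.symm (c.base x) (Pi.single j 1 : Fin m → ℝ) :
        EuclideanSpace ℝ (Fin m))) =
    (Pi.single j 1, fun I => mpderiv (I.1 + Pi.single j 1) (c.localRep φ) (c.base x)) := by
  have hxb := AdaptedChart.mem_base_of_section hφ hx
  have hy := c.base.map_source hxb
  have h1 := (contMDiffAt_prolong hφ a).mdifferentiableAt (by simp)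
  have h2 : MDifferentiableAt 𝓘(ℝ, JetModel m n 1) 𝓘(ℝ, JetModel m n 1) (c.jetChart 1)
      (prolong 1 φ a x) :=
    AdaptedChart.jetChart_mdifferentiable.mdifferentiableAt (x := prolong 1 φ a x)
      (eventually_prolong c hφ hx a).self_of_nhds.1
  have h3 := h2.hasMFDerivAt.comp x h1.hasMFDerivAt
  have h4 := (hasMFDerivAt_of_eq (c.base.left_inv hxb) h3.mdifferentiableAt).comp (c.base x)
    (c.mdifferentiableAt_base_symm hy).hasMFDerivAt
  have h5 : (fun y => ((y, fun I : MultiIndexLE m 1 => mpderiv I.1 (c.localRep φ) y) :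
      JetModel m n 1)) =ᶠ[𝓝 (c.base x)] (c.jetChart 1 ∘ prolong 1 φ a) ∘ c.base.symm := by
    have h6 : Filter.Tendsto c.base.symm (𝓝 (c.base x)) (𝓝 x) := by
      have := (c.base.continuousAt_symm hy).tendsto
      rwa [c.base.left_inv hxb] at this
    filter_upwards [h6.eventually (eventually_prolong c hφ hx a), c.base.open_target.mem_nhds hy]
      with y hy1 hy2
    have h7 := hy1.2
    rw [c.base.right_inv hy2] at h7
    exact h7.symm
  have h8 := (h4.congr_of_eventuallyEq h5).mfderiv
  rw [mfderiv_eq_fderiv] at h8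
  rw [← fderiv_mpderiv_localRep c hφ hx 1 j, h8]
  rw [h3.mfderiv]
  rfl

end Prolongation

/-! ### The coupling in natural coordinates -/

section Coupling

variable {m n : ℕ} {B : FieldBundle m n}

/-- On `symForms` the coordinates determine the form, so intrinsic forms may be evaluated through
their coordinates and the derivative of the natural chart. -/
lemma ofCoord_extCoord_apply (c : B.Chart) {j : Jet B 1} (hj : j.target ∈ c.total.source)
    (θ : symMom j) (v : Fin m → TangentSpace 𝓘(ℝ, JetModel m n 1) j) :
    θ.1 v = JetForm.ofCoord (c.extCoord j θ) fun i => c.jetDeriv j (v i) := by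
  have hloc : JetForm.ofCoord (c.extCoord j θ) = c.localForm j θ :=
    JetForm.ofCoord_coord ((mem_symMom_iff c hj).1 θ.2)
  rw [hloc]
  exact congrArg θ.1 (funext fun i =>
    ((AdaptedChart.isInvertible_jetDeriv hj).inverse_apply_self (v i)).symm)

lemma Jet.isSectionNear_rep {k : ℕ} (a : Jet B k) : IsSectionNear B a.rep.sec a.source := by
  rw [← a.rep_pt]
  exact a.rep.isSection

lemma Jet.rep_sec' {k : ℕ} (a : Jet B k) : a.rep.sec a.source = a.target := by
  rw [← a.rep_pt]
  exact a.rep_sec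

/-- At the source of the jet the chosen representative is a section, so the fallback value `b` is
not used. This identifies the point of `J¹π` at which the coupling evaluates the form. -/
lemma Jet.prolong_rep {k r : ℕ} (h : r ≤ k) (a : Jet B k) (b : Jet B r) :
    prolong r a.rep.sec b a.source = a.trunc r h := by
  have h1 : ∀ (q : JetRep B) (x : B.M) (hx : q.pt = x) (hs : IsSectionNear B q.sec x),
      Jet.mk r ⟨x, q.sec, hs⟩ = Jet.mk r q := by
    rintro q _ rfl hs
    rfl
  rw [prolong, dif_pos a.isSectionNear_rep, h1 _ _ a.rep_pt]
  conv_rhs => rw [← a.mk_rep, Jet.trunc_mk]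

/-- The tangent vectors of a prolongation are graph vectors, so `formOf_graph` applies. The point
`j` is kept as a variable, with an equation, because the type of `θ` depends on it. -/
lemma symMom_apply_prolong (c : B.Chart) {φ : B.M → B.E} {x : B.M} (hφ : IsSectionNear B φ x)
    (hx : φ x ∈ c.total.source) (a : Jet B 1) {j : Jet B 1} (hj : prolong 1 φ a x = j)
    (θ : symMom j) :
    (θ.1 : JetModel m n 1 [⋀^Fin m]→L[ℝ] ℝ) (fun i =>
      (mfderiv (𝓡 m) 𝓘(ℝ, JetModel m n 1) (prolong 1 φ a) x
      (mfderiv 𝓘(ℝ, Fin m → ℝ) (𝓡 m) c.base.symm (c.base x) (Pi.single i 1 : Fin m → ℝ) :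
        EuclideanSpace ℝ (Fin m)) : JetModel m n 1)) =
      (c.extCoord j θ).1 + ∑ k, momSlot (c.extCoord j θ).2 k
        fun I => mpderiv (I.1 + Pi.single k 1) (c.localRep φ) (c.base x) := by
  subst hj
  refine (ofCoord_extCoord_apply c ((target_prolong hφ a).symm ▸ hx) θ _).trans ?_
  rw [← formOf_graph, JetForm.ofCoord_eq]
  exact congrArg (formOf _ _) (funext fun i => jetDeriv_mfderiv_prolong c hφ hx a i)

/-- The coupling in natural coordinates. -/
lemma coupling_apply (c : B.Chart) (a : Jet B 3) (θ : symMom (a.trunc 1 (by norm_num)))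
    (hz : a.target ∈ c.total.source) :
    (coupling (Sigma.mk a θ) : EuclideanSpace ℝ (Fin m) [⋀^Fin m]→L[ℝ] ℝ)
      (fun i => (mfderiv 𝓘(ℝ, Fin m → ℝ) (𝓡 m) c.base.symm (c.base a.source)
        (Pi.single i 1 : Fin m → ℝ) : EuclideanSpace ℝ (Fin m))) =
      (c.extCoord (a.trunc 1 (by norm_num)) θ).1 +
        momPairing (c.extCoord (a.trunc 1 (by norm_num)) θ).2
          (c.jetCoord (a.trunc 2 (by norm_num))).2 := by
  have h1 := symMom_apply_prolong c a.isSectionNear_rep (a.rep_sec' ▸ hz)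
    (a.trunc 1 (by norm_num)) (a.prolong_rep (by norm_num) _) θ
  rw [c.jetCoord_trunc 2 (by norm_num) hz]
  exact h1

end Coupling

/-! ### The section `ĥ` in natural coordinates -/

section HamiltonianSection

variable {m n : ℕ} {B : FieldBundle m n}

/-- Two forms of degree `m` on the tangent space of the base agree when they agree on the coordinate
frame. There the density gives the local Lagrangian and the coupling gives `p + p^i u_i + p^I u_I`.
-/
lemma mem_couplingZero_iff (η : VolumeForm B) (L : Jet B 2 → ℝ) (c : B.Chart) (a : Jet B 3)
    (θ : symMom (a.trunc 1 (by norm_num))) (hz : a.target ∈ c.total.source) :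
    (Sigma.mk a θ : ExtUnified B) ∈ couplingZero η L ↔
      localLagrangian η L c (c.jetCoord (a.trunc 2 (by norm_num))) =
        (c.extCoord (a.trunc 1 (by norm_num)) θ).1 +
        momPairing (c.extCoord (a.trunc 1 (by norm_num)) θ).2
          (c.jetCoord (a.trunc 2 (by norm_num))).2 := by
  have hxs : a.source ∈ c.base.source := by
    rw [← a.proj_target]; exact c.proj_mem _ hz
  have hy := c.base.map_source hxs
  have h2 : (a.trunc 2 (by norm_num)).target ∈ c.total.source :=
    (congrArg (· ∈ c.total.source) (Jet.target_trunc 2 (by norm_num) a)).mpr hz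
  have h3 : (c.jetCoord (a.trunc 2 (by norm_num))).1 = c.base a.source :=
    congrArg (fun v => v.1) (c.jetCoord_trunc 2 (by norm_num) hz)
  have h4 : localLagrangian η L c (c.jetCoord (a.trunc 2 (by norm_num))) =
      L (a.trunc 2 (by norm_num)) * volumeCoeff η c (c.base a.source) := by
    have h5 : (c.jetChart 2).symm (c.jetCoord (a.trunc 2 (by norm_num))) =
      a.trunc 2 (by norm_num) := (c.jetChart 2).left_inv h2
    rw [localLagrangian, h5, h3]
  have h6 : volumeCoeff η c (c.base a.source) =
      (η.form a.source : EuclideanSpace ℝ (Fin m) [⋀^Fin m]→L[ℝ] ℝ)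
        (fun i => (mfderiv 𝓘(ℝ, Fin m → ℝ) (𝓡 m) c.base.symm (c.base a.source)
          (Pi.single i 1 : Fin m → ℝ) : EuclideanSpace ℝ (Fin m))) := by
    have h7 : ∀ q q' : B.M, q = q' → ∀ v : Fin m → EuclideanSpace ℝ (Fin m),
        (η.form q : EuclideanSpace ℝ (Fin m) [⋀^Fin m]→L[ℝ] ℝ) v =
        (η.form q' : EuclideanSpace ℝ (Fin m) [⋀^Fin m]→L[ℝ] ℝ) v := by
      rintro q _ rfl v; rfl
    exact h7 _ _ (c.base.left_inv hxs) _
  rw [h4, h6, ← coupling_apply c a θ hz]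
  have h8 : Function.Surjective (mfderiv 𝓘(ℝ, Fin m → ℝ) (𝓡 m) c.base.symm (c.base a.source) :
      (Fin m → ℝ) →L[ℝ] EuclideanSpace ℝ (Fin m)) := c.surjective_mfderiv_base_symm hy
  constructor
  · intro h
    exact congrArg (fun α : EuclideanSpace ℝ (Fin m) [⋀^Fin m]→L[ℝ] ℝ =>
      α (fun i => (mfderiv 𝓘(ℝ, Fin m → ℝ) (𝓡 m) c.base.symm (c.base a.source)
          (Pi.single i 1 : Fin m → ℝ) : EuclideanSpace ℝ (Fin m)))) h
  · intro h
    have h9 := topForm_ext (V := EuclideanSpace ℝ (Fin m)) (a := (L (a.trunc 2 (by norm_num)) •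
      (η.form a.source : EuclideanSpace ℝ (Fin m) [⋀^Fin m]→L[ℝ] ℝ)))
      (b := (coupling (Sigma.mk a θ) : EuclideanSpace ℝ (Fin m) [⋀^Fin m]→L[ℝ] ℝ)) h8
    exact h9 h

/-- The condition of `mem_couplingZero_iff` is solved by `p = L̂ - p^i u_i - p^I u_I` for given
remaining momenta. So the hypersurface meets every fibre over the restricted bundle, and the
definition of `hamSection` never takes its default value. -/
lemma exists_hamSection_eq (η : VolumeForm B) (L : Jet B 2 → ℝ) (w : RestUnified B) :
    ∃ θ : symMom (w.1.trunc 1 (by norm_num)), hamSection η L w = Sigma.mk w.1 θ ∧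
      QuotientAddGroup.mk θ = w.2 ∧ (Sigma.mk w.1 θ : ExtUnified B) ∈ couplingZero η L := by
  obtain ⟨a, q⟩ := w
  obtain ⟨c, hc⟩ := B.exists_chart a.target
  have h1 : (a.trunc 1 (by norm_num)).target ∈ c.total.source :=
    (congrArg (· ∈ c.total.source) (Jet.target_trunc 1 (by norm_num) a)).mpr hc
  set r := c.restCoord (a.trunc 1 (by norm_num)) q with hr
  obtain ⟨θ, hθ⟩ := (AdaptedChart.extCoord_bijective h1).2
    (localLagrangian η L c (c.jetCoord (a.trunc 2 (by norm_num))) -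
      momPairing r (c.jetCoord (a.trunc 2 (by norm_num))).2, r)
  have hq : QuotientAddGroup.mk θ = q := by
    apply (AdaptedChart.restCoord_bijective h1).1
    rw [AdaptedChart.restCoord_mk h1, hθ]
  have hmem : (Sigma.mk a θ : ExtUnified B) ∈ couplingZero η L := by
    rw [mem_couplingZero_iff η L c a θ hc, hθ]
    ring
  have hex : ∃ z ∈ couplingZero η L, z.mu = (Sigma.mk a q : RestUnified B) :=
    ⟨Sigma.mk a θ, hmem, congrArg (Sigma.mk a) hq⟩
  have h2 : hamSection η L (Sigma.mk a q) = hex.choose := dif_pos hex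
  obtain ⟨h3, h4⟩ := hex.choose_spec
  rw [← h2] at h3 h4
  -- With the chosen point replaced by a variable, its first component can be identified with `a`
  -- although the type of the second one depends on it.
  generalize hamSection η L (Sigma.mk a q) = z at h3 h4 ⊢
  obtain ⟨b, θ'⟩ := z
  obtain ⟨h5, h6⟩ := Sigma.mk.inj_iff.1 h4
  change b = a at h5
  subst h5
  exact ⟨θ', rfl, eq_of_heq h6, h3⟩

/-- The Hamiltonian section `ĥ` in natural coordinates. -/
lemma extMomOpenChart_hamSection (η : VolumeForm B) (L : Jet B 2 → ℝ) (c : B.Chart)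
    {w : RestUnified B} (hw : w.1.target ∈ c.total.source) :
    c.extMomOpenChart (hamSection η L w).rho2 =
      cartanModel (localLagrangian η L c) (truncFst m n (c.restUnifiedOpenChart w)) := by
  obtain ⟨θ, h1, h2, h3⟩ := exists_hamSection_eq η L w
  have h4 : (w.1.trunc 1 (by norm_num)).target ∈ c.total.source :=
    (congrArg (· ∈ c.total.source) (Jet.target_trunc 1 (by norm_num) w.1)).mpr hw
  rw [mem_couplingZero_iff η L c _ θ hw] at h3
  have h5 : c.restCoord (w.1.trunc 1 (by norm_num)) w.2 =
      (c.extCoord (w.1.trunc 1 (by norm_num)) θ).2 := by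
    rw [← h2, AdaptedChart.restCoord_mk h4]
  rw [c.jetCoord_trunc 2 (by norm_num) hw] at h3
  rw [h1]
  -- Whatever point was chosen, its restricted momenta are those of `w` and the coupling condition
  -- determines its coordinate `p`.
  refine Prod.ext (c.jetCoord_trunc 1 (by norm_num) hw) (Prod.ext ?_ h5.symm)
  change (c.extCoord (w.1.trunc 1 (by norm_num)) θ).1 = localLagrangian η L c
    (truncModel 2 (by norm_num) (c.jetCoord w.1)) - momPairing
    (c.restCoord (w.1.trunc 1 (by norm_num)) w.2) (truncModel 2 (by norm_num) (c.jetCoord w.1)).2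
  rw [h3, h5]
  ring

lemma target_rho2_hamSection (η : VolumeForm B) (L : Jet B 2 → ℝ) (w : RestUnified B) :
    (hamSection η L w).rho2.1.target = w.1.target := by
  obtain ⟨θ, h1, -, -⟩ := exists_hamSection_eq η L w
  rw [h1]
  exact Jet.target_trunc 1 (by norm_num) w.1

lemma jetCoord_mem_target_of_mem (c : B.Chart) {a : Jet B 3} (ha : a.target ∈ c.total.source) :
    ((truncModel 2 (by norm_num) (c.jetCoord a) : JetModel m n 2).1,
      (truncModel 2 (by norm_num) (c.jetCoord a) : JetModel m n 2).2 (.zero m 2)) ∈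
      c.total.target :=
  AdaptedChart.jetCoord_mem_target ha

lemma contDiffAt_cartanModel {G : JetModel m n 2 → ℝ} {z : JetModel m n 2 × RestMomModel m n}
    (hG : ContDiffAt ℝ ∞ G z.1) : ContDiffAt ℝ ∞ (cartanModel G) z := by
  refine ContDiffAt.prodMk ((contDiff_truncModel 1 (by norm_num)).contDiffAt.comp z contDiffAt_fst)
    (ContDiffAt.prodMk (ContDiffAt.sub (hG.comp z contDiffAt_fst) ?_) contDiffAt_snd)
  exact (((momPairingB m n).contDiff.comp contDiff_snd).clm_apply
    (contDiff_snd.comp contDiff_fst)).contDiffAt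

/-- Although the section is defined by a choice, its local expression is `cartanModel` of a smooth
function. -/
lemma contMDiff_rho2_hamSection (η : VolumeForm B) {L : Jet B 2 → ℝ}
    (hL : ContMDiff 𝓘(ℝ, JetModel m n 2) 𝓘(ℝ, ℝ) ∞ L) :
    ContMDiff 𝓘(ℝ, JetModel m n 3 × RestMomModel m n) 𝓘(ℝ, JetModel m n 1 × ExtMomModel m n) ∞
      fun w : RestUnified B => (hamSection η L w).rho2 := by
  intro w
  obtain ⟨c, hc⟩ := B.exists_chart w.1.target
  have hw := c.mem_restUnifiedOpenChart_source.2 hc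
  refine contMDiffAt_of_chart c.restUnifiedOpenChart_mem c.extMomOpenChart_mem hw
    (G := fun v => cartanModel (localLagrangian η L c) (truncFst m n v))
    ((contDiffAt_cartanModel (contDiffAt_localLagrangian η hL c
      (jetCoord_mem_target_of_mem c hc))).comp _ (truncFst m n).contDiff.contDiffAt) ?_
  filter_upwards [c.restUnifiedOpenChart.open_source.mem_nhds hw] with q hq
  exact ⟨(congrArg (· ∈ c.total.source) (target_rho2_hamSection η L q)).mpr hq,
    extMomOpenChart_hamSection η L c hq⟩

end HamiltonianSection

/-! ### The Hamiltonian section, and the equivalence of the Hamiltonian equations -/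

section LocalHamiltonian

variable {m n : ℕ} {B : FieldBundle m n}

lemma LocalFieldEq.congr {V : Type*} [NormedAddCommGroup V] [NormedSpace ℝ V]
    {Φ Φ' : V → JetModel m n 1 × ExtMomModel m n} {s s' : (Fin m → ℝ) → V} {y : Fin m → ℝ}
    (hΦ : Φ =ᶠ[𝓝 (s y)] Φ') (hs : s =ᶠ[𝓝 y] s') : LocalFieldEq Φ s y ↔ LocalFieldEq Φ' s' y := by
  rw [LocalFieldEq, LocalFieldEq, hs.fderiv_eq, ← hs.self_of_nhds, hΦ.fderiv_eq]

lemma rho2_pair {a : Jet B 3} {q : RestMom B} (h : q.proj = a.trunc 1 (by norm_num)) :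
    (RestUnified.pair a q).rho2 = q := by
  obtain ⟨j, r⟩ := q
  change j = _ at h
  subst h
  exact congrArg (Sigma.mk _) (dif_pos rfl)

/-- The chart is the very one chosen in the definition of `legendreMap`. Later arguments are all
made in this chart, so that the independence of the chart is never used. -/
lemma restMomOpenChart_legendreMap (η : VolumeForm B) (L : Jet B 2 → ℝ) (a : Jet B 3) :
    (legendreMap η L a).1.target ∈ (B.exists_chart a.target).choose.total.source ∧
    (B.exists_chart a.target).choose.restMomOpenChart (legendreMap η L a) =
      ((B.exists_chart a.target).choose.jetCoord (a.trunc 1 (by norm_num)),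
        legendreCoord (localLagrangian η L (B.exists_chart a.target).choose)
          ((B.exists_chart a.target).choose.jetCoord a)) := by
  have hc := (B.exists_chart a.target).choose_spec
  -- The equation is kept in order to recognise the definition of `legendreMap` in `h3`.
  generalize hc' : (B.exists_chart a.target).choose = c at hc ⊢
  have h1 : (a.trunc 1 (by norm_num)).target ∈ c.total.source :=
    (congrArg (· ∈ c.total.source) (Jet.target_trunc 1 (by norm_num) a)).mpr hc
  have h2 : (c.jetCoord (a.trunc 1 (by norm_num)),
      legendreCoord (localLagrangian η L c) (c.jetCoord a)) ∈ c.restMomOpenChart.target :=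
    ⟨AdaptedChart.jetCoord_mem_target h1, trivial⟩
  have h3 : legendreMap η L a = c.restMomOpenChart.symm (c.jetCoord (a.trunc 1 (by norm_num)),
      legendreCoord (localLagrangian η L c) (c.jetCoord a)) := by
    subst hc'
    rfl
  rw [h3]
  exact ⟨c.restMomOpenChart.map_target h2, c.restMomOpenChart.right_inv h2⟩

lemma legendreMap_proj (η : VolumeForm B) (L : Jet B 2 → ℝ) (a : Jet B 3) :
    (legendreMap η L a).proj = a.trunc 1 (by norm_num) := by
  obtain ⟨h1, h2⟩ := restMomOpenChart_legendreMap η L a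
  have hc := (B.exists_chart a.target).choose_spec
  generalize (B.exists_chart a.target).choose = c at hc h1 h2
  have h3 : (a.trunc 1 (by norm_num)).target ∈ c.total.source :=
    (congrArg (· ∈ c.total.source) (Jet.target_trunc 1 (by norm_num) a)).mpr hc
  exact (c.jetOpenChart 1).injOn (c.mem_jetOpenChart_source.2 h1) (c.mem_jetOpenChart_source.2 h3)
    (congrArg Prod.fst h2)

variable {η : VolumeForm B} {L : Jet B 2 → ℝ} {Υ : RestMom B → Jet B 3}

/-- The Legendre map covers the identity of `J¹π`, hence so does any right inverse of it. -/
lemma IsLegendreSection.proj_eq (hΥ : IsLegendreSection η L Υ) (q : RestMom B) :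
    q.proj = (Υ q).trunc 1 (by norm_num) := by
  conv_lhs => rw [← hΥ.2 q, legendreMap_proj]

lemma IsLegendreSection.target_eq (hΥ : IsLegendreSection η L Υ) (q : RestMom B) :
    (Υ q).target = q.proj.target := by
  rw [hΥ.proj_eq q, Jet.target_trunc]

lemma IsLegendreSection.rho2_pair (hΥ : IsLegendreSection η L Υ) (q : RestMom B) :
    (RestUnified.pair (Υ q) q).rho2 = q :=
  FieldTheory.rho2_pair (hΥ.proj_eq q)

/-- Since the Legendre map sends `Υ q` back to `q`, the section `h` is the projection of `ĥ` at the
pair `(Υ q, q)`. Through this identity the unified and Hamiltonian forms are compared. -/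
lemma IsLegendreSection.hamiltonianSection_eq (hΥ : IsLegendreSection η L Υ) (q : RestMom B) :
    hamiltonianSection η L Υ q = (hamSection η L (RestUnified.pair (Υ q) q)).rho2 := by
  rw [hamiltonianSection, extLegendreMap, hΥ.2]

lemma IsLegendreSection.restUnifiedOpenChart_pair (hΥ : IsLegendreSection η L Υ) (c : B.Chart)
    {q : RestMom B} (hq : q.proj.target ∈ c.total.source) :
    c.restUnifiedOpenChart (RestUnified.pair (Υ q) q) =
      (c.jetCoord (Υ q), (c.restMomOpenChart q).2) := by
  have h1 := restMomOpenChart_rho2 c (z := RestUnified.pair (Υ q) q)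
    ((congrArg (· ∈ c.total.source) (hΥ.target_eq q)).mpr hq)
  rw [hΥ.rho2_pair] at h1
  exact Prod.ext rfl (congrArg Prod.snd h1).symm

lemma IsLegendreSection.contMDiff_pair (hΥ : IsLegendreSection η L Υ) :
    ContMDiff 𝓘(ℝ, JetModel m n 1 × RestMomModel m n) 𝓘(ℝ, JetModel m n 3 × RestMomModel m n) ∞
      fun q => RestUnified.pair (Υ q) q := by
  intro q
  obtain ⟨c, hc⟩ := B.exists_chart q.proj.target
  have hq := c.mem_restMomOpenChart_source.2 hc
  have hΥq : (Υ q).target ∈ c.total.source := (hΥ.target_eq q).symm ▸ hc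
  have hqt := c.restMomOpenChart.map_source hq
  refine contMDiffAt_of_chart c.restMomOpenChart_mem c.restUnifiedOpenChart_mem hq
    (G := fun v => (c.jetOpenChart 3 (Υ (c.restMomOpenChart.symm v)), v.2)) ?_ ?_
  · refine ContDiffAt.prodMk ?_ contDiffAt_snd
    rw [← contMDiffAt_iff_contDiffAt]
    refine ContMDiffAt.comp (g := c.jetOpenChart 3) (I' := 𝓘(ℝ, JetModel m n 3)) _ ?_
      ((hΥ.1 _).comp _ ((contMDiffOn_symm_of_mem_maximalAtlas
        c.restMomOpenChart_mem).contMDiffAt (c.restMomOpenChart.open_target.mem_nhds hqt)))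
    refine (contMDiffOn_of_mem_maximalAtlas (c.jetOpenChart_mem 3)).contMDiffAt
      ((c.jetOpenChart 3).open_source.mem_nhds ?_)
    rw [c.restMomOpenChart.left_inv hq]
    exact hΥq
  · filter_upwards [c.restMomOpenChart.open_source.mem_nhds hq] with q' hq'
    refine ⟨(congrArg (· ∈ c.total.source) (hΥ.target_eq q')).mpr hq', ?_⟩
    rw [hΥ.restUnifiedOpenChart_pair c hq', c.restMomOpenChart.left_inv hq']
    rfl

lemma IsLegendreSection.contMDiff_hamiltonianSection (hΥ : IsLegendreSection η L Υ)
    (hL : ContMDiff 𝓘(ℝ, JetModel m n 2) 𝓘(ℝ, ℝ) ∞ L) :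
    ContMDiff 𝓘(ℝ, JetModel m n 1 × RestMomModel m n) 𝓘(ℝ, JetModel m n 1 × ExtMomModel m n) ∞
      (hamiltonianSection η L Υ) := by
  rw [show hamiltonianSection η L Υ = (fun w : RestUnified B => (hamSection η L w).rho2) ∘
    fun q => RestUnified.pair (Υ q) q from funext hΥ.hamiltonianSection_eq]
  exact (contMDiff_rho2_hamSection η hL).comp hΥ.contMDiff_pair

/-- The Hamiltonian section `h` in natural coordinates, in terms of the Lagrangian. -/
lemma IsLegendreSection.extMomOpenChart_hamiltonianSection (hΥ : IsLegendreSection η L Υ)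
    (c : B.Chart) {q : RestMom B} (hq : q.proj.target ∈ c.total.source) :
    c.extMomOpenChart (hamiltonianSection η L Υ q) = cartanModel (localLagrangian η L c)
      (truncFst m n (c.jetCoord (Υ q), (c.restMomOpenChart q).2)) := by
  rw [hΥ.hamiltonianSection_eq, extMomOpenChart_hamSection η L c
    ((congrArg (· ∈ c.total.source) (hΥ.target_eq q)).mpr hq), hΥ.restUnifiedOpenChart_pair c hq]

lemma IsLegendreSection.target_hamiltonianSection (hΥ : IsLegendreSection η L Υ) (q : RestMom B) :
    (hamiltonianSection η L Υ q).1.target = q.proj.target := by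
  rw [hΥ.hamiltonianSection_eq, target_rho2_hamSection]
  exact hΥ.target_eq q

/-- The Hamiltonian section `h` in natural coordinates, in terms of the Hamiltonian function. -/
lemma IsLegendreSection.eq_hamModel (hΥ : IsLegendreSection η L Υ)
    (c : B.Chart) {q : RestMom B} (hq : q.proj.target ∈ c.total.source) :
    c.extMomOpenChart (hamiltonianSection η L Υ q) =
      hamModel (localHamiltonian η L Υ c) (c.restMomOpenChart q) := by
  have h1 := hΥ.extMomOpenChart_hamiltonianSection c hq
  have h2 : localHamiltonian η L Υ c (c.restMomOpenChart q) =
      -(c.extMomOpenChart (hamiltonianSection η L Υ q)).2.1 := by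
    have h3 : localHamiltonian η L Υ c (c.restMomOpenChart q) = -(c.extMomOpenChart
      (hamiltonianSection η L Υ (c.restMomOpenChart.symm (c.restMomOpenChart q)))).2.1 := rfl
    rw [h3, c.restMomOpenChart.left_inv (c.mem_restMomOpenChart_source.2 hq)]
  refine Prod.ext ?_ (Prod.ext ?_ ?_)
  · rw [h1]
    refine (c.jetCoord_trunc 1 (by norm_num)
      ((congrArg (· ∈ c.total.source) (hΥ.target_eq q)).mpr hq)).symm.trans ?_
    rw [← hΥ.proj_eq]
    rfl
  · change _ = -localHamiltonian η L Υ c (c.restMomOpenChart q)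
    rw [h2, neg_neg]
  · rw [h1]
    rfl

/-- The expression in natural coordinates of the Hamiltonian section. -/
def localHamiltonianSection (η : VolumeForm B) (L : Jet B 2 → ℝ) (Υ : RestMom B → Jet B 3)
    (c : B.Chart) (v : JetModel m n 1 × RestMomModel m n) : JetModel m n 1 × ExtMomModel m n :=
  c.extMomOpenChart (hamiltonianSection η L Υ (c.restMomOpenChart.symm v))

lemma IsLegendreSection.contDiffAt_localHamiltonianSection (hΥ : IsLegendreSection η L Υ)
    (hL : ContMDiff 𝓘(ℝ, JetModel m n 2) 𝓘(ℝ, ℝ) ∞ L) (c : B.Chart) {q : RestMom B}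
    (hq : q.proj.target ∈ c.total.source) :
    ContDiffAt ℝ ∞ (localHamiltonianSection η L Υ c) (c.restMomOpenChart q) := by
  have hqs := c.mem_restMomOpenChart_source.2 hq
  rw [← contMDiffAt_iff_contDiffAt]
  refine ContMDiffAt.comp (g := c.extMomOpenChart) (I' := 𝓘(ℝ, JetModel m n 1 × ExtMomModel m n))
    _ ?_ ((hΥ.contMDiff_hamiltonianSection hL _).comp _ ((contMDiffOn_symm_of_mem_maximalAtlas
      c.restMomOpenChart_mem).contMDiffAt (c.restMomOpenChart.open_target.mem_nhds
        (c.restMomOpenChart.map_source hqs))))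
  refine (contMDiffOn_of_mem_maximalAtlas c.extMomOpenChart_mem).contMDiffAt
    (c.extMomOpenChart.open_source.mem_nhds ?_)
  rw [c.restMomOpenChart.left_inv hqs]
  exact (congrArg (· ∈ c.total.source) (hΥ.target_hamiltonianSection q)).mpr hq

lemma IsLegendreSection.localHamiltonianSection_eventuallyEq (hΥ : IsLegendreSection η L Υ)
    (c : B.Chart) {q : RestMom B} (hq : q.proj.target ∈ c.total.source) :
    localHamiltonianSection η L Υ c =ᶠ[𝓝 (c.restMomOpenChart q)]
      hamModel (localHamiltonian η L Υ c) := by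
  filter_upwards [c.restMomOpenChart.open_target.mem_nhds
    (c.restMomOpenChart.map_source (c.mem_restMomOpenChart_source.2 hq))] with v hv
  rw [localHamiltonianSection, hΥ.eq_hamModel c (c.restMomOpenChart.map_target hv),
    c.restMomOpenChart.right_inv hv]

lemma IsLegendreSection.differentiableAt_localHamiltonian (hΥ : IsLegendreSection η L Υ)
    (hL : ContMDiff 𝓘(ℝ, JetModel m n 2) 𝓘(ℝ, ℝ) ∞ L) (c : B.Chart) {q : RestMom B}
    (hq : q.proj.target ∈ c.total.source) :
    DifferentiableAt ℝ (localHamiltonian η L Υ c) (c.restMomOpenChart q) :=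
  ((hΥ.contDiffAt_localHamiltonianSection hL c hq).differentiableAt (by simp)).snd.fst.neg

/-- The Hamiltonian field equation at a point, in natural coordinates. -/
lemma IsLegendreSection.solvesHamilton_at_iff (hΥ : IsLegendreSection η L Υ)
    (hL : ContMDiff 𝓘(ℝ, JetModel m n 2) 𝓘(ℝ, ℝ) ∞ L) (c : B.Chart) {σ : B.M → RestMom B} {x : B.M}
    (hσ : MDifferentiableAt (𝓡 m) 𝓘(ℝ, JetModel m n 1 × RestMomModel m n) σ x)
    (hxb : x ∈ c.base.source) (hx : (σ x).proj.target ∈ c.total.source) :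
    (∀ X : ∀ q : RestMom B, TangentSpace 𝓘(ℝ, JetModel m n 1 × RestMomModel m n) q,
      IsVectorField X → (((hamiltonCartanForm η L Υ).interior X).pullback σ :
        DiffForm (EuclideanSpace ℝ (Fin m)) B.M m) x = 0) ↔
    LocalFieldEq (localHamiltonianSection η L Υ c) (c.localSection σ) (c.base x) :=
  have h1 : (hamiltonianSection η L Υ (σ x)).1.target ∈ c.total.source :=
    (congrArg (· ∈ c.total.source) (hΥ.target_hamiltonianSection (σ x))).mpr hx
  forall_isVectorField_iff c.restMomOpenChart_mem hx c.extMomOpenChart_mem h1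
    (multisymplecticForm_eq c h1)
    ((hΥ.contMDiff_hamiltonianSection hL _).mdifferentiableAt (by simp)) hσ hxb
    (c.mdifferentiableAt_base hxb) (c.mdifferentiableAt_base_symm (c.base.map_source hxb))

lemma mem_base_source (c : B.Chart) {k : ℕ} {a : Jet B k} (ha : a.target ∈ c.total.source) :
    a.source ∈ c.base.source := by
  rw [← a.proj_target]
  exact c.proj_mem _ ha

lemma differentiableAt_localSection (c : B.Chart) {σ : B.M → RestMom B} {x : B.M}
    (hσ : MDifferentiableAt (𝓡 m) 𝓘(ℝ, JetModel m n 1 × RestMomModel m n) σ x)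
    (hxb : x ∈ c.base.source) (hx : (σ x).proj.target ∈ c.total.source) :
    DifferentiableAt ℝ (c.localSection σ) (c.base x) := by
  rw [← mdifferentiableAt_iff_differentiableAt]
  have h1 : c.base.symm (c.base x) = x := c.base.left_inv hxb
  refine MDifferentiableAt.comp (g := c.restMomOpenChart)
    (I' := 𝓘(ℝ, JetModel m n 1 × RestMomModel m n)) (c.base x) ?_
    (MDifferentiableAt.comp (g := σ) (I' := 𝓡 m) (c.base x) ?_
      (c.mdifferentiableAt_base_symm (c.base.map_source hxb)))
  · rw [h1]
    exact ((contMDiffOn_of_mem_maximalAtlas c.restMomOpenChart_mem).contMDiffAt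
      (c.restMomOpenChart.open_source.mem_nhds hx)).mdifferentiableAt (by simp)
  · rw [h1]
    exact hσ

/-- The Hamilton–De Donder–Weyl equations at a point. -/
lemma IsLegendreSection.localFieldEq_iff (hΥ : IsLegendreSection η L Υ)
    (hL : ContMDiff 𝓘(ℝ, JetModel m n 2) 𝓘(ℝ, ℝ) ∞ L) (c : B.Chart) {σ : B.M → RestMom B} {x : B.M}
    (hσ : MDifferentiableAt (𝓡 m) 𝓘(ℝ, JetModel m n 1 × RestMomModel m n) σ x)
    (hs : ∀ᶠ z in 𝓝 x, (σ z).proj.source = z)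
    (hxb : x ∈ c.base.source) (hx : (σ x).proj.target ∈ c.total.source) :
    LocalFieldEq (localHamiltonianSection η L Υ c) (c.localSection σ) (c.base x) ↔
      HamiltonDeDonderWeyl (localHamiltonian η L Υ c) (c.localSection σ) (c.base x) := by
  have h1 : c.localSection σ (c.base x) = c.restMomOpenChart (σ x) :=
    congrArg (fun z => c.restMomOpenChart (σ z)) (c.base.left_inv hxb)
  have h2 : Filter.Tendsto c.base.symm (𝓝 (c.base x)) (𝓝 x) := by
    have := (c.base.continuousAt_symm (c.base.map_source hxb)).tendsto
    rwa [c.base.left_inv hxb] at this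
  -- The field equation only sees first derivatives at a point, so agreement near that point is
  -- enough.
  rw [LocalFieldEq.congr (Φ' := hamModel (localHamiltonian η L Υ c)) (s' := c.localSection σ)
    (h1 ▸ hΥ.localHamiltonianSection_eventuallyEq c hx) Filter.EventuallyEq.rfl]
  refine localFieldEq_hamModel_iff (h1 ▸ hΥ.differentiableAt_localHamiltonian hL c hx)
    (differentiableAt_localSection c hσ hxb hx) ?_
  filter_upwards [h2.eventually hs, c.base.open_target.mem_nhds (c.base.map_source hxb)]
    with z hz hz'
  change c.base (σ (c.base.symm z)).proj.source = z
  rw [hz, c.base.right_inv hz']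

/-- A section solves the Hamiltonian field equation if and only if it satisfies the
Hamilton–De Donder–Weyl equations. -/
lemma IsLegendreSection.solvesHamilton_iff (hΥ : IsLegendreSection η L Υ)
    (hL : ContMDiff 𝓘(ℝ, JetModel m n 2) 𝓘(ℝ, ℝ) ∞ L) {U : Set B.M} (hU : IsOpen U)
    {σ : B.M → RestMom B} (hσ : RestMom.IsSectionOn σ U) :
    SolvesHamilton η L Υ σ U ↔ SolvesHamiltonDeDonderWeyl η L Υ σ U := by
  have key : ∀ (c : B.Chart), ∀ x ∈ U, (σ x).proj.target ∈ c.total.source →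
      ((∀ X : ∀ q : RestMom B, TangentSpace 𝓘(ℝ, JetModel m n 1 × RestMomModel m n) q,
      IsVectorField X → (((hamiltonCartanForm η L Υ).interior X).pullback σ :
        DiffForm (EuclideanSpace ℝ (Fin m)) B.M m) x = 0) ↔
      HamiltonDeDonderWeyl (localHamiltonian η L Υ c) (c.localSection σ) (c.base x)) := by
    intro c x hxU hx
    have hxb : x ∈ c.base.source := hσ.2 x hxU ▸ mem_base_source c hx
    have hd := (hσ.1.contMDiffAt (hU.mem_nhds hxU)).mdifferentiableAt (by simp)
    rw [hΥ.solvesHamilton_at_iff hL c hd hxb hx]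
    exact hΥ.localFieldEq_iff hL c hd (Filter.mem_of_superset (hU.mem_nhds hxU) hσ.2) hxb hx
  constructor
  · intro h c x hxU hx
    exact (key c x hxU hx).1 fun X hX => h X hX x hxU
  · intro h X hX x hxU
    -- For this direction one natural chart around the point suffices, since the equation on the
    -- left is intrinsic.
    obtain ⟨c, hc⟩ := B.exists_chart (σ x).proj.target
    exact (key c x hxU hc).2 (h c x hxU hc) X hX

end LocalHamiltonian

/-! ### Hyperregularity determines the second-order derivatives -/

section Hyperregular

/-- A differentiable map of a finite-dimensional space to itself is injective if it has a right
inverse of class `C¹`. -/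
lemma injective_of_contDiff_rightInverse {E : Type*} [NormedAddCommGroup E] [NormedSpace ℝ E]
    [FiniteDimensional ℝ E] {G s : E → E} (hG : Differentiable ℝ G) (hs : ContDiff ℝ 1 s)
    (h : ∀ u, G (s u) = u) : Function.Injective G := by
  have : CompleteSpace E := FiniteDimensional.complete ℝ E
  -- By the chain rule the derivative of `s` has a left inverse; in finite dimension it is then
  -- onto, and `s` is open by the surjective form of local inversion.
  have hopen : IsOpen (Set.range s) := by
    refine IsOpenMap.isOpen_range (IsOpenMap.of_nhds_le fun u => ?_)
    have h1 : HasStrictFDerivAt s (fderiv ℝ s u) u :=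
      hs.contDiffAt.hasStrictFDerivAt (by simp)
    have h2 : (fderiv ℝ G (s u)).comp (fderiv ℝ s u) = ContinuousLinearMap.id ℝ E := by
      have h3 := (hG (s u)).hasFDerivAt.comp u h1.hasFDerivAt
      rw [show G ∘ s = id from funext h] at h3
      exact h3.unique (hasFDerivAt_id u)
    have h4 : Function.Injective (fderiv ℝ s u) := fun a b hab => by
      have h5 := congrArg (fderiv ℝ G (s u)) hab
      have h6 := fun a => congrArg (fun L => L a) h2
      exact (h6 a).symm.trans (h5.trans (h6 b))
    have h7 : (fderiv ℝ s u).range = ⊤ :=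
      LinearMap.range_eq_top.2 ((LinearMap.injective_iff_surjective
        (f := (fderiv ℝ s u : E →ₗ[ℝ] E))).1 h4)
    exact (h1.map_nhds_eq_of_surj h7).ge
  -- The image of a right inverse is the fixed-point set of `s ∘ G`.
  have hclosed : IsClosed (Set.range s) := by
    have h1 : Set.range s = {v | s (G v) = v} := by
      ext v
      constructor
      · rintro ⟨u, rfl⟩
        exact congrArg s (h u)
      · exact fun hv => ⟨G v, hv⟩
    rw [h1]
    exact isClosed_eq (hs.continuous.comp hG.continuous) continuous_id
  -- The image is open, closed and nonempty in a connected space. So `s` is onto, and `G` is its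
  -- two-sided inverse.
  have hsurj : Function.Surjective s :=
    Set.range_eq_univ.1 (IsClopen.eq_univ ⟨hclosed, hopen⟩ (Set.range_nonempty s))
  intro a b hab
  obtain ⟨u, rfl⟩ := hsurj a
  obtain ⟨v, rfl⟩ := hsurj b
  rw [h, h] at hab
  rw [hab]

variable {m n : ℕ}

/-- The point of the second jet model with given coordinates of order at most one and given
coordinates of order two. -/
def jetModelOfTop (v : JetModel m n 1) (u : MultiIndexTwo m → Fin n → ℝ) : JetModel m n 2 :=
  (v.1, fun I => if h : ∑ i, I.1 i = 2 then u ⟨I.1, h⟩ else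
    v.2 ⟨I.1, by have := I.2; omega⟩)

lemma jetModelOfTop_eq (w : JetModel m n 2) :
    jetModelOfTop (truncModel 1 (by norm_num) w) (fun K => w.2 K.toLE) = w := by
  refine Prod.ext rfl (funext fun I => ?_)
  simp only [jetModelOfTop]
  split_ifs <;> rfl

lemma contDiff_jetModelOfTop (v : JetModel m n 1) :
    ContDiff ℝ ∞ (jetModelOfTop (n := n) v) := by
  refine contDiff_const.prodMk (contDiff_pi.2 fun I => ?_)
  split_ifs
  · fun_prop
  · exact contDiff_const

lemma jetModelOfTop_zero (v : JetModel m n 1) (u : MultiIndexTwo m → Fin n → ℝ) :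
    (jetModelOfTop v u).2 (.zero m 2) = v.2 (.zero m 1) := by
  simp [jetModelOfTop, MultiIndexLE.zero]

variable {B : FieldBundle m n} {η : VolumeForm B} {L : Jet B 2 → ℝ} {Υ : RestMom B → Jet B 3}

lemma IsLegendreSection.contDiffAt_jetCoord (hΥ : IsLegendreSection η L Υ) (c : B.Chart)
    {v : JetModel m n 1 × RestMomModel m n} (hv : v ∈ c.restMomOpenChart.target) :
    ContDiffAt ℝ ∞ (fun w => c.jetCoord (Υ (c.restMomOpenChart.symm w))) v := by
  rw [← contMDiffAt_iff_contDiffAt]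
  refine ContMDiffAt.comp (g := c.jetOpenChart 3) (I' := 𝓘(ℝ, JetModel m n 3)) _ ?_
      ((hΥ.1 _).comp _ ((contMDiffOn_symm_of_mem_maximalAtlas
        c.restMomOpenChart_mem).contMDiffAt (c.restMomOpenChart.open_target.mem_nhds hv)))
  refine (contMDiffOn_of_mem_maximalAtlas (c.jetOpenChart_mem 3)).contMDiffAt
      ((c.jetOpenChart 3).open_source.mem_nhds ?_)
  exact (congrArg (· ∈ c.total.source) (hΥ.target_eq _)).mpr (c.restMomOpenChart.map_target hv)

/-- For a hyperregular Lagrangian density, the Legendre image of a jet determines its coordinates of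
order at most two. -/
lemma IsLegendreSection.trunc_two_eq (hΥ : IsLegendreSection η L Υ)
    (hL : ContMDiff 𝓘(ℝ, JetModel m n 2) 𝓘(ℝ, ℝ) ∞ L) (a : Jet B 3) :
    (Υ (legendreMap η L a)).trunc 2 (by norm_num) = a.trunc 2 (by norm_num) := by
  obtain ⟨-, hcoord⟩ := restMomOpenChart_legendreMap η L a
  -- Jets with the same target use the same chosen chart in `legendreMap`, so their Legendre images
  -- can be compared in coordinates.
  have hleg : ∀ b : Jet B 3, b.target = a.target →
      (B.exists_chart a.target).choose.restMomOpenChart (legendreMap η L b) =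
      ((B.exists_chart a.target).choose.jetCoord (b.trunc 1 (by norm_num)),
        legendreCoord (localLagrangian η L (B.exists_chart a.target).choose)
          ((B.exists_chart a.target).choose.jetCoord b)) := by
    intro b hb
    have h1 := (restMomOpenChart_legendreMap η L b).2
    rw [hb] at h1
    exact h1
  have hc := (B.exists_chart a.target).choose_spec
  generalize (B.exists_chart a.target).choose = c at hc hleg hcoord
  have hproj := legendreMap_proj η L a
  set q := legendreMap η L a with hq
  have hb : (Υ q).target = a.target := by
    rw [hΥ.target_eq, hproj, Jet.target_trunc]
  have hc1 : (a.trunc 1 (by norm_num)).target ∈ c.total.source :=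
    (congrArg (· ∈ c.total.source) (Jet.target_trunc 1 (by norm_num) a)).mpr hc
  set v₁ := c.jetCoord (a.trunc 1 (by norm_num)) with hv₁
  set F := localLagrangian η L c with hF
  set r := (c.restMomOpenChart q).2 with hr
  have hv₁t : (v₁.1, v₁.2 (.zero m 1)) ∈ c.total.target := AdaptedChart.jetCoord_mem_target hc1
  -- With the coordinates of order at most one frozen, `p^I = ∂L̂/∂u_I` depends only on the
  -- second-order coordinates. This gives a self-map of a vector space, defined everywhere because
  -- natural charts of `J²π` contain all values of those coordinates.
  set G : (MultiIndexTwo m → Fin n → ℝ) → (MultiIndexTwo m → Fin n → ℝ) :=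
    fun u K α => partialU K.toLE α F (jetModelOfTop v₁ u) with hG
  have hGd : Differentiable ℝ G := by
    intro u
    refine differentiableAt_pi.2 fun K => differentiableAt_pi.2 fun α => ?_
    have h1 : ContDiffAt ℝ ∞ F (jetModelOfTop v₁ u) := by
      refine contDiffAt_localLagrangian η hL c ?_
      rw [jetModelOfTop_zero]
      exact hv₁t
    have h2 : ContDiffAt ℝ ∞ (partialU K.toLE α F) (jetModelOfTop v₁ u) :=
      (h1.fderiv_right (m := ∞) (by simp)).clm_apply contDiffAt_const
    exact (h2.comp u (contDiff_jetModelOfTop v₁).contDiffAt).differentiableAt (by simp)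
  have hjet : ∀ b : Jet B 3, b.trunc 1 (by norm_num) = a.trunc 1 (by norm_num) →
      b.target ∈ c.total.source ∧ truncModel 2 (by norm_num) (c.jetCoord b) =
        jetModelOfTop v₁ fun K => (c.jetCoord b).2 (K.toLE.castLE (by norm_num)) := by
    intro b hbt
    have hbs : b.target ∈ c.total.source := by
      rw [← Jet.target_trunc 1 (by norm_num) b, hbt]
      exact hc1
    refine ⟨hbs, ?_⟩
    rw [← jetModelOfTop_eq (truncModel 2 (by norm_num) (c.jetCoord b)), hv₁, ← hbt,
      c.jetCoord_trunc 1 (by norm_num) hbs]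
    rfl
  have hGb : ∀ b : Jet B 3, b.trunc 1 (by norm_num) = a.trunc 1 (by norm_num) →
      G (fun K => (c.jetCoord b).2 (K.toLE.castLE (by norm_num))) =
        (c.restMomOpenChart (legendreMap η L b)).2.2 := by
    intro b hbt
    have hbt' : b.target = a.target := by
      rw [← Jet.target_trunc 1 (by norm_num) b, hbt, Jet.target_trunc]
    rw [hleg b hbt']
    funext K α
    exact congrArg (partialU K.toLE α F) (hjet b hbt).2.symm
  -- The right inverse: `Υ` at the point with these coordinates of order at most one, the fixed
  -- momenta `p^i` of `q` and variable `p^I`, keeping only the second-order coordinates.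
  set s : (MultiIndexTwo m → Fin n → ℝ) → (MultiIndexTwo m → Fin n → ℝ) := fun p K =>
    (c.jetCoord (Υ (c.restMomOpenChart.symm (v₁, (r.1, p))))).2 (K.toLE.castLE (by norm_num))
    with hs
  have hmem : ∀ p, (v₁, (r.1, p)) ∈ c.restMomOpenChart.target := fun p => ⟨hv₁t, trivial⟩
  have hsd : ContDiff ℝ ∞ s := by
    rw [contDiff_iff_contDiffAt]
    intro p
    have h1 := (hΥ.contDiffAt_jetCoord c (hmem p)).comp p
      (f := fun p => (v₁, (r.1, p))) (by fun_prop)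
    refine contDiffAt_pi.2 fun K => ?_
    exact contDiffAt_pi.1 (contDiff_snd.contDiffAt.comp p h1) _
  -- This is the `p^I` component of the statement that `Υ` is a section of the Legendre map.
  have hGs : ∀ p, G (s p) = p := by
    intro p
    have h1 := c.restMomOpenChart.map_target (hmem p)
    have h2 := c.restMomOpenChart.right_inv (hmem p)
    have h3 : (c.restMomOpenChart.symm (v₁, (r.1, p))).proj = a.trunc 1 (by norm_num) :=
      (c.jetOpenChart 1).injOn h1 hc1 (congrArg Prod.fst h2)
    rw [hs, hGb _ ((hΥ.proj_eq _).symm.trans h3), hΥ.2, h2]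
  have hinj := injective_of_contDiff_rightInverse hGd (hsd.of_le (by simp)) hGs
  have hbt : (Υ q).trunc 1 (by norm_num) = a.trunc 1 (by norm_num) :=
    (hΥ.proj_eq q).symm.trans hproj
  -- Both `Υ q` and `a` have Legendre image `q` and lie over the same point of `J¹π`, so injectivity
  -- equates their second-order coordinates.
  have hu := hinj ((hGb _ hbt).trans ((congrArg (fun z => (c.restMomOpenChart z).2.2)
    (hΥ.2 q)).trans (hGb a rfl).symm))
  have h1 := hjet _ hbt
  have h2 := hjet a rfl
  have h3 : ((Υ q).trunc 2 (by norm_num)).target ∈ c.total.source :=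
    (congrArg (· ∈ c.total.source) (Jet.target_trunc 2 (by norm_num) _)).mpr h1.1
  have h4 : (a.trunc 2 (by norm_num)).target ∈ c.total.source :=
    (congrArg (· ∈ c.total.source) (Jet.target_trunc 2 (by norm_num) _)).mpr h2.1
  refine (c.jetOpenChart 2).injOn (c.mem_jetOpenChart_source.2 h3)
    (c.mem_jetOpenChart_source.2 h4) ?_
  rw [c.jetOpenChart_apply, c.jetOpenChart_apply, c.jetCoord_trunc 2 (by norm_num) h1.1,
    c.jetCoord_trunc 2 (by norm_num) h2.1, h1.2, h2.2, hu]

end Hyperregular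

/-! ### From holonomic solutions of the unified equation to the Hamiltonian equation -/

section UnifiedSolutions

variable {m n : ℕ}

/-- By the chain rule the test vectors `dΦ(X)` are among the vectors `dΨ(Y)`, and the tangent
vectors of the two sections have the same images. The map `Λ` need not be onto in this direction. -/
lemma LocalFieldEq.of_comp {V W : Type*} [NormedAddCommGroup V] [NormedSpace ℝ V]
    [NormedAddCommGroup W] [NormedSpace ℝ W] {Φ : V → JetModel m n 1 × ExtMomModel m n}
    {Ψ : W → JetModel m n 1 × ExtMomModel m n} {Λ : V → W} {s : (Fin m → ℝ) → V}
    {r : (Fin m → ℝ) → W} {y : Fin m → ℝ} (hΨ : DifferentiableAt ℝ Ψ (r y))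
    (hΛ : DifferentiableAt ℝ Λ (s y)) (hs : DifferentiableAt ℝ s y)
    (hΦ : Φ =ᶠ[𝓝 (s y)] Ψ ∘ Λ) (hr : Λ ∘ s =ᶠ[𝓝 y] r) (h : LocalFieldEq Ψ r y) :
    LocalFieldEq Φ s y := by
  have hy : Λ (s y) = r y := hr.self_of_nhds
  have h1 : ∀ X, fderiv ℝ Φ (s y) X = fderiv ℝ Ψ (r y) (fderiv ℝ Λ (s y) X) := by
    intro X
    rw [hΦ.fderiv_eq, fderiv_comp _ (hy ▸ hΨ) hΛ, hy]
    rfl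
  have h2 : ∀ X, fderiv ℝ Λ (s y) (fderiv ℝ s y X) = fderiv ℝ r y X := by
    intro X
    rw [← hr.fderiv_eq, fderiv_comp _ hΛ hs]
    rfl
  intro X
  simp only [h1, h2]
  exact h _

/-- Surjectivity lets every test vector be lifted. Applied with `truncFst`, it discards the third
derivatives, on which `cartanModel ∘ truncFst` does not depend. -/
lemma LocalFieldEq.of_comp_clm {V W : Type*} [NormedAddCommGroup V] [NormedSpace ℝ V]
    [NormedAddCommGroup W] [NormedSpace ℝ W] {Ψ : W → JetModel m n 1 × ExtMomModel m n}
    {T : V →L[ℝ] W} (hT : Function.Surjective T) {s : (Fin m → ℝ) → V} {y : Fin m → ℝ}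
    (hΨ : DifferentiableAt ℝ Ψ (T (s y))) (hs : DifferentiableAt ℝ s y)
    (h : LocalFieldEq (Ψ ∘ T) s y) : LocalFieldEq Ψ (fun z => T (s z)) y := by
  have h1 : ∀ X, fderiv ℝ (Ψ ∘ T) (s y) X = fderiv ℝ Ψ (T (s y)) (T X) := by
    intro X
    rw [fderiv_comp _ hΨ T.differentiableAt, T.fderiv]
    rfl
  have h2 : ∀ X, fderiv ℝ (fun z => T (s z)) y X = T (fderiv ℝ s y X) := by
    intro X
    exact congrArg (fun L => L X) (T.hasFDerivAt.comp y hs.hasFDerivAt).fderiv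
  intro X
  obtain ⟨X', rfl⟩ := hT X
  have h3 := h X'
  simp only [h1] at h3
  simp only [h2]
  exact h3

lemma truncFst_surjective : Function.Surjective (truncFst m n) := by
  rintro ⟨v, r⟩
  refine ⟨((v.1, fun I => if h : ∑ i, I.1 i ≤ 2 then v.2 ⟨I.1, h⟩ else 0), r), ?_⟩
  refine Prod.ext (Prod.ext rfl (funext fun I => ?_)) rfl
  exact dif_pos I.2

variable {B : FieldBundle m n} {η : VolumeForm B} {L : Jet B 2 → ℝ} {Υ : RestMom B → Jet B 3}

/-- The local expression of a section of `𝒲_r → M` in natural coordinates. -/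
def localUnifiedSection (c : B.Chart) (ψ : B.M → RestUnified B) (y : Fin m → ℝ) :
    JetModel m n 3 × RestMomModel m n :=
  c.restUnifiedOpenChart (ψ (c.base.symm y))

lemma localUnifiedSection_base (c : B.Chart) (ψ : B.M → RestUnified B) {x : B.M}
    (hx : x ∈ c.base.source) :
    localUnifiedSection c ψ (c.base x) = c.restUnifiedOpenChart (ψ x) :=
  congrArg (fun z => c.restUnifiedOpenChart (ψ z)) (c.base.left_inv hx)

/-- Carries a property that holds near a point of the base to coordinates; the round trip through
the chart is recorded so that pointwise results at `c.base (c.base.symm y)` can be read at `y`. -/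
lemma eventually_base_symm (c : B.Chart) {x : B.M} (hx : x ∈ c.base.source) {p : B.M → Prop}
    (hp : ∀ᶠ z in 𝓝 x, p z) :
    ∀ᶠ y in 𝓝 (c.base x), c.base (c.base.symm y) = y ∧ p (c.base.symm y) := by
  have hy := c.base.map_source hx
  have h1 := (c.base.continuousAt_symm hy).tendsto
  rw [c.base.left_inv hx] at h1
  filter_upwards [h1.eventually hp, c.base.open_target.mem_nhds hy] with y hy1 hy2
  exact ⟨c.base.right_inv hy2, hy1⟩

lemma differentiableAt_localUnifiedSection (c : B.Chart) {ψ : B.M → RestUnified B} {x : B.M}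
    (hψ : MDifferentiableAt (𝓡 m) 𝓘(ℝ, JetModel m n 3 × RestMomModel m n) ψ x)
    (hxb : x ∈ c.base.source) (hx : (ψ x).rho1.target ∈ c.total.source) :
    DifferentiableAt ℝ (localUnifiedSection c ψ) (c.base x) := by
  rw [← mdifferentiableAt_iff_differentiableAt]
  have h1 : c.base.symm (c.base x) = x := c.base.left_inv hxb
  refine MDifferentiableAt.comp (g := c.restUnifiedOpenChart)
    (I' := 𝓘(ℝ, JetModel m n 3 × RestMomModel m n)) (c.base x) ?_
    (MDifferentiableAt.comp (g := ψ) (I' := 𝓡 m) (c.base x) ?_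
      (c.mdifferentiableAt_base_symm (c.base.map_source hxb)))
  · rw [h1]
    exact ((contMDiffOn_of_mem_maximalAtlas c.restUnifiedOpenChart_mem).contMDiffAt
      (c.restUnifiedOpenChart.open_source.mem_nhds hx)).mdifferentiableAt (by simp)
  · rw [h1]
    exact hψ

/-- The unified field equation in natural coordinates. -/
lemma SolvesUnified.localFieldEq (hL : ContMDiff 𝓘(ℝ, JetModel m n 2) 𝓘(ℝ, ℝ) ∞ L)
    {ψ : B.M → RestUnified B} {U : Set B.M} (h : SolvesUnified η L ψ U) (c : B.Chart) {x : B.M}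
    (hxU : x ∈ U) (hψ : MDifferentiableAt (𝓡 m) 𝓘(ℝ, JetModel m n 3 × RestMomModel m n) ψ x)
    (hxb : x ∈ c.base.source) (hx : (ψ x).rho1.target ∈ c.total.source) :
    LocalFieldEq (cartanModel (localLagrangian η L c) ∘ truncFst m n) (localUnifiedSection c ψ)
      (c.base x) := by
  have h1 : (hamSection η L (ψ x)).rho2.1.target ∈ c.total.source :=
    (congrArg (· ∈ c.total.source) (target_rho2_hamSection η L (ψ x))).mpr hx
  have h2 : LocalFieldEq (fun z => c.extMomOpenChart
      (hamSection η L (c.restUnifiedOpenChart.symm z)).rho2) (localUnifiedSection c ψ)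
      (c.base x) :=
    (forall_isVectorField_iff (F := fun w => (hamSection η L w).rho2)
      c.restUnifiedOpenChart_mem hx c.extMomOpenChart_mem h1
      (multisymplecticForm_eq c h1)
      ((contMDiff_rho2_hamSection η hL _).mdifferentiableAt (by simp)) hψ hxb
      (c.mdifferentiableAt_base hxb) (c.mdifferentiableAt_base_symm (c.base.map_source hxb))).1
      fun X hX => h X hX x hxU
  refine (LocalFieldEq.congr ?_ Filter.EventuallyEq.rfl).1 h2
  rw [localUnifiedSection_base c ψ hxb]
  filter_upwards [c.restUnifiedOpenChart.open_target.mem_nhds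
    (c.restUnifiedOpenChart.map_source hx)] with v hv
  rw [extMomOpenChart_hamSection η L c (c.restUnifiedOpenChart.map_target hv),
    c.restUnifiedOpenChart.right_inv hv]
  rfl

section Holonomic

variable {ψ : B.M → RestUnified B} {U : Set B.M}

lemma RestUnified.IsSectionOn.mdifferentiableAt (hψ : RestUnified.IsSectionOn ψ U) (hU : IsOpen U)
    {x : B.M} (hx : x ∈ U) :
    MDifferentiableAt (𝓡 m) 𝓘(ℝ, JetModel m n 3 × RestMomModel m n) ψ x :=
  (hψ.1.contMDiffAt (hU.mem_nhds hx)).mdifferentiableAt (by simp)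

lemma RestUnified.IsSectionOn.eventually_mem (hψ : RestUnified.IsSectionOn ψ U) (hU : IsOpen U)
    (c : B.Chart) {x : B.M} (hxU : x ∈ U) (hx : (ψ x).rho1.target ∈ c.total.source) :
    ∀ᶠ z in 𝓝 x, z ∈ U ∧ (ψ z).rho1.target ∈ c.total.source := by
  have h1 : ContinuousAt ψ x := (hψ.mdifferentiableAt hU hxU).continuousAt
  filter_upwards [hU.mem_nhds hxU, h1 (c.restUnifiedOpenChart.open_source.mem_nhds hx)]
    with z hz hz'
  exact ⟨hz, hz'⟩

lemma RestUnified.IsSectionOn.mem_base (hψ : RestUnified.IsSectionOn ψ U) (c : B.Chart)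
    {x : B.M} (hxU : x ∈ U) (hx : (ψ x).rho1.target ∈ c.total.source) : x ∈ c.base.source :=
  hψ.2 x hxU ▸ mem_base_source c hx

/-- At each nearby point the jet is that of the same section `φ`, so the jet coordinates are the
partial derivatives of a single function. -/
lemma RestUnified.IsHolonomicOn.eventually_fst_eq (hh : RestUnified.IsHolonomicOn ψ U)
    (hψ : RestUnified.IsSectionOn ψ U) (hU : IsOpen U)
    (c : B.Chart) {x : B.M} (hxU : x ∈ U) (hx : (ψ x).rho1.target ∈ c.total.source) :
    ∀ᶠ y in 𝓝 (c.base x), (localUnifiedSection c ψ y).1 =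
      (y, fun I => mpderiv I.1 (c.localRep fun z => (ψ z).rho1.target) y) := by
  filter_upwards [eventually_base_symm c (hψ.mem_base c hxU hx) (hψ.eventually_mem hU c hxU hx)]
    with y hy
  obtain ⟨h1, h2⟩ := hh _ hy.2.1
  change c.jetCoord (ψ (c.base.symm y)).rho1 = _
  rw [h2, c.jetCoord_mk _ hy.2.2]
  dsimp only
  rw [hy.1]

/-- On a holonomic solution of the unified field equation, the momenta are given by the Legendre
map. -/
lemma SolvesUnified.legendreMap_eq (h : SolvesUnified η L ψ U)
    (hL : ContMDiff 𝓘(ℝ, JetModel m n 2) 𝓘(ℝ, ℝ) ∞ L) (hψ : RestUnified.IsSectionOn ψ U)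
    (hh : RestUnified.IsHolonomicOn ψ U) (hU : IsOpen U) {x : B.M} (hxU : x ∈ U) :
    legendreMap η L (ψ x).rho1 = (ψ x).rho2 := by
  obtain ⟨h1, h2⟩ := restMomOpenChart_legendreMap η L (ψ x).rho1
  have hc := (B.exists_chart (ψ x).rho1.target).choose_spec
  generalize (B.exists_chart (ψ x).rho1.target).choose = c at hc h1 h2
  have hxb := hψ.mem_base c hxU hc
  have hev := eventually_base_symm c hxb (hψ.eventually_mem hU c hxU hc)
  have hfst := hh.eventually_fst_eq hψ hU c hxU hc
  have hd : ∀ᶠ y in 𝓝 (c.base x), DifferentiableAt ℝ (localUnifiedSection c ψ) y := by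
    filter_upwards [hev] with y hy
    have h3 := differentiableAt_localUnifiedSection c (hψ.mdifferentiableAt hU hy.2.1)
      (hψ.mem_base c hy.2.1 hy.2.2) hy.2.2
    rwa [hy.1] at h3
  have hsec : IsSectionNear B (fun z => (ψ z).rho1.target) x := (hh x hxU).1
  -- The chart is the one used in the definition of `legendreMap` at this jet, so the coordinate
  -- identity gives equality of points directly.
  have key := eq_legendreCoord (G := localLagrangian η L c) (s := localUnifiedSection c ψ)
    (y := c.base x) ?_ hd (hfst.mono fun y hy => congrArg Prod.fst hy) ?_ ?_
  · refine c.restMomOpenChart.injOn (c.mem_restMomOpenChart_source.2 h1) ?_ ?_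
    · exact c.mem_restMomOpenChart_source.2
        ((congrArg (· ∈ c.total.source) (Jet.target_trunc 1 (by norm_num) (ψ x).1)).mpr hc)
    · rw [localUnifiedSection_base c ψ hxb] at key
      rw [h2, restMomOpenChart_rho2 c hc, key]
      exact Prod.ext (c.jetCoord_trunc 1 (by norm_num) hc) rfl
  · filter_upwards [hev] with y hy
    exact contDiffAt_localLagrangian η hL c (jetCoord_mem_target_of_mem c hy.2.2)
  -- Holonomy in coordinates: the derivative of the component `I` along the section is the component
  -- `I + 1_j`.
  · intro j I
    have h3 := hd.self_of_nhds
    have h4 : fderiv ℝ (fun y => (localUnifiedSection c ψ y).1) (c.base x) (Pi.single j 1) =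
        (fderiv ℝ (localUnifiedSection c ψ) (c.base x) (Pi.single j 1)).1 :=
      congrArg (fun L => L (Pi.single j 1)) h3.hasFDerivAt.fst.fderiv
    have h5 : (fun y => (localUnifiedSection c ψ y).1) =ᶠ[𝓝 (c.base x)] fun y =>
      (y, fun I => mpderiv I.1 (c.localRep fun z => (ψ z).rho1.target) y) := hfst
    rw [← h4, h5.fderiv_eq, fderiv_mpderiv_localRep c hsec hc 3 j, hfst.self_of_nhds]
    rfl
  · filter_upwards [hev] with y hy
    have h3 := h.localFieldEq hL c hy.2.1 (hψ.mdifferentiableAt hU hy.2.1)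
      (hψ.mem_base c hy.2.1 hy.2.2) hy.2.2
    rwa [hy.1] at h3

lemma RestUnified.IsSectionOn.rho2 (hψ : RestUnified.IsSectionOn ψ U) :
    RestMom.IsSectionOn (fun x => (ψ x).rho2) U := by
  refine ⟨contMDiff_rho2.comp_contMDiffOn hψ.1, fun x hx => ?_⟩
  refine Eq.trans ?_ (hψ.2 x hx)
  change ((ψ x).1.trunc 1 (by norm_num)).source = (ψ x).1.source
  rw [← Jet.proj_target, Jet.target_trunc, Jet.proj_target]

/-- A holonomic solution of the unified field equation projects to a solution of the Hamiltonian
field equation. -/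
lemma SolvesUnified.solvesHamilton (h : SolvesUnified η L ψ U) (hΥ : IsLegendreSection η L Υ)
    (hL : ContMDiff 𝓘(ℝ, JetModel m n 2) 𝓘(ℝ, ℝ) ∞ L) (hψ : RestUnified.IsSectionOn ψ U)
    (hh : RestUnified.IsHolonomicOn ψ U) (hU : IsOpen U) :
    SolvesHamilton η L Υ (fun x => (ψ x).rho2) U := by
  intro X hX x hxU
  obtain ⟨c, hc⟩ := B.exists_chart (ψ x).rho1.target
  have hmem : ∀ z, (ψ z).rho1.target ∈ c.total.source →
      (ψ z).rho2.proj.target ∈ c.total.source := fun z hz =>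
    (congrArg (· ∈ c.total.source) (Jet.target_trunc 1 (by norm_num) (ψ z).1)).mpr hz
  have hxb := hψ.mem_base c hxU hc
  have hσ := (hψ.rho2.1.contMDiffAt (hU.mem_nhds hxU)).mdifferentiableAt (n := ∞) (by simp)
  refine (hΥ.solvesHamilton_at_iff hL c hσ hxb (hmem x hc)).2 ?_ X hX
  have hψx := hψ.mdifferentiableAt hU hxU
  have hs := differentiableAt_localSection c hσ hxb (hmem x hc)
  have hsr := differentiableAt_localUnifiedSection c hψx hxb hc
  have hG : DifferentiableAt ℝ (cartanModel (localLagrangian η L c))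
      (truncFst m n (localUnifiedSection c ψ (c.base x))) := by
    rw [localUnifiedSection_base c ψ hxb]
    exact (contDiffAt_cartanModel (contDiffAt_localLagrangian η hL c
      (jetCoord_mem_target_of_mem c hc))).differentiableAt (by simp)
  have hsx : c.localSection (fun x => (ψ x).rho2) (c.base x) = c.restMomOpenChart (ψ x).rho2 :=
    congrArg (fun z => c.restMomOpenChart (ψ z).rho2) (c.base.left_inv hxb)
  have hst := c.restMomOpenChart.map_source (c.mem_restMomOpenChart_source.2 (hmem x hc))
  -- In coordinates `Λ` sends `q` to the second-order part of `Υ q` together with the momenta of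
  -- `q`. Then `h` is `cartanModel ∘ Λ`, and `Λ` maps the projected section to the second-order
  -- truncation of `ψ`. The truncation is essential, because third derivatives of `Υ q` and of `ψ`
  -- need not agree.
  refine LocalFieldEq.of_comp (Λ := fun v => truncFst m n
    (c.jetCoord (Υ (c.restMomOpenChart.symm v)), v.2)) hG ?_ hs ?_ ?_
    ((h.localFieldEq hL c hxU hψx hxb hc).of_comp_clm truncFst_surjective hG hsr)
  · rw [hsx]
    exact (truncFst m n).differentiableAt.comp _
      (((hΥ.contDiffAt_jetCoord c hst).differentiableAt (by simp)).prodMk differentiableAt_snd)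
  · rw [hsx]
    filter_upwards [c.restMomOpenChart.open_target.mem_nhds hst] with v hv
    rw [localHamiltonianSection, hΥ.extMomOpenChart_hamiltonianSection c
      (c.restMomOpenChart.map_target hv), c.restMomOpenChart.right_inv hv]
    rfl
  · filter_upwards [eventually_base_symm c hxb (hψ.eventually_mem hU c hxU hc)] with y hy
    have h1 := c.mem_restMomOpenChart_source.2 (hmem _ hy.2.2)
    have h2 : (Υ (ψ (c.base.symm y)).rho2).target ∈ c.total.source :=
      (congrArg (· ∈ c.total.source) (hΥ.target_eq _)).mpr h1
    -- The momenta of `ψ` are the Legendre image of its jet, so `Υ` applied to the projected section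
    -- recovers that jet up to order two.
    have h3 := hΥ.trunc_two_eq hL (ψ (c.base.symm y)).rho1
    rw [h.legendreMap_eq hL hψ hh hU hy.2.1] at h3
    have h4 := congrArg c.jetCoord h3
    rw [c.jetCoord_trunc 2 (by norm_num) h2, c.jetCoord_trunc 2 (by norm_num) hy.2.2] at h4
    refine Prod.ext ?_ rfl
    change truncModel 2 (by norm_num) (c.jetCoord (Υ (c.restMomOpenChart.symm
      (c.restMomOpenChart (ψ (c.base.symm y)).rho2)))) = _
    rw [c.restMomOpenChart.left_inv h1]
    exact h4

end Holonomic

end UnifiedSolutions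

end FieldTheory

end

theorem mainTheorem10 {m n : ℕ} (B : FieldBundle m n) (η : VolumeForm B) (L : Jet B 2 → ℝ)
    (hL : ContMDiff 𝓘(ℝ, JetModel m n 2) 𝓘(ℝ, ℝ) ∞ L)
    (Υ : RestMom B → Jet B 3) (hΥ : IsLegendreSection η L Υ)
    (U : Set B.M) (hU : IsOpen U) :
    (∀ ψ : B.M → RestUnified B, RestUnified.IsSectionOn ψ U → RestUnified.IsHolonomicOn ψ U →
      SolvesUnified η L ψ U →
        RestMom.IsSectionOn (fun x => (ψ x).rho2) U ∧
        SolvesHamilton η L Υ (fun x => (ψ x).rho2) U ∧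
        SolvesHamiltonDeDonderWeyl η L Υ (fun x => (ψ x).rho2) U) ∧
    ∀ σ : B.M → RestMom B, RestMom.IsSectionOn σ U →
      (SolvesHamilton η L Υ σ U ↔ SolvesHamiltonDeDonderWeyl η L Υ σ U) := by
  refine ⟨fun ψ hψ hh h => ?_, fun σ hσ => hΥ.solvesHamilton_iff hL hU hσ⟩
  have h1 := h.solvesHamilton hΥ hL hψ hh hU
  exact ⟨hψ.rho2, h1, (hΥ.solvesHamilton_iff hL hU hψ.rho2).1 h1⟩
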